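/- Let $L$ be a five-dimensional complex vector space, $V = L^\vee\oplus L$ with the inner product $\langle (f,l),(g,m)\rangle = f(m)+g(l)$, and $S_+=\wedge^{\mathrm{even}}L^\vee$ the positive half-spin representation of $\mathrm{Spin}(V)$, where $(f,l)\in V$ acts on $\wedge^\bullet L^\vee$ by Clifford multiplication $\psi\mapsto f\wedge\psi+ l\lrcorner\psi$. Let $\gamma:\mathrm{Sym}^2 S_+\to V$ be the projection (unique up to scale) to the vector representation. Let $W$ be a two-dimensional complex vector space with a non-degenerate symmetric bilinear form $(-,-)_W$, and equip $(S_+\otimes W)\oplus V$ with the bracket $[\psi\otimes w,\psi'\otimes w']=\gamma(\psi,\psi')\,(w,w')_W$ of odd elements. A spinor $\psi$ is pure if $\{v\in V: v\cdot\psi=0\}$ is a maximal isotropic subspace of $V$. Let $Q\in S_+\otimes W$, viewed as a linear map $W^\vee\to S_+$, have rank two, and suppose that every non-zero element of its image $S_Q$ is pure, i.e. the line $\mathbb P(S_Q)$ lies in the pure spinor variety. Then the following hold. 1. The image $E$ of $[Q,-]:S_+\otimes W\to V$ has dimension $7$, so three translations survive: $\dim V/E=3$. 2. The twist by $Q$ lives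 on $\mathbb C^3\times\mathbb R^4$: for every Euclidean real form $\mathbb R^{10}\subset V$ (i.e. $\langle-,-\rangle$ restricts to the Euclidean inner product of $\mathbb R^{10}$) there is a linear isometry $\mathbb R^{10}\cong\mathbb C^3\times\mathbb R^4$ under which $E\subset V=\mathbb R^{10}\otimes\mathbb C$ is spanned by the antiholomorphic translations of $\mathbb C^3$ and all translations of $\mathbb R^4$. 3. Let $\mathrm{Stab}(Q)$ be the stabilizer of $Q$ in $\mathrm{Spin}(V)\times \mathrm O(W)$, and let $\mathrm{Stab}_0(Q)$ be the stabilizer of $Q$ in $\mathrm{Spin}(V)\times\mathrm{SO}(W)$. Then $\mathrm{Stab}_0(Q)$ has index $2$ in $\mathrm{Stab}(Q)$, and $$\mathrm{Stab}_0(Q)\;\cong\;(\mathrm{SL}(3)\times\mathrm{SL}(2)\times\mathbb C^\times)\ltimes N_{15},$$ where $N_{15}$ is a nilpotent group of dimension $15$. More precisely, $\mathrm{Stab}_0(Q)$ has a normal nilpotent subgroup $N_{15}$, isomorphic to $\mathbb C^{15}$ as a variety, and a complementary subgroup isomorphic to $\mathrm{SL}(3)\times\mathrm{SL}(2)\times\mathbb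 C^\times$ as a complex algebraic group. Here $N_{15}$ acts trivially on $W$, and an element of $\mathrm{SL}(3)\times\mathrm{SL}(2)\times\mathbb C^\times$ acts trivially on $W$ if and only if its component in $\mathbb C^\times$ is $1$; so the elements of $\mathrm{Stab}(Q)$ that act trivially on $W$ form $(\mathrm{SL}(3)\times\mathrm{SL}(2))\ltimes N_{15}$. -/

import Mathlib

open scoped TensorProduct

noncomputable section

namespace IIB

section Vector

variable (L : Type*) [AddCommGroup L] [Module ℂ L]

/-- The vector representation `V = L^∨ ⊕ L`. -/
abbrev Vec : Type _ := Module.Dual ℂ L × L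

/-- The quadratic form `(f, l) ↦ f l` on `V`. Its polar form `LinearMap.dualProd ℂ L` is the inner
product `⟨(f, l), (g, m)⟩ = f m + g l`, for which `L` and `L^∨` are maximally isotropic and dual. -/
abbrev vecForm : QuadraticForm ℂ (Vec L) := QuadraticForm.dualProd ℂ L

/-- The Dirac spinors `∧^• L^∨`. -/
abbrev Spinor : Type _ := ExteriorAlgebra ℂ (Module.Dual ℂ L)

/-- The positive chirality spinors `S_+ = ∧^even L^∨`. -/
abbrev SPlus : Submodule ℂ (Spinor L) :=
  CliffordAlgebra.evenOdd (0 : QuadraticForm ℂ (Module.Dual ℂ L)) 0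

variable {L}

/-- Contraction of a form in `∧^• L^∨` with a vector of `L`. -/
def contract (l : L) : Spinor L →ₗ[ℂ] Spinor L :=
  CliffordAlgebra.contractLeft (Q := (0 : QuadraticForm ℂ (Module.Dual ℂ L)))
    (Module.Dual.eval ℂ L l)

/-- Clifford multiplication of a vector on spinors: `(f, l) · ψ = f ∧ ψ + l ⌟ ψ`. -/
def cliffordMul : Vec L →ₗ[ℂ] Module.End ℂ (Spinor L) where
  toFun v := LinearMap.mulLeft ℂ (ExteriorAlgebra.ι ℂ v.1) + contract v.2
  map_add' v w := by
    ext ψ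
    simp [contract, add_mul]
    abel
  map_smul' c v := by
    ext ψ
    simp [contract]

theorem cliffordMul_apply (v : Vec L) (ψ : Spinor L) :
    cliffordMul v ψ = ExteriorAlgebra.ι ℂ v.1 * ψ + contract v.2 ψ := rfl

theorem contract_ι_mul (l : L) (f : Module.Dual ℂ L) (ψ : Spinor L) :
    contract l (ExteriorAlgebra.ι ℂ f * ψ) = f l • ψ - ExteriorAlgebra.ι ℂ f * contract l ψ :=
  CliffordAlgebra.contractLeft_ι_mul _ _ _

theorem cliffordMul_sq (v : Vec L) :
    cliffordMul v * cliffordMul v = algebraMap ℂ (Module.End ℂ (Spinor L)) (vecForm L v) := by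
  apply LinearMap.ext
  intro ψ
  have h1 : contract v.2 (contract v.2 ψ) = 0 := CliffordAlgebra.contractLeft_contractLeft _ _
  have h2 : ExteriorAlgebra.ι ℂ v.1 * (ExteriorAlgebra.ι ℂ v.1 * ψ) = 0 := by
    rw [← mul_assoc, ExteriorAlgebra.ι_sq_zero, zero_mul]
  simp only [Module.End.mul_apply, cliffordMul_apply, map_add, contract_ι_mul, h1, h2,
    Module.algebraMap_end_apply, QuadraticForm.dualProd_apply]
  abel

variable (L) in
/-- The spinor representation of the Clifford algebra. -/
def spinorRep : CliffordAlgebra (vecForm L) →ₐ[ℂ] Module.End ℂ (Spinor L) :=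
  CliffordAlgebra.lift (vecForm L) ⟨cliffordMul, cliffordMul_sq⟩

theorem contract_mem (l : L) (n : ZMod 2) (ψ : Spinor L)
    (hψ : ψ ∈ CliffordAlgebra.evenOdd (0 : QuadraticForm ℂ (Module.Dual ℂ L)) n) :
    contract l ψ ∈ CliffordAlgebra.evenOdd (0 : QuadraticForm ℂ (Module.Dual ℂ L)) (1 + n) := by
  induction ψ, hψ using CliffordAlgebra.evenOdd_induction with
  | range_ι_pow v h =>
    obtain rfl | rfl : n = 0 ∨ n = 1 := by clear h; revert n; decide
    · rw [ZMod.val_zero, pow_zero] at h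
      obtain ⟨r, rfl⟩ := Submodule.mem_one.mp h
      have : contract l (algebraMap ℂ (Spinor L) r) = 0 :=
        CliffordAlgebra.contractLeft_algebraMap (Q := (0 : QuadraticForm ℂ (Module.Dual ℂ L)))
          (Module.Dual.eval ℂ L l) r
      exact this ▸ Submodule.zero_mem _
    · rw [show ZMod.val (1 : ZMod 2) = 1 from rfl, pow_one] at h
      obtain ⟨f, rfl⟩ := h
      have : contract l (CliffordAlgebra.ι (0 : QuadraticForm ℂ (Module.Dual ℂ L)) f)
          = algebraMap ℂ (Spinor L) (f l) :=
        CliffordAlgebra.contractLeft_ι (Q := (0 : QuadraticForm ℂ (Module.Dual ℂ L)))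
          (Module.Dual.eval ℂ L l) f
      rw [this, show (1 : ZMod 2) + 1 = 0 from rfl]
      exact SetLike.algebraMap_mem_graded
        (CliffordAlgebra.evenOdd (0 : QuadraticForm ℂ (Module.Dual ℂ L))) _
  | add x y hx hy ihx ihy => rw [map_add]; exact Submodule.add_mem _ ihx ihy
  | ι_mul_ι_mul f g x hx ih =>
    have e : contract l (CliffordAlgebra.ι (0 : QuadraticForm ℂ (Module.Dual ℂ L)) f *
        CliffordAlgebra.ι (0 : QuadraticForm ℂ (Module.Dual ℂ L)) g * x) =
        f l • (CliffordAlgebra.ι (0 : QuadraticForm ℂ (Module.Dual ℂ L)) g * x) -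
        (CliffordAlgebra.ι (0 : QuadraticForm ℂ (Module.Dual ℂ L)) f * (g l • x) -
          CliffordAlgebra.ι (0 : QuadraticForm ℂ (Module.Dual ℂ L)) f *
            CliffordAlgebra.ι (0 : QuadraticForm ℂ (Module.Dual ℂ L)) g * contract l x) := by
      have h1 := contract_ι_mul l f (CliffordAlgebra.ι
        (0 : QuadraticForm ℂ (Module.Dual ℂ L)) g * x)
      have h2 := contract_ι_mul l g x
      simp only [ExteriorAlgebra.ι] at h1 h2
      rw [mul_assoc, h1, h2, mul_sub, mul_assoc]
    rw [e]
    refine Submodule.sub_mem _ (Submodule.smul_mem _ _ ?_) (Submodule.sub_mem _ ?_ ?_)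
    · exact SetLike.mul_mem_graded (CliffordAlgebra.ι_mem_evenOdd_one _ _) hx
    · exact SetLike.mul_mem_graded (CliffordAlgebra.ι_mem_evenOdd_one _ _)
        (Submodule.smul_mem _ _ hx)
    · have := SetLike.mul_mem_graded (CliffordAlgebra.ι_mul_ι_mem_evenOdd_zero
        (0 : QuadraticForm ℂ (Module.Dual ℂ L)) f g) ih
      rwa [zero_add] at this

theorem cliffordMul_mem (v : Vec L) (n : ZMod 2) (ψ : Spinor L)
    (hψ : ψ ∈ CliffordAlgebra.evenOdd (0 : QuadraticForm ℂ (Module.Dual ℂ L)) n) :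
    cliffordMul v ψ ∈ CliffordAlgebra.evenOdd (0 : QuadraticForm ℂ (Module.Dual ℂ L)) (1 + n) :=
  Submodule.add_mem _ (SetLike.mul_mem_graded (CliffordAlgebra.ι_mem_evenOdd_one _ _) hψ)
    (contract_mem _ _ _ hψ)

theorem spinorRep_even_mem (x : CliffordAlgebra (vecForm L))
    (hx : x ∈ CliffordAlgebra.evenOdd (vecForm L) 0) (ψ : Spinor L) (hψ : ψ ∈ SPlus L) :
    spinorRep L x ψ ∈ SPlus L := by
  induction x, hx using CliffordAlgebra.even_induction with
  | algebraMap r =>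
    rw [AlgHom.commutes, Module.algebraMap_end_apply]
    exact Submodule.smul_mem _ _ hψ
  | add x y hx hy ihx ihy =>
    rw [map_add, LinearMap.add_apply]; exact Submodule.add_mem _ ihx ihy
  | ι_mul_ι_mul v w x hx ih =>
    have := cliffordMul_mem v _ _ (cliffordMul_mem w _ _ ih)
    rw [map_mul, map_mul, Module.End.mul_apply, Module.End.mul_apply]
    simpa [spinorRep, show (1 : ZMod 2) + 1 = 0 from rfl] using this

variable (L) in
/-- The representation of `Spin(V)` on `S_+`. -/
def halfSpinRep : spinGroup (vecForm L) →* Module.End ℂ (SPlus L) where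
  toFun g := (spinorRep L g.1).restrict fun ψ hψ => spinorRep_even_mem g.1 g.2.2 ψ hψ
  map_one' := by ext; simp [LinearMap.restrict_apply]
  map_mul' g h := by ext; simp [LinearMap.restrict_apply]

/-- `Ann(ψ) = {v ∈ V | v · ψ = 0}`. -/
def ann (ψ : Spinor L) : Submodule ℂ (Vec L) := LinearMap.ker (cliffordMul.flip ψ)

/-- All inner products of elements of `E` vanish. -/
def IsIsotropic (E : Submodule ℂ (Vec L)) : Prop :=
  ∀ v ∈ E, ∀ w ∈ E, LinearMap.dualProd ℂ L v w = 0

/-- A spinor is pure if its annihilator is a maximal isotropic subspace. -/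
def IsPure (ψ : Spinor L) : Prop := Maximal IsIsotropic (ann ψ)

/-- `Ω⁻¹ : ∧^• L^∨ → ℂ`, the coefficient of the top form `Ω = e₁^∨ ∧ ⋯ ∧ e₅^∨`: the degree zero
part of the contraction with `e₁, …, e₅`. -/
def topCoeff (e : Module.Basis (Fin 5) ℂ L) : Spinor L →ₗ[ℂ] ℂ :=
  (ExteriorAlgebra.algebraMapInv (R := ℂ) (M := Module.Dual ℂ L)).toLinearMap ∘ₗ
    contract (e 4) ∘ₗ contract (e 3) ∘ₗ contract (e 2) ∘ₗ contract (e 1) ∘ₗ contract (e 0)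

/-- The `Spin(V)`-invariant pairing of spinors `(ψ, φ) ↦ Ω⁻¹(ψᵗ ∧ φ)`, where `ψᵗ` is the
reversal of `ψ`. -/
def spinorPairing (e : Module.Basis (Fin 5) ℂ L) : Spinor L →ₗ[ℂ] Spinor L →ₗ[ℂ] ℂ :=
  ((LinearMap.mul ℂ (Spinor L)).compr₂ (topCoeff e)) ∘ₗ
    CliffordAlgebra.reverse (Q := (0 : QuadraticForm ℂ (Module.Dual ℂ L)))

/-- The projection `γ : Sym² S_+ → V`, up to scale: `γ(ψ, φ)` is the vector determined by
`⟨v, γ(ψ, φ)⟩ = (ψ, v · φ)` for all `v ∈ V`. Its `L^∨` component is therefore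
`l ↦ (ψ, l ⌟ φ)` and its `L` component is `∑ i, (ψ, eᵢ^∨ ∧ φ) eᵢ`. -/
def gamma (e : Module.Basis (Fin 5) ℂ L) : SPlus L →ₗ[ℂ] SPlus L →ₗ[ℂ] Vec L :=
  LinearMap.mk₂ ℂ
    (fun ψ φ =>
      ((spinorPairing e ψ.1 ∘ₗ cliffordMul.flip φ.1) ∘ₗ LinearMap.inr ℂ (Module.Dual ℂ L) L,
        ∑ i, spinorPairing e ψ.1 (cliffordMul (e.coord i, 0) φ.1) • e i))
    (fun ψ ψ' φ => by
      refine Prod.ext ?_ ?_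
      · ext l; simp
      · simp [add_smul, Finset.sum_add_distrib])
    (fun c ψ φ => by
      refine Prod.ext ?_ ?_
      · ext l; simp
      · simp [mul_smul, Finset.smul_sum])
    (fun ψ φ φ' => by
      refine Prod.ext ?_ ?_
      · ext l; simp
      · simp [add_smul, Finset.sum_add_distrib])
    (fun c ψ φ => by
      refine Prod.ext ?_ ?_
      · ext l; simp
      · simp [mul_smul, Finset.smul_sum])

/-- `γ(ψ, φ)` is characterised by `⟨v, γ(ψ, φ)⟩ = (ψ, v · φ)`. -/
theorem dualProd_gamma (e : Module.Basis (Fin 5) ℂ L) (v : Vec L) (ψ φ : SPlus L) :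
    LinearMap.dualProd ℂ L v (gamma e ψ φ) = spinorPairing e ψ.1 (cliffordMul v φ.1) := by
  have h1 : v = (v.1, 0) + (0, v.2) := by simp
  have h2 : (v.1, (0 : L)) = ∑ i, v.1 (e i) • ((e.coord i, 0) : Vec L) := by
    refine Prod.ext ?_ ?_
    · refine e.ext fun j => ?_
      simp [Prod.fst_sum]
    · simp [Prod.snd_sum]
  have h3 : spinorPairing e ψ.1 (cliffordMul v φ.1) =
      (∑ i, v.1 (e i) * spinorPairing e ψ.1 (cliffordMul (e.coord i, 0) φ.1)) +
        spinorPairing e ψ.1 (cliffordMul (0, v.2) φ.1) := by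
    conv_lhs => rw [h1, map_add, h2, map_sum]
    simp only [map_smul, LinearMap.add_apply, LinearMap.sum_apply, LinearMap.smul_apply, map_add,
      map_sum, smul_eq_mul]
  rw [h3]
  simp [gamma, mul_comm, add_comm]

/-- A Euclidean real form of `V`: a real-linear embedding of `ℝ¹⁰` along which the complex inner
product of `V` restricts to the Euclidean one (so that `V` is the complexification of `ℝ¹⁰`). -/
def IsEuclideanForm (j : EuclideanSpace ℝ (Fin 10) →ₗ[ℝ] Vec L) : Prop :=
  ∀ x y, LinearMap.dualProd ℂ L (j x) (j y) = ((inner ℝ x y : ℝ) : ℂ)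

/-- If `E ⊆ V` is the space of translations that become trivial in a twist, the twist lives on
`ℂᵃ × ℝᵇ`: there is an isometry of `ℂᵃ × ℝᵇ` with the Euclidean `ℝ¹⁰` under which `E` is spanned
by the antiholomorphic translations `∂_x + i ∂_y` of `ℂᵃ` together with all translations of `ℝᵇ`. -/
def LivesOn (E : Submodule ℂ (Vec L)) (a b : ℕ)
    (j : EuclideanSpace ℝ (Fin 10) →ₗ[ℝ] Vec L) : Prop :=
  ∃ φ : WithLp 2 (EuclideanSpace ℂ (Fin a) × EuclideanSpace ℝ (Fin b)) ≃ₗᵢ[ℝ]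
      EuclideanSpace ℝ (Fin 10),
    E = Submodule.span ℂ
      (Set.range (fun z : EuclideanSpace ℂ (Fin a) =>
          j (φ (WithLp.toLp 2 (z, 0))) +
            Complex.I • j (φ (WithLp.toLp 2 (Complex.I • z, 0)))) ∪
        Set.range (fun x : EuclideanSpace ℝ (Fin b) => j (φ (WithLp.toLp 2 (0, x)))))

end Vector

section Supercharges

variable {L : Type*} [AddCommGroup L] [Module ℂ L] {W : Type*} [AddCommGroup W] [Module ℂ W]

variable (L W) in
/-- The odd part `S_+ ⊗ W` of the supertranslation algebra. -/
abbrev Supercharge : Type _ := SPlus L ⊗[ℂ] W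

/-- The bracket `γ ⊗ (-,-)_W` of odd elements. -/
def bracket (e : Module.Basis (Fin 5) ℂ L) (B : LinearMap.BilinForm ℂ W) :
    Supercharge L W →ₗ[ℂ] Supercharge L W →ₗ[ℂ] Vec L :=
  (TensorProduct.map₂ (gamma e) B).compr₂ (TensorProduct.rid ℂ (Vec L)).toLinearMap

/-- A supercharge, viewed as a linear map `W^∨ → S_+`. -/
def toMap (Q : Supercharge L W) : Module.Dual ℂ W →ₗ[ℂ] SPlus L where
  toFun f := TensorProduct.rid ℂ (SPlus L) (LinearMap.lTensor (SPlus L) f Q)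
  map_add' f g := by simp [LinearMap.lTensor_add]
  map_smul' c f := by simp [LinearMap.lTensor_smul]

/-- The orthogonal group of a bilinear form. -/
def orthogonal (B : LinearMap.BilinForm ℂ W) : Subgroup (W ≃ₗ[ℂ] W) where
  carrier := {h | ∀ x y, B (h x) (h y) = B x y}
  mul_mem' {g h} hg hh x y := by
    simp only [Set.mem_ofPred_eq] at hg hh
    rw [LinearEquiv.mul_apply, LinearEquiv.mul_apply, hg, hh]
  one_mem' _ _ := rfl
  inv_mem' {h} hh x y := by
    have hx : ∀ z, h (h⁻¹ z) = z := fun z => h.apply_symm_apply z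
    have := hh (h⁻¹ x) (h⁻¹ y)
    rw [hx, hx] at this
    exact this.symm

variable (L) in
/-- The symmetry group `Spin(V) × O(W)`. -/
abbrev Sym (B : LinearMap.BilinForm ℂ W) : Type _ := spinGroup (vecForm L) × orthogonal B

variable (L) in
/-- The action of `Spin(V) × O(W)` on `S_+ ⊗ W`. -/
def superRep (B : LinearMap.BilinForm ℂ W) : Sym L B →* Module.End ℂ (Supercharge L W) where
  toFun p := TensorProduct.map (halfSpinRep L p.1) (p.2.1 : W →ₗ[ℂ] W)
  map_one' := by
    simp only [Prod.fst_one, map_one, Prod.snd_one, OneMemClass.coe_one]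
    exact TensorProduct.map_id
  map_mul' p q := by
    simp only [Prod.fst_mul, map_mul, Prod.snd_mul, Subgroup.coe_mul]
    exact TensorProduct.map_mul _ _ _ _

/-- The stabilizer of a supercharge in `Spin(V) × O(W)`. -/
def stab (B : LinearMap.BilinForm ℂ W) (Q : Supercharge L W) : Subgroup (Sym L B) where
  carrier := {p | superRep L B p Q = Q}
  mul_mem' {p q} hp hq := by
    simp only [Set.mem_ofPred_eq] at hp hq ⊢
    rw [map_mul, Module.End.mul_apply, hq, hp]
  one_mem' := by simp
  inv_mem' {p} hp := by
    simp only [Set.mem_ofPred_eq] at hp ⊢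
    conv_lhs => rw [← hp]
    rw [← Module.End.mul_apply, ← map_mul, inv_mul_cancel, map_one, Module.End.one_apply]

/-- The stabilizer of a supercharge in `Spin(V) × SO(W)`. -/
def specialStab (B : LinearMap.BilinForm ℂ W) (Q : Supercharge L W) : Subgroup (Sym L B) :=
  stab B Q ⊓ (LinearEquiv.det.comp ((orthogonal B).subtype.comp (MonoidHom.snd _ _))).ker

/-- The algebra of regular functions on a variety `X` mapping to `Spin(V) × O(W)`: it is generated
by the linear functions on the Clifford algebra (containing `Spin(V)`) and on `End W`
(containing `O(W)`). -/
def groupFunctions (B : LinearMap.BilinForm ℂ W) {X : Type*} (j : X → Sym L B) :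
    Subalgebra ℂ (X → ℂ) :=
  Algebra.adjoin ℂ
    (Set.range (fun (f : Module.Dual ℂ (CliffordAlgebra (vecForm L))) (x : X) => f (j x).1.1) ∪
      Set.range (fun (f : Module.Dual ℂ (Module.End ℂ W)) (x : X) =>
        f ((j x).2.1 : W →ₗ[ℂ] W)))

end Supercharges

section Algebraic

/-- The polynomial functions on affine `n`-space. -/
def affineFunctions (n : ℕ) : Subalgebra ℂ ((Fin n → ℂ) → ℂ) :=
  Algebra.adjoin ℂ (Set.range fun (i : Fin n) (x : Fin n → ℂ) => x i)

/-- The group `SL(3) × SL(2) × ℂˣ`. -/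
abbrev Levi : Type :=
  Matrix.SpecialLinearGroup (Fin 3) ℂ × Matrix.SpecialLinearGroup (Fin 2) ℂ × ℂˣ

/-- The regular functions on `SL(3) × SL(2) × ℂˣ`: polynomials in the matrix entries, in the
coordinate `t` of `ℂˣ` and in `t⁻¹`. -/
def leviFunctions : Subalgebra ℂ (Levi → ℂ) :=
  Algebra.adjoin ℂ
    (Set.range (fun (k : Fin 3 × Fin 3) (m : Levi) => m.1.1 k.1 k.2) ∪
      Set.range (fun (k : Fin 2 × Fin 2) (m : Levi) => m.2.1.1 k.1 k.2) ∪
      {fun m : Levi => (m.2.2 : ℂ), fun m : Levi => ((m.2.2⁻¹ : ℂˣ) : ℂ)})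

/-- A bijection of affine varieties, given by their algebras of regular functions, that is an
isomorphism of varieties: pulling back regular functions is a bijection of these algebras. -/
def IsBiregular {X Y : Type*} (RX : Subalgebra ℂ (X → ℂ)) (RY : Subalgebra ℂ (Y → ℂ))
    (Φ : X ≃ Y) : Prop :=
  ∀ u : Y → ℂ, u ∈ RY ↔ u ∘ Φ ∈ RX

end Algebraic

end IIB

end

/-!
Write the null basis `w₀, w₁` of `W`, with `(w₀, w₁) = 1`, and `Q = ψ₁ ⊗ w₀ + ψ₂ ⊗ w₁`. Since
`⟨v, γ(ψ, φ)⟩ = (ψ, v · φ)` and the pairing of spinors is non-degenerate, the orthogonal complement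
of the image `E` of `[Q, -]` is `K = Ann ψ₁ ∩ Ann ψ₂` (`orth_range_bracket`).

*Normal form.* A pure spinor is the vacuum of a Fock space: an annihilator `M` of `ψ₁`, an isotropic
complement of it, and the operators of creation and annihilation given by dual bases
(`FockFrame`). If `ψ₂` and `ψ₁ + ψ₂` are pure too, then `ψ₂ = q₀ q₁ ψ₁` for null vectors `q₀, q₁`,
and the frame can be chosen to contain them (`exists_fockFrame`). So `V` has a basis of `k₀, k₁, k₂`
spanning `K`, of `p₀, p₁` completing it to `Ann ψ₁`, of `q₀, q₁` completing it to `Ann ψ₂`, and of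
vectors `k'ᵢ` dual to the `kᵢ` (`AdaptedFrame`). In particular `dim K = 3`, so that `dim E = 7`.

*Real structure.* A Euclidean real form makes `V` a Hermitian space. As `K` is isotropic, real and
imaginary parts of a unitary basis of `K` are an orthonormal family, up to a factor `√2`. They span
the factor `ℂ³`, on which `K` is the space of antiholomorphic translations; the orthogonal
complement is `ℝ⁴`, and `E = K^⟂` (`livesOn_of_isIsotropic_orth`).

*Stabilizer.* The group `SO(W)` is the torus scaling `w₀` and `w₁` by `t` and `t⁻¹`, so an element
of `Stab₀(Q)` scales `ψ₁` by `t⁻¹` and `ψ₂` by `t`. It therefore preserves the flag `K ⊂ K^⟂ ⊂ V`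
and, in `K^⟂ / K`, the Lagrangians spanned by the `p` and by the `q`. An element of the spin group is
determined by its action on `V` and on one spinor (`spin_ext`), because the Clifford algebra acts
faithfully and irreducibly on spinors (`spinorRep_injective`, `eq_top_of_cliffordMul_mem`).

* The elements acting trivially on `W` and on the graded pieces of the flag form the unipotent
  radical. They are uniquely products of the elements `1 + kᵢ x` with `x ∈ K^⟂`, whose coordinates
  are polynomials in the action on `V` (`ad_unipElt_unipCoord`). The components in `K^⟂ / K` give a
  homomorphism to a vector space with central kernel, so the group is nilpotent.
* A block matrix with blocks `A ∈ SL(3)` and `t⁻¹ C`, `C ∈ SL(2)`, acting on `Ann ψ₁` and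
  contragrediently on the dual isotropic subspace, has a unique lift to the spin group that scales
  `ψ₁` by `t⁻¹` (`exists_isLift`, from elementary and diagonal matrices). This lift scales `ψ₂` by
  `t` and gives the Levi factor (`leviHom`).
* The scalings of `ψ₁` and `ψ₂` force these determinants for the diagonal blocks of any element of
  the stabilizer (`Scales.det_blocks`), so it is a product of elements of the two subgroups.
* A map to the stabilizer is regular as soon as its actions on `V` and on one spinor are
  (`IsRegular.spin_of_apply`), again by irreducibility.
* A product of four vectors interchanges `ψ₁` and `ψ₂` (`exists_swap`). Together with the
  interchange of `w₀` and `w₁` it represents the other component of the stabilizer.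
-/

noncomputable section

namespace IIB

/-! ### Contractions in the exterior algebra -/

section Exterior

variable {M : Type*} [AddCommGroup M] [Module ℂ M]

/-- Contraction of the exterior algebra with a covector. -/
abbrev extContract (d : Module.Dual ℂ M) : Module.End ℂ (ExteriorAlgebra ℂ M) :=
  CliffordAlgebra.contractLeft (Q := (0 : QuadraticForm ℂ M)) d

theorem extContract_ι_mul (d : Module.Dual ℂ M) (m : M) (x : ExteriorAlgebra ℂ M) :
    extContract d (ExteriorAlgebra.ι ℂ m * x) =
      d m • x - ExteriorAlgebra.ι ℂ m * extContract d x :=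
  CliffordAlgebra.contractLeft_ι_mul _ _ _

theorem extContract_algebraMap (d : Module.Dual ℂ M) (r : ℂ) :
    extContract d (algebraMap ℂ (ExteriorAlgebra ℂ M) r) = 0 :=
  CliffordAlgebra.contractLeft_algebraMap (Q := (0 : QuadraticForm ℂ M)) d r

theorem extContract_one (d : Module.Dual ℂ M) :
    extContract d (1 : ExteriorAlgebra ℂ M) = 0 :=
  CliffordAlgebra.contractLeft_one (Q := (0 : QuadraticForm ℂ M)) d

theorem extContract_extContract (d : Module.Dual ℂ M) (x : ExteriorAlgebra ℂ M) :
    extContract d (extContract d x) = 0 :=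
  CliffordAlgebra.contractLeft_contractLeft _ _

theorem extContract_comm (d d' : Module.Dual ℂ M) (x : ExteriorAlgebra ℂ M) :
    extContract d (extContract d' x) = -extContract d' (extContract d x) :=
  CliffordAlgebra.contractLeft_comm _ _ _

theorem ext_ι_mul_ι_mul (m m' : M) (x : ExteriorAlgebra ℂ M) :
    ExteriorAlgebra.ι ℂ m * (ExteriorAlgebra.ι ℂ m' * x) =
      -(ExteriorAlgebra.ι ℂ m' * (ExteriorAlgebra.ι ℂ m * x)) := by
  rw [← mul_assoc, ← mul_assoc, ← neg_mul, ← eq_neg_of_add_eq_zero_left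
    (ExteriorAlgebra.ι_add_mul_swap m m')]

theorem ext_induction {C : ExteriorAlgebra ℂ M → Prop}
    (algebraMap : ∀ r : ℂ, C (algebraMap ℂ _ r)) (add : ∀ x y, C x → C y → C (x + y))
    (ι_mul : ∀ m x, C x → C (ExteriorAlgebra.ι ℂ m * x)) (x : ExteriorAlgebra ℂ M) : C x :=
  CliffordAlgebra.left_induction (Q := (0 : QuadraticForm ℂ M)) algebraMap
    add (fun x m hx => ι_mul m x hx) x

variable {ι : Type*}

/-- The product of the commuting projections `x ↦ eᵢ^∨ ⌟ (eᵢ ∧ x)` over a list of indices. -/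
def vacuumProj (b : Module.Basis ι ℂ M) : List ι → Module.End ℂ (ExteriorAlgebra ℂ M)
  | [] => 1
  | i :: l => extContract (b.coord i) * LinearMap.mulLeft ℂ (ExteriorAlgebra.ι ℂ (b i)) *
      vacuumProj b l

theorem vacuumProj_cons (b : Module.Basis ι ℂ M) (i : ι) (l : List ι)
    (x : ExteriorAlgebra ℂ M) : vacuumProj b (i :: l) x =
      extContract (b.coord i) (ExteriorAlgebra.ι ℂ (b i) * vacuumProj b l x) := rfl

theorem vacuumProj_eq_self (b : Module.Basis ι ℂ M) (l : List ι) (x : ExteriorAlgebra ℂ M)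
    (hx : ∀ i, extContract (b.coord i) x = 0) : vacuumProj b l x = x := by
  induction l with
  | nil => rfl
  | cons i l ih => rw [vacuumProj_cons, ih, extContract_ι_mul, hx]; simp

/-- The factors of `vacuumProj` other than that of `j` preserve the left ideal of `eⱼ`, and the
factor of `j` annihilates it. -/
theorem exists_vacuumProj_ι_mul (b : Module.Basis ι ℂ M) (l : List ι) (j : ι)
    (x : ExteriorAlgebra ℂ M) :
    (∃ y, vacuumProj b l (ExteriorAlgebra.ι ℂ (b j) * x) = ExteriorAlgebra.ι ℂ (b j) * y) ∧
      (j ∈ l → vacuumProj b l (ExteriorAlgebra.ι ℂ (b j) * x) = 0) := by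
  classical
  induction l with
  | nil => exact ⟨⟨x, rfl⟩, by simp⟩
  | cons i l ih =>
    obtain ⟨⟨y, hy⟩, h0⟩ := ih
    rw [vacuumProj_cons]
    by_cases hij : i = j
    · subst hij
      have : extContract (b.coord i) (ExteriorAlgebra.ι ℂ (b i) *
          vacuumProj b l (ExteriorAlgebra.ι ℂ (b i) * x)) = 0 := by
        rw [hy, ← mul_assoc, ExteriorAlgebra.ι_sq_zero, zero_mul, map_zero]
      rw [this]
      exact ⟨⟨0, by simp⟩, fun _ => rfl⟩
    · refine ⟨⟨extContract (b.coord i) (ExteriorAlgebra.ι ℂ (b i) * y), ?_⟩, fun hj => ?_⟩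
      · rw [hy, ext_ι_mul_ι_mul, map_neg, extContract_ι_mul (m := b j)]
        simp [Ne.symm hij]
      · rw [h0 (by simpa [Ne.symm hij] using hj)]; simp

/-- The intersection of the kernels of all contractions consists of the scalars. -/
theorem exists_algebraMap_of_extContract_eq_zero [Finite ι] (b : Module.Basis ι ℂ M)
    (x : ExteriorAlgebra ℂ M) (hx : ∀ i, extContract (b.coord i) x = 0) :
    ∃ r : ℂ, x = algebraMap ℂ _ r := by
  have := Fintype.ofFinite ι
  rw [← vacuumProj_eq_self b Finset.univ.toList x hx]
  clear hx
  induction x using ext_induction with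
  | algebraMap r => exact ⟨r, vacuumProj_eq_self b _ _ fun i => extContract_algebraMap _ _⟩
  | add x y hx hy =>
    obtain ⟨r, hr⟩ := hx
    obtain ⟨s, hs⟩ := hy
    exact ⟨r + s, by rw [map_add, hr, hs, map_add]⟩
  | ι_mul m x hx =>
    refine ⟨0, ?_⟩
    rw [← b.sum_repr m]
    simp only [map_sum, map_smul, Finset.sum_mul, smul_mul_assoc, map_zero]
    exact Finset.sum_eq_zero fun j _ => by
      rw [(exists_vacuumProj_ι_mul b _ j x).2 (by simp), smul_zero]

/-- A nonzero subspace of the exterior algebra that is stable under contractions contains `1`. -/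
theorem one_mem_of_extContract_mem [Finite ι] (b : Module.Basis ι ℂ M)
    (S : Submodule ℂ (ExteriorAlgebra ℂ M)) (hS : S ≠ ⊥)
    (hc : ∀ i, ∀ x ∈ S, extContract (b.coord i) x ∈ S) : 1 ∈ S := by
  classical
  have := Fintype.ofFinite ι
  -- apply contractions to a nonzero element until all of them annihilate it
  have key : ∀ s : Finset ι, ∃ x ∈ S, x ≠ 0 ∧ ∀ i ∈ s, extContract (b.coord i) x = 0 := by
    intro s
    induction s using Finset.induction_on with
    | empty =>
      obtain ⟨x, hx, h0⟩ := S.exists_mem_ne_zero_of_ne_bot hS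
      exact ⟨x, hx, h0, by simp⟩
    | insert j s hj ih =>
      obtain ⟨x, hx, h0, h⟩ := ih
      by_cases hjx : extContract (b.coord j) x = 0
      · exact ⟨x, hx, h0, by simpa [hjx] using h⟩
      · refine ⟨_, hc j x hx, hjx, fun i hi => ?_⟩
        rcases Finset.mem_insert.mp hi with rfl | hi
        · exact extContract_extContract _ _
        · rw [extContract_comm, h i hi, map_zero, neg_zero]
  obtain ⟨x, hx, h0, h⟩ := key Finset.univ
  obtain ⟨r, rfl⟩ := exists_algebraMap_of_extContract_eq_zero b x fun i => h i (by simp)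
  have hr : r ≠ 0 := by rintro rfl; simp at h0
  have := S.smul_mem r⁻¹ hx
  rwa [Algebra.algebraMap_eq_smul_one, smul_smul, inv_mul_cancel₀ hr, one_smul] at this

instance exteriorAlgebra_finite [Module.Finite ℂ M] : Module.Finite ℂ (ExteriorAlgebra ℂ M) :=
  Module.Finite.of_basis
    (Module.Basis.ExteriorAlgebra (Module.finBasis ℂ M))

end Exterior

/-! ### The spinor representation is irreducible and faithful -/

section SpinorRep

variable {L : Type*} [AddCommGroup L] [Module ℂ L]

theorem spinorRep_ι (v : Vec L) : spinorRep L (CliffordAlgebra.ι _ v) = cliffordMul v :=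
  CliffordAlgebra.lift_ι_apply _ _ _

theorem vecForm_polar (v w : Vec L) :
    QuadraticMap.polar (vecForm L) v w = LinearMap.dualProd ℂ L v w := by
  simp [QuadraticMap.polar]
  ring

theorem ι_mul_ι_add (v w : Vec L) :
    CliffordAlgebra.ι (vecForm L) v * CliffordAlgebra.ι (vecForm L) w +
      CliffordAlgebra.ι (vecForm L) w * CliffordAlgebra.ι (vecForm L) v =
      algebraMap ℂ _ (LinearMap.dualProd ℂ L v w) := by
  rw [CliffordAlgebra.ι_mul_ι_add_swap, vecForm_polar]

theorem cliffordMul_anticomm (v w : Vec L) (x : Spinor L) :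
    cliffordMul v (cliffordMul w x) =
      LinearMap.dualProd ℂ L v w • x - cliffordMul w (cliffordMul v x) := by
  have := congrArg (fun z => spinorRep L z x) (ι_mul_ι_add v w)
  simp only [map_add, map_mul, spinorRep_ι, AlgHom.commutes, LinearMap.add_apply,
    Module.End.mul_apply, Module.algebraMap_end_apply] at this
  rw [← this]; abel

theorem dualProd_comm (v w : Vec L) :
    LinearMap.dualProd ℂ L v w = LinearMap.dualProd ℂ L w v :=
  add_comm _ _

theorem dualProd_self (v : Vec L) : LinearMap.dualProd ℂ L v v = 2 * vecForm L v := by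
  simp; ring

theorem cliffordMul_cliffordMul (v : Vec L) (x : Spinor L) :
    cliffordMul v (cliffordMul v x) = vecForm L v • x :=
  congrArg (fun z => z x) (cliffordMul_sq v)

variable (e : Module.Basis (Fin 5) ℂ L)

theorem cliffordMul_zero_snd (l : L) (x : Spinor L) :
    cliffordMul ((0, l) : Vec L) x = contract l x := by
  simp [cliffordMul_apply]

theorem cliffordMul_fst_zero (f : Module.Dual ℂ L) (x : Spinor L) :
    cliffordMul ((f, 0) : Vec L) x = ExteriorAlgebra.ι ℂ f * x := by
  simp [cliffordMul_apply, contract]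

include e in
/-- The spinor representation is irreducible. -/
theorem eq_top_of_cliffordMul_mem (S : Submodule ℂ (Spinor L)) (hS : S ≠ ⊥)
    (hc : ∀ v, ∀ x ∈ S, cliffordMul v x ∈ S) : S = ⊤ := by
  have h1 : (1 : Spinor L) ∈ S := by
    refine one_mem_of_extContract_mem e.dualBasis S hS fun i x hx => ?_
    have : extContract (e.dualBasis.coord i) x = cliffordMul (0, e i) x := by
      rw [cliffordMul_zero_snd]
      change extContract _ x = extContract _ x
      congr 2
      refine e.dualBasis.ext fun j => ?_
      simp [Finsupp.single_apply]
    rw [this]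
    exact hc _ _ hx
  rw [eq_top_iff]
  rintro x -
  induction x using ext_induction with
  | algebraMap r => rw [Algebra.algebraMap_eq_smul_one]; exact S.smul_mem _ h1
  | add x y hx hy => exact S.add_mem hx hy
  | ι_mul m x hx => rw [← cliffordMul_fst_zero]; exact hc _ _ hx

/-- The contraction of the Clifford algebra with `⟨v, -⟩` is the supercommutator with `v`. -/
theorem contractLeft_dualProd (v : Vec L) (x : CliffordAlgebra (vecForm L)) :
    CliffordAlgebra.contractLeft (LinearMap.dualProd ℂ L v) x =
      CliffordAlgebra.ι _ v * x - CliffordAlgebra.involute x * CliffordAlgebra.ι _ v := by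
  induction x using CliffordAlgebra.left_induction with
  | algebraMap r =>
    rw [CliffordAlgebra.contractLeft_algebraMap, AlgHom.commutes, Algebra.commutes, sub_self]
  | add x y hx hy => rw [map_add, hx, hy, map_add]; noncomm_ring
  | ι_mul x w hx =>
    rw [CliffordAlgebra.contractLeft_ι_mul, hx, map_mul, CliffordAlgebra.involute_ι,
      Algebra.smul_def, ← ι_mul_ι_add]
    noncomm_ring

/-- The kernel of the spinor representation is stable under the grading involution, because the
representation is graded. -/
theorem spinorRep_involute_eq_zero (x : CliffordAlgebra (vecForm L))
    (hx : spinorRep L x = 0) : spinorRep L (CliffordAlgebra.involute x) = 0 := by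
  have key : ∀ (x : CliffordAlgebra (vecForm L)) (ψ : Spinor L),
      spinorRep L (CliffordAlgebra.involute x) (CliffordAlgebra.involute (Q := 0) ψ) =
        CliffordAlgebra.involute (Q := 0) (spinorRep L x ψ) := by
    intro x
    induction x using CliffordAlgebra.left_induction with
    | algebraMap r => intro ψ; simp
    | add x y hx hy => intro ψ; simp [hx, hy]
    | ι_mul x w hx =>
      intro ψ
      have h2 : ∀ φ : Spinor L, CliffordAlgebra.involute (Q := 0) (cliffordMul w φ) =
          - cliffordMul w (CliffordAlgebra.involute (Q := 0) φ) := by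
        intro φ
        have h3 : ∀ φ : Spinor L, CliffordAlgebra.involute (Q := 0) (contract w.2 φ) =
            - contract w.2 (CliffordAlgebra.involute (Q := 0) φ) := by
          intro φ
          induction φ using ext_induction with
          | algebraMap r =>
            have : contract w.2 (algebraMap ℂ (Spinor L) r) = 0 := extContract_algebraMap _ _
            rw [AlgHom.commutes, this, map_zero, neg_zero]
          | add x y hx hy => simp only [map_add, hx, hy]; abel
          | ι_mul f x hx =>
            have h4 : CliffordAlgebra.involute (Q := 0) (ExteriorAlgebra.ι ℂ f) =
              - ExteriorAlgebra.ι ℂ f := CliffordAlgebra.involute_ι f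
            rw [contract_ι_mul, map_sub, map_mul, map_mul, hx, map_smul, h4, neg_mul, neg_mul,
              map_neg, contract_ι_mul]
            noncomm_ring
        have h4 : CliffordAlgebra.involute (Q := 0) (ExteriorAlgebra.ι ℂ w.1) =
          - ExteriorAlgebra.ι ℂ w.1 := CliffordAlgebra.involute_ι w.1
        rw [cliffordMul_apply, map_add, map_mul, h3, h4, cliffordMul_apply]
        noncomm_ring
      simp only [map_mul, CliffordAlgebra.involute_ι, Module.End.mul_apply, map_neg, spinorRep_ι,
        LinearMap.neg_apply, h2, hx, neg_mul]
  refine LinearMap.ext fun ψ => ?_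
  have := key x (CliffordAlgebra.involute (Q := 0) ψ)
  rw [hx] at this
  simpa [CliffordAlgebra.involute_involute] using this

include e in
/-- The spinor representation is faithful: its kernel is stable under contractions, so it would
contain a nonzero scalar. -/
theorem spinorRep_injective : Function.Injective (spinorRep L) := by
  have : Module.Finite ℂ L := Module.Finite.of_basis e
  rw [injective_iff_map_eq_zero]
  intro x hx
  by_contra h0
  let S : Submodule ℂ (CliffordAlgebra (vecForm L)) := LinearMap.ker (spinorRep L).toLinearMap
  have hS : ∀ x, x ∈ S ↔ spinorRep L x = 0 := fun x => by simp [S]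
  let T := S.map (CliffordAlgebra.equivExterior (vecForm L)).toLinearMap
  have hT : T ≠ ⊥ := by
    intro hT
    have : CliffordAlgebra.equivExterior (vecForm L) x ∈ T :=
      Submodule.mem_map_of_mem ((hS x).2 hx)
    rw [hT, Submodule.mem_bot] at this
    exact h0 ((LinearEquiv.map_eq_zero_iff _).1 this)
  have h1 : (1 : ExteriorAlgebra ℂ (Vec L)) ∈ T := by
    refine one_mem_of_extContract_mem (Module.finBasis ℂ (Vec L)) T hT ?_
    rintro i _ ⟨y, hy, rfl⟩
    -- contraction with `⟨v, -⟩` is the supercommutator with `v`, so it preserves the kernel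
    obtain ⟨v, hv⟩ : ∃ v, LinearMap.dualProd ℂ L v = (Module.finBasis ℂ (Vec L)).coord i := by
      have hinj : Function.Injective (LinearMap.dualProd ℂ L) := by
        rw [← LinearMap.ker_eq_bot, ← LinearMap.separatingLeft_iff_ker_eq_bot,
          LinearMap.separatingLeft_dualProd]
        exact (Module.evalEquiv ℂ L).injective
      exact (LinearMap.injective_iff_surjective_of_finrank_eq_finrank
        Subspace.dual_finrank_eq.symm).mp hinj _
    refine ⟨CliffordAlgebra.contractLeft ((Module.finBasis ℂ (Vec L)).coord i) y, ?_, ?_⟩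
    · change _ ∈ S
      have hy' := (hS y).1 hy
      rw [hS, ← hv, contractLeft_dualProd, map_sub, map_mul, map_mul, hy',
        spinorRep_involute_eq_zero _ hy', mul_zero, zero_mul, sub_zero]
    · exact CliffordAlgebra.changeForm_contractLeft
        CliffordAlgebra.changeForm.associated_neg_proof _ _
  obtain ⟨y, hy, hy1⟩ := h1
  -- so `1` lies in the kernel, which is absurd
  have hy2 : y = 1 := by
    apply (CliffordAlgebra.equivExterior (vecForm L)).injective
    exact hy1.trans (CliffordAlgebra.changeForm_one
      CliffordAlgebra.changeForm.associated_neg_proof).symm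
  have := (hS y).1 hy
  rw [hy2, map_one] at this
  exact one_ne_zero (congrArg (fun z => z (1 : Spinor L)) this)

include e in
theorem finite_cliffordAlgebra : Module.Finite ℂ (CliffordAlgebra (vecForm L)) := by
  have : Module.Finite ℂ L := Module.Finite.of_basis e
  exact Module.Finite.equiv (CliffordAlgebra.equivExterior (vecForm L)).symm

end SpinorRep

/-! ### The vector representation of the spin group -/

section Ad

variable {L : Type*} [AddCommGroup L] [Module ℂ L]

/-- A linear left inverse of the inclusion of `V` in its Clifford algebra. -/
def vecProj : CliffordAlgebra (vecForm L) →ₗ[ℂ] Vec L :=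
  ExteriorAlgebra.ιInv ∘ₗ (CliffordAlgebra.equivExterior (vecForm L)).toLinearMap

theorem vecProj_ι (v : Vec L) : vecProj (CliffordAlgebra.ι _ v) = v := by
  have : CliffordAlgebra.equivExterior (vecForm L) (CliffordAlgebra.ι _ v) =
      ExteriorAlgebra.ι ℂ v :=
    CliffordAlgebra.changeForm_ι CliffordAlgebra.changeForm.associated_neg_proof v
  simp only [vecProj, LinearMap.comp_apply, LinearEquiv.coe_coe, this]
  exact ExteriorAlgebra.ι_leftInverse v

theorem cliffordι_injective : Function.Injective (CliffordAlgebra.ι (vecForm L)) :=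
  Function.LeftInverse.injective vecProj_ι

theorem exists_ι_eq_conj (g : spinGroup (vecForm L)) (v : Vec L) :
    ∃ w, CliffordAlgebra.ι _ w =
      (g : CliffordAlgebra (vecForm L)) * CliffordAlgebra.ι _ v * star g.1 := by
  obtain ⟨w, hw⟩ := spinGroup.conjAct_smul_ι_mem_range_ι (x := spinGroup.toUnits g)
    (by simp) v
  refine ⟨w, hw.trans ?_⟩
  rw [ConjAct.units_smul_def]
  rfl

/-- The underlying function of the vector representation: `v ↦ g v g⁻¹`. -/
def adLinear (g : spinGroup (vecForm L)) : Module.End ℂ (Vec L) :=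
  vecProj ∘ₗ LinearMap.mulRight ℂ (star g.1) ∘ₗ LinearMap.mulLeft ℂ g.1 ∘ₗ CliffordAlgebra.ι _

theorem adLinear_apply (g : spinGroup (vecForm L)) (v : Vec L) :
    adLinear g v = vecProj (g.1 * CliffordAlgebra.ι _ v * star g.1) := rfl

theorem ι_adLinear (g : spinGroup (vecForm L)) (v : Vec L) :
    CliffordAlgebra.ι _ (adLinear g v) = g.1 * CliffordAlgebra.ι _ v * star g.1 := by
  obtain ⟨w, hw⟩ := exists_ι_eq_conj g v
  rw [adLinear_apply, ← hw, vecProj_ι]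

/-- The vector representation of `Spin(V)`: `v ↦ g v g⁻¹`. -/
def ad : spinGroup (vecForm L) →* Module.End ℂ (Vec L) where
  toFun := adLinear
  map_one' := LinearMap.ext fun v => cliffordι_injective <| by simp [ι_adLinear]
  map_mul' g h := LinearMap.ext fun v => cliffordι_injective <| by
    simp [ι_adLinear, mul_assoc]

theorem ι_ad (g : spinGroup (vecForm L)) (v : Vec L) :
    CliffordAlgebra.ι _ (ad g v) = g.1 * CliffordAlgebra.ι _ v * star g.1 :=
  ι_adLinear g v

theorem ι_ad_mul (g : spinGroup (vecForm L)) (v : Vec L) :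
    CliffordAlgebra.ι _ (ad g v) * g.1 = g.1 * CliffordAlgebra.ι _ v := by
  rw [ι_ad, mul_assoc, spinGroup.star_mul_self_of_mem g.2, mul_one]

theorem ad_eq_of_mul_eq {g : spinGroup (vecForm L)} {v w : Vec L}
    (h : g.1 * CliffordAlgebra.ι _ v = CliffordAlgebra.ι _ w * g.1) : ad g v = w := by
  apply cliffordι_injective
  rw [ι_ad, h, mul_assoc, spinGroup.mul_star_self_of_mem g.2, mul_one]

theorem ad_mul_apply (g h : spinGroup (vecForm L)) (v : Vec L) :
    ad (g * h) v = ad g (ad h v) := by rw [map_mul]; rfl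

theorem ad_inv_ad (g : spinGroup (vecForm L)) (v : Vec L) : ad g⁻¹ (ad g v) = v := by
  rw [← ad_mul_apply, inv_mul_cancel, map_one]; rfl

theorem ad_ad_inv (g : spinGroup (vecForm L)) (v : Vec L) : ad g (ad g⁻¹ v) = v := by
  rw [← ad_mul_apply, mul_inv_cancel, map_one]; rfl

theorem dualProd_ad (g : spinGroup (vecForm L)) (v w : Vec L) :
    LinearMap.dualProd ℂ L (ad g v) (ad g w) = LinearMap.dualProd ℂ L v w := by
  have h := ι_mul_ι_add (ad g v) (ad g w)
  have h2 : CliffordAlgebra.ι (vecForm L) (ad g v) * CliffordAlgebra.ι (vecForm L) (ad g w) +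
      CliffordAlgebra.ι (vecForm L) (ad g w) * CliffordAlgebra.ι (vecForm L) (ad g v) =
      g.1 * (CliffordAlgebra.ι _ v * CliffordAlgebra.ι _ w +
        CliffordAlgebra.ι _ w * CliffordAlgebra.ι _ v) * star g.1 := by
    have h3 := spinGroup.star_mul_self_of_mem g.2
    have h4 : ∀ v w : Vec L, CliffordAlgebra.ι (vecForm L) (ad g v) *
        CliffordAlgebra.ι (vecForm L) (ad g w) = g.1 * (CliffordAlgebra.ι _ v *
          CliffordAlgebra.ι _ w) * star g.1 := by
      intro v w
      rw [ι_ad g w, ← mul_assoc, ← mul_assoc, ι_ad_mul]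
      simp only [mul_assoc]
    rw [h4, h4, mul_add, add_mul]
  rw [h2, ι_mul_ι_add, ← Algebra.commutes, mul_assoc, spinGroup.mul_star_self_of_mem g.2,
    mul_one] at h
  exact (FaithfulSMul.algebraMap_injective ℂ (CliffordAlgebra (vecForm L)) h).symm

theorem spinorRep_cliffordMul (g : spinGroup (vecForm L)) (v : Vec L) (x : Spinor L) :
    spinorRep L g.1 (cliffordMul v x) = cliffordMul (ad g v) (spinorRep L g.1 x) := by
  rw [← spinorRep_ι, ← spinorRep_ι, ← Module.End.mul_apply, ← Module.End.mul_apply, ← map_mul,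
    ← map_mul, ι_ad_mul]

theorem spinorRep_mul_apply (g h : spinGroup (vecForm L)) (x : Spinor L) :
    spinorRep L (g * h).1 x = spinorRep L g.1 (spinorRep L h.1 x) := by
  rw [Submonoid.coe_mul, map_mul]; rfl

theorem spinorRep_inv_apply (g : spinGroup (vecForm L)) (x : Spinor L) :
    spinorRep L g⁻¹.1 (spinorRep L g.1 x) = x := by
  rw [← spinorRep_mul_apply, inv_mul_cancel, OneMemClass.coe_one, map_one]; rfl

/-- A spinor scaled by `g` has an annihilator that is stable under `g`. -/
theorem ad_mem_ann {g : spinGroup (vecForm L)} {ψ : Spinor L} {r : ℂ} (hr : r ≠ 0)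
    (hg : spinorRep L g.1 ψ = r • ψ) {v : Vec L} (hv : cliffordMul v ψ = 0) :
    cliffordMul (ad g v) ψ = 0 := by
  have := spinorRep_cliffordMul g v ψ
  rw [hv, map_zero, hg, map_smul] at this
  exact (smul_eq_zero.mp this.symm).resolve_left hr

/-- A product of two vectors whose norms multiply to `1` belongs to the spin group. -/
theorem ι_mul_ι_mem_spinGroup {v w : Vec L} (h : vecForm L v * vecForm L w = 1) :
    CliffordAlgebra.ι (vecForm L) v * CliffordAlgebra.ι (vecForm L) w ∈
      spinGroup (vecForm L) := by
  have h0 : vecForm L v ≠ 0 ∧ vecForm L w ≠ 0 := by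
    constructor <;> rintro h' <;> simp [h'] at h
  have hu : ∀ v : Vec L, vecForm L v ≠ 0 → ∃ u : (CliffordAlgebra (vecForm L))ˣ,
      u ∈ lipschitzGroup (vecForm L) ∧ u.1 = CliffordAlgebra.ι (vecForm L) v := by
    intro v hv
    have e1 : CliffordAlgebra.ι (vecForm L) v * ((vecForm L v)⁻¹ • CliffordAlgebra.ι _ v) = 1 := by
      rw [mul_smul_comm, CliffordAlgebra.ι_sq_scalar, Algebra.algebraMap_eq_smul_one, smul_smul,
        inv_mul_cancel₀ hv, one_smul]
    have e2 : ((vecForm L v)⁻¹ • CliffordAlgebra.ι _ v) * CliffordAlgebra.ι (vecForm L) v = 1 := by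
      rw [smul_mul_assoc, ← mul_smul_comm, e1]
    exact ⟨⟨_, _, e1, e2⟩, Subgroup.subset_closure ⟨v, rfl⟩, rfl⟩
  obtain ⟨a, ha, ha'⟩ := hu v h0.1
  obtain ⟨b, hb, hb'⟩ := hu w h0.2
  have h1 : CliffordAlgebra.ι (vecForm L) w * (CliffordAlgebra.ι _ v * CliffordAlgebra.ι _ v) *
      CliffordAlgebra.ι (vecForm L) w = 1 := by
    rw [CliffordAlgebra.ι_sq_scalar, ← Algebra.commutes, mul_assoc, CliffordAlgebra.ι_sq_scalar,
      ← map_mul, h, map_one]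
  have h2 : CliffordAlgebra.ι (vecForm L) v * (CliffordAlgebra.ι _ w * CliffordAlgebra.ι _ w) *
      CliffordAlgebra.ι (vecForm L) v = 1 := by
    rw [CliffordAlgebra.ι_sq_scalar, ← Algebra.commutes, mul_assoc, CliffordAlgebra.ι_sq_scalar,
      ← map_mul, mul_comm, h, map_one]
  refine ⟨⟨⟨a * b, mul_mem ha hb, by simp [ha', hb']⟩, ?_, ?_⟩, ?_⟩
  · rw [star_mul, CliffordAlgebra.star_ι, CliffordAlgebra.star_ι, ← h1]; noncomm_ring
  · rw [star_mul, CliffordAlgebra.star_ι, CliffordAlgebra.star_ι, ← h2]; noncomm_ring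
  · exact CliffordAlgebra.ι_mul_ι_mem_evenOdd_zero _ _ _

theorem ι_mul_ι_swap (v w : Vec L) :
    CliffordAlgebra.ι (vecForm L) w * CliffordAlgebra.ι (vecForm L) v =
      algebraMap ℂ _ (LinearMap.dualProd ℂ L v w) -
        CliffordAlgebra.ι (vecForm L) v * CliffordAlgebra.ι (vecForm L) w := by
  rw [← ι_mul_ι_add]; abel

theorem vecForm_add (v w : Vec L) :
    vecForm L (v + w) = vecForm L v + vecForm L w + LinearMap.dualProd ℂ L v w := by
  rw [← vecForm_polar, QuadraticMap.polar]; ring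

theorem ι_mul_self_eq_zero {k : Vec L} (hk : vecForm L k = 0) :
    CliffordAlgebra.ι (vecForm L) k * CliffordAlgebra.ι (vecForm L) k = 0 := by
  rw [CliffordAlgebra.ι_sq_scalar, hk, map_zero]

/-- For a null vector `k` and a vector `u ⟂ k`, the element `1 + k u` belongs to the spin group.
If `u` is not null, it is a product of two vectors; in general `u` is a sum of two vectors that
are not null. -/
theorem one_add_ι_mul_ι_mem_spinGroup {k u z : Vec L} (hk : vecForm L k = 0)
    (hu : LinearMap.dualProd ℂ L k u = 0) (hz : LinearMap.dualProd ℂ L k z = 0)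
    (hz0 : vecForm L z ≠ 0) :
    1 + CliffordAlgebra.ι (vecForm L) k * CliffordAlgebra.ι (vecForm L) u ∈
      spinGroup (vecForm L) := by
  have key : ∀ u : Vec L, LinearMap.dualProd ℂ L k u = 0 → vecForm L u ≠ 0 →
      1 + CliffordAlgebra.ι (vecForm L) k * CliffordAlgebra.ι (vecForm L) u ∈
        spinGroup (vecForm L) := by
    intro u hu hu0
    have e : 1 + CliffordAlgebra.ι (vecForm L) k * CliffordAlgebra.ι (vecForm L) u =
        CliffordAlgebra.ι (vecForm L) (k + (vecForm L u)⁻¹ • u) *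
          CliffordAlgebra.ι (vecForm L) u := by
      rw [map_add, map_smul, add_mul, smul_mul_assoc, CliffordAlgebra.ι_sq_scalar,
        Algebra.algebraMap_eq_smul_one, smul_smul, inv_mul_cancel₀ hu0, one_smul, add_comm]
    rw [e]
    apply ι_mul_ι_mem_spinGroup
    rw [vecForm_add, hk, QuadraticMap.map_smul, map_smul, hu]
    simp only [smul_eq_mul]
    field_simp
    ring
  by_cases hu0 : vecForm L u = 0
  · -- `u = s z + (u - s z)` with both summands not null, as `q (u - s z) = s (s q z - ⟨u, z⟩)`
    obtain ⟨s, hs0, hs⟩ : ∃ s : ℂ, s ≠ 0 ∧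
        s * vecForm L z ≠ LinearMap.dualProd ℂ L u z := by
      by_cases h : vecForm L z = LinearMap.dualProd ℂ L u z
      · refine ⟨2, two_ne_zero, fun h' => hz0 ?_⟩
        linear_combination h' - h
      · exact ⟨1, one_ne_zero, by rwa [one_mul]⟩
    have h1 := key (s • z) (by rw [map_smul, hz, smul_zero])
      (by rw [QuadraticMap.map_smul]; simp [hs0]; simpa using hz0)
    have h2 := key (u - s • z) (by rw [map_sub, map_smul, hu, hz]; simp) (by
      rw [sub_eq_add_neg, vecForm_add, hu0, QuadraticMap.map_neg,
        QuadraticMap.map_smul, map_neg, map_smul]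
      intro h
      apply mul_ne_zero hs0 (sub_ne_zero.mpr hs)
      simp only [smul_eq_mul] at h ⊢
      linear_combination h)
    have h3 := mul_mem h1 h2
    convert! h3 using 1
    -- the product of the two elements is additive in `u`, since `k x k = -k² x = 0` for `x ⟂ k`
    have h4 : CliffordAlgebra.ι (vecForm L) k * CliffordAlgebra.ι (vecForm L) (s • z) *
        (CliffordAlgebra.ι (vecForm L) k * CliffordAlgebra.ι (vecForm L) (u - s • z)) = 0 := by
      have : LinearMap.dualProd ℂ L k (s • z) = 0 := by rw [map_smul, hz, smul_zero]
      have e := ι_mul_ι_swap k (s • z)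
      rw [this, map_zero, zero_sub] at e
      rw [mul_assoc, ← mul_assoc (CliffordAlgebra.ι (vecForm L) (s • z)), e, neg_mul, mul_neg,
        ← mul_assoc, ← mul_assoc, ι_mul_self_eq_zero hk, zero_mul, zero_mul, neg_zero]
    rw [mul_add, mul_one, add_mul, h4, one_mul, map_sub, mul_sub]
    abel
  · exact key u hu hu0

/-- The action of `1 + k u` on vectors. -/
theorem ad_one_add {k u : Vec L} (hk : vecForm L k = 0)
    (hu : LinearMap.dualProd ℂ L k u = 0) {g : spinGroup (vecForm L)}
    (hg : g.1 = 1 + CliffordAlgebra.ι (vecForm L) k * CliffordAlgebra.ι (vecForm L) u)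
    (v : Vec L) : ad g v = v + LinearMap.dualProd ℂ L u v • k - LinearMap.dualProd ℂ L k v • u -
      (LinearMap.dualProd ℂ L k v * vecForm L u) • k := by
  apply ad_eq_of_mul_eq
  rw [hg]
  have hkk := ι_mul_self_eq_zero hk
  have huu := CliffordAlgebra.ι_sq_scalar (vecForm L) u
  have huk := ι_mul_ι_swap k u
  rw [hu, map_zero, zero_sub] at huk
  have hvk := ι_mul_ι_swap k v
  have hvu := ι_mul_ι_swap u v
  simp only [map_add, map_sub, map_smul, Algebra.algebraMap_eq_smul_one] at *
  set K := CliffordAlgebra.ι (vecForm L) k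
  set U := CliffordAlgebra.ι (vecForm L) u
  set X := CliffordAlgebra.ι (vecForm L) v
  set α := LinearMap.dualProd ℂ L k v
  set β := LinearMap.dualProd ℂ L u v
  set q := vecForm L u
  have e1 : X * (K * U) = α • U - β • K + K * U * X := by
    rw [← mul_assoc, hvk, sub_mul, mul_assoc, hvu, mul_sub, smul_mul_assoc, one_mul,
      mul_smul_comm, mul_one, mul_assoc]
    abel
  have e2 : K * (K * U) = 0 := by rw [← mul_assoc, hkk, zero_mul]
  have e3 : U * (K * U) = - q • K := by
    rw [← mul_assoc, huk, neg_mul, mul_assoc, huu, mul_smul_comm, mul_one, neg_smul]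
  rw [add_mul, one_mul, mul_add, mul_one, sub_mul, sub_mul, add_mul]
  simp only [smul_mul_assoc, e1, e2, e3, smul_zero, add_zero, sub_zero]
  module

/-- An element of the spin group that acts trivially on vectors is `±1`: it acts on the
irreducible spinor representation by a scalar. -/
theorem eq_algebraMap_of_ad_eq_id (e : Module.Basis (Fin 5) ℂ L) {g : spinGroup (vecForm L)}
    (hg : ∀ v, ad g v = v) : ∃ r : ℂ, r ^ 2 = 1 ∧ g.1 = algebraMap ℂ _ r := by
  have : Module.Finite ℂ L := Module.Finite.of_basis e
  obtain ⟨r, hr⟩ := Module.End.exists_eigenvalue (spinorRep L g.1)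
  have htop : Module.End.eigenspace (spinorRep L g.1) r = ⊤ := by
    refine eq_top_of_cliffordMul_mem e _ hr fun v x hx => ?_
    rw [Module.End.mem_eigenspace_iff] at hx ⊢
    rw [spinorRep_cliffordMul, hg, hx, map_smul]
  have hgr : g.1 = algebraMap ℂ _ r := by
    apply spinorRep_injective e
    rw [AlgHom.commutes]
    refine LinearMap.ext fun x => ?_
    have : x ∈ Module.End.eigenspace (spinorRep L g.1) r := htop ▸ Submodule.mem_top
    rw [Module.End.mem_eigenspace_iff.mp this, Module.algebraMap_end_apply]
  refine ⟨r, ?_, hgr⟩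
  have h := spinGroup.star_mul_self_of_mem g.2
  rw [hgr, CliffordAlgebra.star_algebraMap, ← map_mul,
    ← map_one (algebraMap ℂ (CliffordAlgebra (vecForm L)))] at h
  rw [sq]
  exact FaithfulSMul.algebraMap_injective ℂ (CliffordAlgebra (vecForm L)) h

/-- An element of the spin group that acts trivially on vectors and on one spinor is `1`. -/
theorem eq_one_of_ad_eq_id (e : Module.Basis (Fin 5) ℂ L) {g : spinGroup (vecForm L)}
    (hg : ∀ v, ad g v = v) {ψ : Spinor L} (hψ : ψ ≠ 0) (hgψ : spinorRep L g.1 ψ = ψ) :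
    g = 1 := by
  obtain ⟨r, -, hr⟩ := eq_algebraMap_of_ad_eq_id e hg
  rw [hr, AlgHom.commutes, Module.algebraMap_end_apply] at hgψ
  have : r = 1 := by
    by_contra h
    have h2 : (r - 1) • ψ = 0 := by rw [sub_smul, one_smul, hgψ, sub_self]
    exact (smul_eq_zero.mp h2).elim (fun h3 => h (sub_eq_zero.mp h3)) hψ
  apply Subtype.ext
  rw [hr, this, map_one]; rfl

/-- Elements of the spin group are determined by their actions on vectors and on one spinor. -/
theorem spin_ext (e : Module.Basis (Fin 5) ℂ L) {g h : spinGroup (vecForm L)}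
    (hgh : ∀ v, ad g v = ad h v) {ψ : Spinor L} (hψ : ψ ≠ 0)
    (hs : spinorRep L g.1 ψ = spinorRep L h.1 ψ) : g = h := by
  rw [← inv_mul_eq_one]
  refine eq_one_of_ad_eq_id e (fun v => ?_) hψ ?_
  · rw [ad_mul_apply, ← hgh, ad_inv_ad]
  · rw [spinorRep_mul_apply, ← hs, spinorRep_inv_apply]

end Ad

/-! ### Isotropic subspaces and Witt frames -/

section Isotropic

variable {L : Type*} [AddCommGroup L] [Module ℂ L] (e : Module.Basis (Fin 5) ℂ L)

/-- The orthogonal complement of a subspace of `V`. -/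
def orth (M : Submodule ℂ (Vec L)) : Submodule ℂ (Vec L) := (LinearMap.dualProd ℂ L).orthogonal M

theorem mem_orth {M : Submodule ℂ (Vec L)} {v : Vec L} :
    v ∈ orth M ↔ ∀ w ∈ M, LinearMap.dualProd ℂ L w v = 0 := Iff.rfl

include e in
theorem finrank_vec : Module.finrank ℂ (Vec L) = 10 := by
  have : Module.Finite ℂ L := Module.Finite.of_basis e
  have h : Module.finrank ℂ L = 5 := by simpa using Module.finrank_eq_card_basis e
  rw [Module.finrank_prod, Subspace.dual_finrank_eq, h]

theorem dualProd_isRefl : (LinearMap.dualProd ℂ L).IsRefl := fun v w h => by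
  rw [dualProd_comm, h]

include e in
theorem dualProd_nondegenerate : (LinearMap.dualProd ℂ L).Nondegenerate := by
  have : Module.Finite ℂ L := Module.Finite.of_basis e
  have h : (LinearMap.dualProd ℂ L).SeparatingLeft := by
    rw [LinearMap.separatingLeft_dualProd]
    exact (Module.evalEquiv ℂ L).injective
  exact ⟨h, fun y hy => h y fun x => by rw [dualProd_comm, hy]⟩

include e in
theorem finrank_add_finrank_orthogonal_dualProd (M : Submodule ℂ (Vec L)) :
    Module.finrank ℂ M + Module.finrank ℂ (orth M) = 10 := by
  have : Module.Finite ℂ L := Module.Finite.of_basis e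
  have h := LinearMap.BilinForm.finrank_orthogonal (dualProd_nondegenerate e) M
  have h2 : Module.finrank ℂ M ≤ Module.finrank ℂ (Vec L) := Submodule.finrank_le M
  have h3 := finrank_vec e
  refine (congrArg (fun n => Module.finrank ℂ M + n) h).trans ((Nat.add_sub_cancel' h2).trans h3)

include e in
theorem orthogonal_orthogonal_dualProd (M : Submodule ℂ (Vec L)) :
    orth (orth M) = M := by
  have : Module.Finite ℂ L := Module.Finite.of_basis e
  exact LinearMap.BilinForm.orthogonal_orthogonal (dualProd_nondegenerate e) dualProd_isRefl M

include e in
theorem eq_zero_of_dualProd_eq_zero {v : Vec L}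
    (h : ∀ w, LinearMap.dualProd ℂ L v w = 0) : v = 0 :=
  (dualProd_nondegenerate e).1 v h

include e in
/-- Every covector of `V` is the inner product with a vector. -/
theorem exists_dualProd_eq (f : Module.Dual ℂ (Vec L)) :
    ∃ v, LinearMap.dualProd ℂ L v = f := by
  have : Module.Finite ℂ L := Module.Finite.of_basis e
  have hinj : Function.Injective (LinearMap.dualProd ℂ L) := by
    rw [injective_iff_map_eq_zero]
    exact fun v hv => eq_zero_of_dualProd_eq_zero e fun w => by rw [hv]; rfl
  exact (LinearMap.injective_iff_surjective_of_finrank_eq_finrank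
    Subspace.dual_finrank_eq.symm).mp hinj _

theorem isIsotropic_iff_le {M : Submodule ℂ (Vec L)} :
    IsIsotropic M ↔ M ≤ orth M :=
  ⟨fun h v hv w hw => h w hw v hv, fun h v hv _ hw => h hw v hv⟩

theorem isIsotropic_sup_span {M : Submodule ℂ (Vec L)} (hM : IsIsotropic M) {v : Vec L}
    (hv : v ∈ orth M) (h0 : vecForm L v = 0) :
    IsIsotropic (M ⊔ ℂ ∙ v) := by
  intro x hx y hy
  obtain ⟨m, hm, s, hs, rfl⟩ := Submodule.mem_sup.mp hx
  obtain ⟨n, hn, t, ht, rfl⟩ := Submodule.mem_sup.mp hy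
  obtain ⟨α, rfl⟩ := Submodule.mem_span_singleton.mp hs
  obtain ⟨β, rfl⟩ := Submodule.mem_span_singleton.mp ht
  have h1 := hv m hm
  have h2 := hv n hn
  have h3 := hM m hm n hn
  have h4 : LinearMap.dualProd ℂ L v v = 0 := by rw [dualProd_self, h0, mul_zero]
  rw [map_add, map_add, LinearMap.add_apply, LinearMap.add_apply, h3, map_smul, map_smul,
    map_smul, LinearMap.smul_apply, LinearMap.smul_apply, h1, h4, dualProd_comm v n, h2]
  simp

/-- A null vector orthogonal to a maximal isotropic subspace belongs to it. -/
theorem mem_of_maximal_isIsotropic {M : Submodule ℂ (Vec L)} (hM : Maximal IsIsotropic M)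
    {v : Vec L} (hv : v ∈ orth M) (h0 : vecForm L v = 0) :
    v ∈ M :=
  hM.2 (isIsotropic_sup_span hM.1 hv h0) le_sup_left
    (Submodule.mem_sup_right (Submodule.mem_span_singleton_self v))

include e in
/-- A maximal isotropic subspace is its own orthogonal complement: otherwise the orthogonal
complement would contain a plane independent of it, and that plane a null vector. -/
theorem orthogonal_eq_of_maximal {M : Submodule ℂ (Vec L)} (hM : Maximal IsIsotropic M) :
    orth M = M := by
  have : Module.Finite ℂ L := Module.Finite.of_basis e
  have hle := isIsotropic_iff_le.mp hM.1
  have hfin := finrank_add_finrank_orthogonal_dualProd e M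
  by_contra hne
  obtain ⟨u, hu, huM⟩ := SetLike.exists_of_lt (lt_of_le_of_ne hle (Ne.symm hne))
  have hQ : ∀ v ∈ orth M, v ∉ M → vecForm L v ≠ 0 :=
    fun v hv hvM h => hvM (mem_of_maximal_isIsotropic hM hv h)
  have hlt : M ⊔ ℂ ∙ u < orth M := by
    refine lt_of_le_of_ne (sup_le hle (by simpa using hu)) fun h => ?_
    have h1 : Module.finrank ℂ M < Module.finrank ℂ (M ⊔ ℂ ∙ u : Submodule ℂ (Vec L)) :=
      Submodule.finrank_lt_finrank_of_lt (lt_of_le_of_ne le_sup_left fun h' => huM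
        (h' ▸ Submodule.mem_sup_right (Submodule.mem_span_singleton_self u)))
    have h2 : Module.finrank ℂ (M ⊔ ℂ ∙ u : Submodule ℂ (Vec L)) ≤
        Module.finrank ℂ M + 1 := by
      refine (Submodule.finrank_add_le_finrank_add_finrank _ _).trans ?_
      have := finrank_span_le_card (R := ℂ) ({u} : Set (Vec L))
      simp only [Set.toFinset_singleton, Finset.card_singleton] at this
      omega
    rw [h] at h1 h2
    omega
  obtain ⟨w, hw, hwM⟩ := SetLike.exists_of_lt hlt
  -- the quadratic equation `Q (s u + w) = 0` has a root `s`
  have hu0 := hQ u hu huM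
  obtain ⟨s, hs⟩ := IsAlgClosed.exists_root
    (Polynomial.C (vecForm L u) * Polynomial.X ^ 2 +
      Polynomial.C (LinearMap.dualProd ℂ L u w) * Polynomial.X + Polynomial.C (vecForm L w))
    (by rw [Polynomial.degree_quadratic hu0]; norm_num)
  have hs' : vecForm L (s • u + w) = 0 := by
    rw [vecForm_add, QuadraticMap.map_smul, map_smul, LinearMap.smul_apply]
    simp only [Polynomial.IsRoot.def, Polynomial.eval_add, Polynomial.eval_mul, Polynomial.eval_C,
      Polynomial.eval_pow, Polynomial.eval_X] at hs
    simp only [smul_eq_mul]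
    linear_combination hs
  have := mem_of_maximal_isIsotropic hM (Submodule.add_mem _ (Submodule.smul_mem _ s hu) hw) hs'
  apply hwM
  have h2 : w = (s • u + w) + (-s) • u := by module
  rw [h2]
  exact Submodule.add_mem_sup this
    (Submodule.smul_mem _ _ (Submodule.mem_span_singleton_self u))

include e in
theorem finrank_of_maximal {M : Submodule ℂ (Vec L)} (hM : Maximal IsIsotropic M) :
    Module.finrank ℂ M = 5 := by
  have : Module.Finite ℂ L := Module.Finite.of_basis e
  have hfin := finrank_add_finrank_orthogonal_dualProd e M
  rw [orthogonal_eq_of_maximal e hM] at hfin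
  omega

include e in
/-- An isotropic family, orthogonal to and independent of a family `x`, has an isotropic dual
family that is orthogonal to `x`. -/
theorem exists_isotropic_dual {ι κ : Type*} [Fintype ι] [DecidableEq ι] (k : ι → Vec L)
    (x : κ → Vec L) (hli : LinearIndependent ℂ (Sum.elim k x))
    (hkk : ∀ i j, LinearMap.dualProd ℂ L (k i) (k j) = 0)
    (hkx : ∀ i j, LinearMap.dualProd ℂ L (k i) (x j) = 0) :
    ∃ k' : ι → Vec L, (∀ i j, LinearMap.dualProd ℂ L (k' i) (k j) = if i = j then 1 else 0) ∧
      (∀ i j, LinearMap.dualProd ℂ L (k' i) (k' j) = 0) ∧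
      ∀ i j, LinearMap.dualProd ℂ L (k' i) (x j) = 0 := by
  classical
  -- a dual family, from the coordinate functionals of the independent family
  have hy : ∀ i, ∃ y : Vec L, (∀ j, LinearMap.dualProd ℂ L y (k j) = if i = j then 1 else 0) ∧
      ∀ j, LinearMap.dualProd ℂ L y (x j) = 0 := by
    intro i
    obtain ⟨f, hf⟩ := LinearMap.exists_extend ((Finsupp.lapply (Sum.inl i)) ∘ₗ
      (hli.repr : _ →ₗ[ℂ] _))
    obtain ⟨y, hy⟩ := exists_dualProd_eq e f
    have hval : ∀ s, f (Sum.elim k x s) = (Finsupp.single s (1 : ℂ)) (Sum.inl i) := by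
      intro s
      have h := LinearMap.congr_fun hf ⟨Sum.elim k x s, Submodule.subset_span ⟨s, rfl⟩⟩
      have h3 := hli.repr_eq_single s ⟨Sum.elim k x s, Submodule.subset_span ⟨s, rfl⟩⟩ rfl
      simp only [LinearMap.comp_apply, Submodule.subtype_apply] at h
      rw [h, h3]; rfl
    refine ⟨y, fun j => ?_, fun j => ?_⟩
    · rw [hy]
      have := hval (Sum.inl j)
      rw [Sum.elim_inl] at this
      rw [this, Finsupp.single_apply]
      simp [eq_comm]
    · rw [hy]
      have := hval (Sum.inr j)
      rw [Sum.elim_inr] at this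
      rw [this, Finsupp.single_apply]
      simp
  choose y hyk hyx using hy
  -- the dual family `y` becomes isotropic after a correction in the span of `k`
  refine ⟨fun i => y i - (2 : ℂ)⁻¹ • ∑ l, LinearMap.dualProd ℂ L (y i) (y l) • k l,
    fun i j => ?_, fun i j => ?_, fun i j => ?_⟩
  · simp only [map_sub, map_smul, map_sum, LinearMap.sub_apply, LinearMap.smul_apply,
      LinearMap.sum_apply, hkk, hyk]
    simp
  · have hky : ∀ i j, LinearMap.dualProd ℂ L (k j) (y i) = if i = j then 1 else 0 := fun i j => by
      rw [dualProd_comm, hyk]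
    simp only [map_sub, map_smul, map_sum, LinearMap.sub_apply, LinearMap.smul_apply,
      LinearMap.sum_apply, hkk, hyk, hky]
    simp only [smul_eq_mul, mul_ite, mul_one, mul_zero, Finset.sum_ite_eq, Finset.mem_univ,
      if_true, Finset.sum_const_zero, sub_zero]
    rw [dualProd_comm (y j) (y i)]
    ring
  · simp only [map_sub, map_smul, map_sum, LinearMap.sub_apply, LinearMap.smul_apply,
      LinearMap.sum_apply, hkx, hyx]
    simp

end Isotropic

/-! ### Fock spaces -/

/-- A pair of dual Lagrangian frames of `V`, together with a vacuum: a nonzero spinor annihilated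
by the vectors `b i`. -/
structure FockFrame (L : Type*) [AddCommGroup L] [Module ℂ L] (ι : Type*) [DecidableEq ι] where
  /-- The creation operators. -/
  a : ι → Vec L
  /-- The annihilation operators. -/
  b : ι → Vec L
  aa : ∀ i j, LinearMap.dualProd ℂ L (a i) (a j) = 0
  bb : ∀ i j, LinearMap.dualProd ℂ L (b i) (b j) = 0
  ab : ∀ i j, LinearMap.dualProd ℂ L (a i) (b j) = if i = j then 1 else 0
  /-- The vacuum. -/
  vacuum : Spinor L
  vacuum_ne_zero : vacuum ≠ 0
  b_vacuum : ∀ i, cliffordMul (b i) vacuum = 0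

namespace FockFrame

variable {L : Type*} [AddCommGroup L] [Module ℂ L] {ι : Type*} [DecidableEq ι]
  (F : FockFrame L ι)

theorem ba (i j : ι) : LinearMap.dualProd ℂ L (F.b i) (F.a j) = if i = j then 1 else 0 := by
  rw [dualProd_comm, F.ab]; simp [eq_comm]

variable [Fintype ι]

theorem linearIndependent : LinearIndependent ℂ (Sum.elim F.a F.b) := by
  rw [Fintype.linearIndependent_iff]
  intro g hg
  have h := fun v => congrArg (LinearMap.dualProd ℂ L v) hg
  simp only [Fintype.sum_sum_type, Sum.elim_inl, Sum.elim_inr, map_add, map_sum, map_smul,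
    map_zero] at h
  rintro (i | i)
  · have := h (F.b i)
    simpa [-LinearMap.dualProd_apply_apply, F.bb, F.ba] using this
  · have := h (F.a i)
    simpa [-LinearMap.dualProd_apply_apply, F.aa, F.ab] using this

/-- The expansion of a vector in the frame. -/
theorem expand (e : Module.Basis (Fin 5) ℂ L) (hι : Fintype.card ι = 5) (v : Vec L) :
    v = ∑ i, LinearMap.dualProd ℂ L (F.b i) v • F.a i +
      ∑ i, LinearMap.dualProd ℂ L (F.a i) v • F.b i := by
  have : Module.Finite ℂ L := Module.Finite.of_basis e
  have hspan := F.linearIndependent.span_eq_top_of_card_eq_finrank'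
    (by rw [Fintype.card_sum, hι, finrank_vec e])
  have hv : v ∈ Submodule.span ℂ (Set.range (Sum.elim F.a F.b)) := hspan ▸ Submodule.mem_top
  obtain ⟨c, hc⟩ := (Submodule.mem_span_range_iff_exists_fun ℂ).mp hv
  simp only [Fintype.sum_sum_type, Sum.elim_inl, Sum.elim_inr] at hc
  have h1 : ∀ i, LinearMap.dualProd ℂ L (F.b i) v = c (Sum.inl i) := fun i => by
    rw [← hc]
    simp [-LinearMap.dualProd_apply_apply, F.bb, F.ba]
  have h2 : ∀ i, LinearMap.dualProd ℂ L (F.a i) v = c (Sum.inr i) := fun i => by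
    rw [← hc]
    simp [-LinearMap.dualProd_apply_apply, F.aa, F.ab]
  simp only [h1, h2]
  exact hc.symm

/-- Linear combinations of the creation operators. -/
def creation : (ι → ℂ) →ₗ[ℂ] Vec L := Fintype.linearCombination ℂ F.a

theorem creation_single (i : ι) : F.creation (Pi.single i 1) = F.a i := by
  simp [creation, Fintype.linearCombination_apply_single]

theorem vecForm_creation (x : ι → ℂ) : vecForm L (F.creation x) = 0 := by
  have : LinearMap.dualProd ℂ L (F.creation x) (F.creation x) = 0 := by
    simp [-LinearMap.dualProd_apply_apply, creation, Fintype.linearCombination_apply, F.aa]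
  rw [dualProd_self] at this
  exact (mul_eq_zero.mp this).resolve_left two_ne_zero

theorem b_creation (i : ι) (x : ι → ℂ) :
    LinearMap.dualProd ℂ L (F.b i) (F.creation x) = x i := by
  simp [-LinearMap.dualProd_apply_apply, creation, Fintype.linearCombination_apply, F.ba]

/-- The exterior algebra on the creation operators, acting on the vacuum. -/
def fock : ExteriorAlgebra ℂ (ι → ℂ) →ₗ[ℂ] Spinor L :=
  LinearMap.applyₗ F.vacuum ∘ₗ (ExteriorAlgebra.lift ℂ
    ⟨cliffordMul ∘ₗ F.creation, fun x => by
      rw [LinearMap.comp_apply, cliffordMul_sq, F.vecForm_creation, map_zero]⟩).toLinearMap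

theorem fock_algebraMap (r : ℂ) : F.fock (algebraMap ℂ _ r) = r • F.vacuum := by
  simp [fock]

theorem fock_ι_mul (x : ι → ℂ) (y : ExteriorAlgebra ℂ (ι → ℂ)) :
    F.fock (ExteriorAlgebra.ι ℂ x * y) = cliffordMul (F.creation x) (F.fock y) := by
  simp [fock]

theorem fock_extContract (i : ι) (y : ExteriorAlgebra ℂ (ι → ℂ)) :
    F.fock (extContract ((Pi.basisFun ℂ ι).coord i) y) = cliffordMul (F.b i) (F.fock y) := by
  induction y using ext_induction with
  | algebraMap r => rw [extContract_algebraMap, fock_algebraMap, map_smul, F.b_vacuum]; simp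
  | add x y hx hy => simp only [map_add, hx, hy]
  | ι_mul m x hx =>
    rw [extContract_ι_mul, map_sub, fock_ι_mul, fock_ι_mul, hx, map_smul,
      cliffordMul_anticomm (F.b i), F.b_creation]
    simp

theorem fock_injective : Function.Injective F.fock := by
  rw [← LinearMap.ker_eq_bot]
  by_contra h
  have h1 := one_mem_of_extContract_mem (Pi.basisFun ℂ ι) _ h fun i x hx => by
    rw [LinearMap.mem_ker] at hx ⊢
    rw [fock_extContract, hx, map_zero]
  rw [LinearMap.mem_ker, ← map_one (algebraMap ℂ _), fock_algebraMap, one_smul] at h1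
  exact F.vacuum_ne_zero h1

theorem fock_surjective (e : Module.Basis (Fin 5) ℂ L) (hι : Fintype.card ι = 5) :
    Function.Surjective F.fock := by
  rw [← LinearMap.range_eq_top]
  have h0 : F.vacuum ∈ LinearMap.range F.fock :=
    ⟨algebraMap ℂ _ 1, by rw [fock_algebraMap, one_smul]⟩
  refine eq_top_of_cliffordMul_mem e _ (fun h => ?_) fun v x hx => ?_
  · rw [h] at h0
    exact F.vacuum_ne_zero ((Submodule.mem_bot ℂ).mp h0)
  · obtain ⟨y, rfl⟩ := hx
    rw [F.expand e hι v]
    simp only [map_add, map_sum, map_smul, LinearMap.add_apply, LinearMap.sum_apply,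
      LinearMap.smul_apply]
    refine Submodule.add_mem _ (Submodule.sum_mem _ fun i _ => Submodule.smul_mem _ _ ?_)
      (Submodule.sum_mem _ fun i _ => Submodule.smul_mem _ _ ?_)
    · exact ⟨_, by rw [F.fock_ι_mul, F.creation_single]⟩
    · exact ⟨_, F.fock_extContract i y⟩

/-- The vacuum is determined up to scale by its annihilation operators. -/
theorem exists_smul_vacuum (e : Module.Basis (Fin 5) ℂ L) (hι : Fintype.card ι = 5)
    {χ : Spinor L} (hχ : ∀ i, cliffordMul (F.b i) χ = 0) : ∃ r : ℂ, χ = r • F.vacuum := by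
  obtain ⟨y, rfl⟩ := F.fock_surjective e hι χ
  obtain ⟨r, rfl⟩ := exists_algebraMap_of_extContract_eq_zero (Pi.basisFun ℂ ι) y fun i => by
    apply F.fock_injective
    rw [fock_extContract, hχ, map_zero]
  exact ⟨r, F.fock_algebraMap r⟩

end FockFrame

/-! ### The invariant pairing of spinors -/

section Pairing

variable {L : Type*} [AddCommGroup L] [Module ℂ L] (e : Module.Basis (Fin 5) ℂ L)

theorem topCoeff_apply (x : Spinor L) : topCoeff e x = ExteriorAlgebra.algebraMapInv
    (contract (e 4) (contract (e 3) (contract (e 2) (contract (e 1) (contract (e 0) x))))) := rfl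

theorem contract_contract_comm (l m : L) (x : Spinor L) :
    contract l (contract m x) = -contract m (contract l x) := extContract_comm _ _ _

theorem contract_contract_self (l : L) (x : Spinor L) : contract l (contract l x) = 0 :=
  extContract_extContract _ _

theorem topCoeff_contract (l : L) (x : Spinor L) : topCoeff e (contract l x) = 0 := by
  have h : ∀ i, topCoeff e (contract (e i) x) = 0 := by
    intro i
    rw [topCoeff_apply]
    fin_cases i
    · simp only [Fin.zero_eta, contract_contract_self, map_zero]
    · simp only [Fin.mk_one, contract_contract_comm (e 0) (e 1), map_neg, contract_contract_self,
        map_zero, neg_zero]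
    · simp only [Fin.reduceFinMk, contract_contract_comm (e 0) (e 2),
        contract_contract_comm (e 1) (e 2), map_neg, contract_contract_self, map_zero, neg_zero]
    · simp only [Fin.reduceFinMk, contract_contract_comm (e 0) (e 3),
        contract_contract_comm (e 1) (e 3), contract_contract_comm (e 2) (e 3), map_neg,
        contract_contract_self, map_zero, neg_zero]
    · simp only [Fin.reduceFinMk, contract_contract_comm (e 0) (e 4),
        contract_contract_comm (e 1) (e 4), contract_contract_comm (e 2) (e 4),
        contract_contract_comm (e 3) (e 4), map_neg,
        contract_contract_self, map_zero, neg_zero]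
  have h2 : contract l x = ∑ i, e.repr l i • contract (e i) x := by
    rw [← cliffordMul_zero_snd]
    have : ((0, l) : Vec L) = ∑ i, e.repr l i • ((0, e i) : Vec L) := by
      refine Prod.ext ?_ ?_
      · simp [Prod.fst_sum]
      · simp [Prod.snd_sum, e.sum_repr]
    rw [this]
    simp only [map_sum, map_smul, LinearMap.sum_apply, LinearMap.smul_apply, cliffordMul_zero_snd]
  rw [h2, map_sum]
  exact Finset.sum_eq_zero fun i _ => by rw [map_smul, h, smul_zero]

theorem spinorPairing_apply (ψ φ : Spinor L) : spinorPairing e ψ φ =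
    topCoeff e (CliffordAlgebra.reverse (Q := (0 : QuadraticForm ℂ (Module.Dual ℂ L))) ψ * φ) :=
  rfl

theorem spinorPairing_ι_mul (f : Module.Dual ℂ L) (ψ φ : Spinor L) :
    spinorPairing e (ExteriorAlgebra.ι ℂ f * ψ) φ =
      spinorPairing e ψ (ExteriorAlgebra.ι ℂ f * φ) := by
  have h : CliffordAlgebra.reverse (Q := (0 : QuadraticForm ℂ (Module.Dual ℂ L)))
      (ExteriorAlgebra.ι ℂ f) = ExteriorAlgebra.ι ℂ f := CliffordAlgebra.reverse_ι f
  rw [spinorPairing_apply, spinorPairing_apply, CliffordAlgebra.reverse.map_mul, h, mul_assoc]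

theorem spinorPairing_contract (l : L) (ψ φ : Spinor L) :
    spinorPairing e (contract l ψ) φ = spinorPairing e ψ (contract l φ) := by
  induction ψ using ext_induction generalizing φ with
  | algebraMap r =>
    have h : contract l (algebraMap ℂ (Spinor L) r) = 0 := extContract_algebraMap _ _
    rw [h, map_zero, LinearMap.zero_apply, spinorPairing_apply, CliffordAlgebra.reverse.commutes,
      ← Algebra.smul_def, map_smul, topCoeff_contract, smul_zero]
  | add x y hx hy => simp only [map_add, LinearMap.add_apply, hx, hy]
  | ι_mul f x hx =>
    rw [contract_ι_mul, map_sub, LinearMap.sub_apply, spinorPairing_ι_mul, hx, contract_ι_mul,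
      map_sub, map_smul, map_smul, LinearMap.smul_apply, spinorPairing_ι_mul]
    abel

/-- Vectors are self-adjoint for the pairing of spinors. -/
theorem spinorPairing_cliffordMul (v : Vec L) (ψ φ : Spinor L) :
    spinorPairing e (cliffordMul v ψ) φ = spinorPairing e ψ (cliffordMul v φ) := by
  rw [cliffordMul_apply, cliffordMul_apply, map_add, LinearMap.add_apply, map_add,
    spinorPairing_ι_mul, spinorPairing_contract]

theorem topCoeff_top : topCoeff e (ExteriorAlgebra.ι ℂ (e.coord 0) *
    (ExteriorAlgebra.ι ℂ (e.coord 1) * (ExteriorAlgebra.ι ℂ (e.coord 2) *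
      (ExteriorAlgebra.ι ℂ (e.coord 3) * (ExteriorAlgebra.ι ℂ (e.coord 4) * 1))))) = 1 := by
  have h : ∀ l : L, contract l (1 : Spinor L) = 0 := fun l => extContract_one _
  rw [topCoeff_apply]
  simp [contract_ι_mul, h, -mul_one]

/-- The left radical of the pairing of spinors vanishes, since it is a subrepresentation. -/
theorem eq_zero_of_spinorPairing_eq_zero {χ : Spinor L}
    (h : ∀ φ, spinorPairing e χ φ = 0) : χ = 0 := by
  by_contra hχ
  have htop : LinearMap.ker (spinorPairing e) = ⊤ := by
    refine eq_top_of_cliffordMul_mem e _ (fun hbot => hχ ?_) fun v x hx => ?_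
    · rw [← Submodule.mem_bot ℂ, ← hbot, LinearMap.mem_ker]
      exact LinearMap.ext h
    · rw [LinearMap.mem_ker] at hx ⊢
      refine LinearMap.ext fun φ => ?_
      rw [spinorPairing_cliffordMul, hx]; rfl
  have h1 : (1 : Spinor L) ∈ LinearMap.ker (spinorPairing e) := htop ▸ Submodule.mem_top
  have h2 := topCoeff_top e
  rw [← one_mul (ExteriorAlgebra.ι ℂ (e.coord 0) * _),
    ← CliffordAlgebra.reverse.map_one (Q := (0 : QuadraticForm ℂ (Module.Dual ℂ L)))] at h2
  rw [← spinorPairing_apply, LinearMap.mem_ker.mp h1] at h2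
  exact zero_ne_one h2

theorem algebraMapInv_eq_zero_of_odd {x : Spinor L}
    (hx : x ∈ CliffordAlgebra.evenOdd (0 : QuadraticForm ℂ (Module.Dual ℂ L)) 1) :
    ExteriorAlgebra.algebraMapInv x = 0 := by
  have h : (ExteriorAlgebra.algebraMapInv (R := ℂ) (M := Module.Dual ℂ L)).comp
      (CliffordAlgebra.involute (Q := (0 : QuadraticForm ℂ (Module.Dual ℂ L)))) =
      ExteriorAlgebra.algebraMapInv := by
    apply ExteriorAlgebra.hom_ext
    refine LinearMap.ext fun f => ?_
    have h4 : CliffordAlgebra.involute (Q := (0 : QuadraticForm ℂ (Module.Dual ℂ L)))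
      (ExteriorAlgebra.ι ℂ f) = - ExteriorAlgebra.ι ℂ f := CliffordAlgebra.involute_ι f
    simp [h4, ExteriorAlgebra.algebraMapInv]
  have h2 := congrArg (fun g => g x) h
  simp only [AlgHom.comp_apply, CliffordAlgebra.involute_eq_of_mem_odd hx, map_neg] at h2
  linear_combination -(1 / 2) * h2

/-- Spinors of odd chirality pair to zero with each other. -/
theorem spinorPairing_odd_odd {χ φ : Spinor L}
    (hχ : χ ∈ CliffordAlgebra.evenOdd (0 : QuadraticForm ℂ (Module.Dual ℂ L)) 1)
    (hφ : φ ∈ CliffordAlgebra.evenOdd (0 : QuadraticForm ℂ (Module.Dual ℂ L)) 1) :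
    spinorPairing e χ φ = 0 := by
  rw [spinorPairing_apply, topCoeff_apply]
  apply algebraMapInv_eq_zero_of_odd
  have hr : CliffordAlgebra.reverse (Q := (0 : QuadraticForm ℂ (Module.Dual ℂ L))) χ ∈
      CliffordAlgebra.evenOdd (0 : QuadraticForm ℂ (Module.Dual ℂ L)) 1 := by
    rw [CliffordAlgebra.reverse_mem_evenOdd_iff]; exact hχ
  have h := SetLike.mul_mem_graded hr hφ
  have h5 := contract_mem (e 4) _ _ (contract_mem (e 3) _ _ (contract_mem (e 2) _ _
    (contract_mem (e 1) _ _ (contract_mem (e 0) _ _ h))))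
  have e5 : (1 + (1 + (1 + (1 + (1 + (1 + 1))))) : ZMod 2) = 1 := by decide
  rw [e5] at h5
  exact h5

theorem eq_zero_of_odd_of_spinorPairing_even_eq_zero {χ : Spinor L}
    (hχ : χ ∈ CliffordAlgebra.evenOdd (0 : QuadraticForm ℂ (Module.Dual ℂ L)) 1)
    (h : ∀ φ : SPlus L, spinorPairing e χ φ.1 = 0) : χ = 0 := by
  refine eq_zero_of_spinorPairing_eq_zero e fun φ => ?_
  have hφ : φ ∈ SPlus L ⊔ CliffordAlgebra.evenOdd (0 : QuadraticForm ℂ (Module.Dual ℂ L)) 1 := by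
    rw [(CliffordAlgebra.evenOdd_isCompl (0 : QuadraticForm ℂ (Module.Dual ℂ L))).sup_eq_top]
    exact Submodule.mem_top
  obtain ⟨φ₀, h₀, φ₁, h₁, rfl⟩ := Submodule.mem_sup.mp hφ
  rw [map_add, h ⟨φ₀, h₀⟩, spinorPairing_odd_odd e hχ h₁, add_zero]

theorem dualProd_gamma' (v : Vec L) (ψ φ : SPlus L) :
    LinearMap.dualProd ℂ L v (gamma e ψ φ) = spinorPairing e (cliffordMul v ψ.1) φ.1 := by
  rw [dualProd_gamma, spinorPairing_cliffordMul]

theorem mem_ann {v : Vec L} {ψ : Spinor L} : v ∈ ann ψ ↔ cliffordMul v ψ = 0 := by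
  simp [ann]

/-- A vector orthogonal to `γ(ψ, S_+)` annihilates `ψ`. -/
theorem cliffordMul_eq_zero_iff {v : Vec L} {ψ : SPlus L} : cliffordMul v ψ.1 = 0 ↔
    ∀ φ : SPlus L, LinearMap.dualProd ℂ L v (gamma e ψ φ) = 0 := by
  refine ⟨fun h φ => by rw [dualProd_gamma', h]; simp, fun h => ?_⟩
  exact eq_zero_of_odd_of_spinorPairing_even_eq_zero e (cliffordMul_mem v 0 _ ψ.2)
    fun φ => by rw [← dualProd_gamma', h]

end Pairing

/-! ### Supercharges in a null basis of `W` -/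

section Bracket

variable {L : Type*} [AddCommGroup L] [Module ℂ L] {W : Type*} [AddCommGroup W] [Module ℂ W]

/-- The plane `W` has a basis of null vectors with inner product `1`. -/
theorem exists_null_basis (hW : Module.finrank ℂ W = 2) {B : LinearMap.BilinForm ℂ W}
    (hsymm : B.IsSymm) (hB : B.Nondegenerate) : ∃ w : Module.Basis (Fin 2) ℂ W,
      B (w 0) (w 0) = 0 ∧ B (w 1) (w 1) = 0 ∧ B (w 0) (w 1) = 1 ∧ B (w 1) (w 0) = 1 := by
  have : Module.Finite ℂ W := Module.finite_of_finrank_pos (by omega)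
  obtain ⟨v, hv⟩ := LinearMap.BilinForm.exists_orthogonal_basis
    (LinearMap.BilinForm.isSymm_iff.mp hsymm)
  have hne := hv.not_isOrtho_basis_self_of_separatingLeft hB.1
  let i0 : Fin (Module.finrank ℂ W) := ⟨0, by omega⟩
  let i1 : Fin (Module.finrank ℂ W) := ⟨1, by omega⟩
  have h00 : B (v i0) (v i0) ≠ 0 := hne i0
  have h11 : B (v i1) (v i1) ≠ 0 := hne i1
  have h01 : B (v i0) (v i1) = 0 := hv (by simp [i0, i1])
  have h10 : B (v i1) (v i0) = 0 := hv (by simp [i0, i1])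
  -- rescale to squares `1` and `-1`; the sum and the difference are then null
  obtain ⟨α, hα⟩ := IsAlgClosed.exists_pow_nat_eq (B (v i0) (v i0))⁻¹ two_pos
  obtain ⟨β, hβ⟩ := IsAlgClosed.exists_pow_nat_eq (-(B (v i1) (v i1))⁻¹) two_pos
  have hα' : α ^ 2 * B (v i0) (v i0) = 1 := by rw [hα, inv_mul_cancel₀ h00]
  have hβ' : β ^ 2 * B (v i1) (v i1) = -1 := by rw [hβ, neg_mul, inv_mul_cancel₀ h11]
  obtain ⟨x, hx⟩ : ∃ x, x = (2 : ℂ)⁻¹ • (α • v i0 + β • v i1) := ⟨_, rfl⟩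
  obtain ⟨y, hy⟩ : ∃ y, y = α • v i0 - β • v i1 := ⟨_, rfl⟩
  have e00 : B x x = 0 := by
    simp only [hx, map_smul, map_add, LinearMap.smul_apply, LinearMap.add_apply, h01, h10,
      smul_eq_mul]
    linear_combination (1 / 4) * hα' + (1 / 4) * hβ'
  have e11 : B y y = 0 := by
    simp only [hy, map_smul, map_sub, LinearMap.smul_apply, LinearMap.sub_apply, h01, h10,
      smul_eq_mul]
    linear_combination hα' + hβ'
  have e01 : B x y = 1 := by
    simp only [hx, hy, map_smul, map_add, map_sub, LinearMap.smul_apply, LinearMap.add_apply,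
      h01, h10, smul_eq_mul]
    linear_combination (1 / 2) * hα' - (1 / 2) * hβ'
  have e10 : B y x = 1 := by rw [← e01]; exact hsymm.eq _ _
  have hli : LinearIndependent ℂ ![x, y] := by
    rw [LinearIndependent.pair_iff' (fun h => by rw [h] at e01; simp at e01)]
    intro c hc
    have h1 := congrArg (B x) hc
    rw [map_smul, e00, e01, smul_zero] at h1
    exact zero_ne_one h1
  let w := basisOfLinearIndependentOfCardEqFinrank hli (by simp [hW])
  have hw0 : w 0 = x := by simp [w]
  have hw1 : w 1 = y := by simp [w]
  exact ⟨w, by rwa [hw0], by rwa [hw1], by rwa [hw0, hw1], by rwa [hw0, hw1]⟩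

theorem toMap_tmul (ψ : SPlus L) (x : W) (f : Module.Dual ℂ W) :
    toMap (ψ ⊗ₜ[ℂ] x) f = f x • ψ := by simp [toMap]

theorem toMap_add (Q Q' : Supercharge L W) (f : Module.Dual ℂ W) :
    toMap (Q + Q') f = toMap Q f + toMap Q' f := by simp [toMap]

/-- The expansion of a supercharge in a basis of `W`. -/
theorem supercharge_eq (w : Module.Basis (Fin 2) ℂ W) (Q : Supercharge L W) :
    Q = toMap Q (w.coord 0) ⊗ₜ[ℂ] w 0 + toMap Q (w.coord 1) ⊗ₜ[ℂ] w 1 := by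
  induction Q using TensorProduct.induction_on with
  | zero => simp [toMap]
  | tmul ψ x =>
    rw [toMap_tmul, toMap_tmul, TensorProduct.smul_tmul, TensorProduct.smul_tmul,
      ← TensorProduct.tmul_add]
    congr 1
    conv_lhs => rw [← w.sum_repr x, Fin.sum_univ_two]
    rfl
  | add Q Q' h h' =>
    rw [toMap_add, toMap_add, TensorProduct.add_tmul, TensorProduct.add_tmul]
    conv_lhs => rw [h, h']
    abel

theorem bracket_tmul (e : Module.Basis (Fin 5) ℂ L) (B : LinearMap.BilinForm ℂ W)
    (ψ φ : SPlus L) (x y : W) :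
    bracket e B (ψ ⊗ₜ[ℂ] x) (φ ⊗ₜ[ℂ] y) = B x y • gamma e ψ φ := by
  simp [bracket]

/-- The orthogonal complement of the image of `[Q, -]` is the common annihilator of the spinors
in `S_Q`. -/
theorem orth_range_bracket (e : Module.Basis (Fin 5) ℂ L) {B : LinearMap.BilinForm ℂ W}
    {w : Module.Basis (Fin 2) ℂ W} (h00 : B (w 0) (w 0) = 0) (h11 : B (w 1) (w 1) = 0)
    (h01 : B (w 0) (w 1) = 1) (h10 : B (w 1) (w 0) = 1) (ψ₁ ψ₂ : SPlus L) :
    orth (LinearMap.range (bracket e B (ψ₁ ⊗ₜ[ℂ] w 0 + ψ₂ ⊗ₜ[ℂ] w 1))) =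
      ann ψ₁.1 ⊓ ann ψ₂.1 := by
  ext v
  rw [Submodule.mem_inf, mem_ann, mem_ann, cliffordMul_eq_zero_iff e, cliffordMul_eq_zero_iff e,
    mem_orth]
  refine ⟨fun h => ⟨fun φ => ?_, fun φ => ?_⟩, ?_⟩
  · rw [dualProd_comm]
    refine h _ ⟨φ ⊗ₜ[ℂ] w 1, ?_⟩
    rw [map_add, LinearMap.add_apply, bracket_tmul, bracket_tmul, h01, h11, one_smul, zero_smul,
      add_zero]
  · rw [dualProd_comm]
    refine h _ ⟨φ ⊗ₜ[ℂ] w 0, ?_⟩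
    rw [map_add, LinearMap.add_apply, bracket_tmul, bracket_tmul, h00, h10, one_smul, zero_smul,
      zero_add]
  · rintro ⟨h1, h2⟩ _ ⟨x, rfl⟩
    rw [dualProd_comm]
    induction x using TensorProduct.induction_on with
    | zero => rw [map_zero, map_zero]
    | tmul φ y =>
      rw [map_add, LinearMap.add_apply, bracket_tmul, bracket_tmul, map_add, map_smul, map_smul,
        h1, h2, smul_zero, smul_zero, add_zero]
    | add x y hx hy => rw [map_add, map_add, hx, hy, add_zero]

end Bracket

/-! ### Lines of pure spinors -/

section PureLine

variable {L : Type*} [AddCommGroup L] [Module ℂ L] (e : Module.Basis (Fin 5) ℂ L)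

include e in
/-- A pure spinor is determined up to scale by its annihilator. -/
theorem exists_smul_of_ann_eq {ψ₁ ψ₂ : Spinor L} (h0 : ψ₁ ≠ 0) (h1 : IsPure ψ₁)
    (h : ann ψ₁ ≤ ann ψ₂) : ∃ r : ℂ, ψ₂ = r • ψ₁ := by
  have : Module.Finite ℂ L := Module.Finite.of_basis e
  let k := Module.finBasisOfFinrankEq ℂ (ann ψ₁) (finrank_of_maximal e h1)
  have hkk : ∀ i j, LinearMap.dualProd ℂ L (k i : Vec L) (k j) = 0 := fun i j =>
    h1.1 _ (k i).2 _ (k j).2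
  have hli : LinearIndependent ℂ (Sum.elim (fun i => (k i : Vec L)) (Empty.elim)) := by
    have := k.linearIndependent.map' (ann ψ₁).subtype (Submodule.ker_subtype _)
    exact LinearIndependent.sum_type this (linearIndependent_empty_type)
      (by rw [Set.range_eq_empty Empty.elim, Submodule.span_empty]; exact disjoint_bot_right)
  obtain ⟨k', hk'k, hk'k', -⟩ := exists_isotropic_dual e _ _ hli hkk (fun i j => j.elim)
  let F : FockFrame L (Fin 5) := ⟨k', fun i => k i, hk'k', hkk, hk'k, ψ₁, h0,
    fun i => mem_ann.mp (k i).2⟩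
  exact F.exists_smul_vacuum e (by simp) fun i => mem_ann.mp (h (k i).2)

include e in
/-- The spinors `ψ₁, ψ₂` of a basis of a line of pure spinors satisfy `ψ₂ = q₀ q₁ ψ₁` for two
vectors annihilating `ψ₂`. For a vector `v` annihilating `ψ₁ + ψ₂` but not `ψ₁`, the
decomposition `v = u₁ + u₂` with `uᵢ ψᵢ = 0` gives `u₂ ψ₁ = -u₁ ψ₂`, and applying a vector dual
to `u₁` recovers `ψ₂` from `ψ₁`. -/
theorem exists_eq_cliffordMul_cliffordMul {ψ₁ ψ₂ : Spinor L} (hli : LinearIndependent ℂ ![ψ₁, ψ₂])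
    (h₁ : IsPure ψ₁) (h₂ : IsPure ψ₂) (h₃ : IsPure (ψ₁ + ψ₂)) :
    ∃ q : Fin 2 → Vec L, (∀ i, q i ∈ ann ψ₂) ∧
      ψ₂ = cliffordMul (q 0) (cliffordMul (q 1) ψ₁) := by
  have hψ₁ : ψ₁ ≠ 0 := hli.ne_zero 0
  have hor₁ := orthogonal_eq_of_maximal e h₁
  have hor₂ := orthogonal_eq_of_maximal e h₂
  have hpair := LinearIndependent.pair_iff.mp hli
  -- otherwise all three annihilators agree, and a pure spinor is determined by its annihilator
  obtain ⟨v, hv₃, hv₁⟩ : ∃ v ∈ ann (ψ₁ + ψ₂), v ∉ ann ψ₁ := by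
    by_contra! hcon
    have h31 : ann ψ₁ ≤ ann (ψ₁ + ψ₂) := h₃.2 h₁.1 hcon
    have h12 : ann ψ₁ ≤ ann ψ₂ := fun v hv => by
      have := mem_ann.mp (h31 hv)
      rw [map_add, mem_ann.mp hv, zero_add] at this
      exact mem_ann.mpr this
    obtain ⟨r, hr⟩ := exists_smul_of_ann_eq e hψ₁ h₁ h12
    have := (hpair r (-1) (by rw [hr]; module)).2
    norm_num at this
  have hv : cliffordMul v ψ₁ = - cliffordMul v ψ₂ := by
    rw [mem_ann, map_add] at hv₃
    exact eq_neg_of_add_eq_zero_left hv₃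
  have hsup : orth (ann ψ₁ ⊓ ann ψ₂) = ann ψ₁ ⊔ ann ψ₂ := by
    rw [← orthogonal_orthogonal_dualProd e (ann ψ₁ ⊔ ann ψ₂)]
    congr 1
    conv_lhs => rw [← hor₁, ← hor₂]
    ext x
    simp only [Submodule.mem_inf, mem_orth]
    refine ⟨fun h w hw => ?_, fun h => ⟨fun w hw => h w (Submodule.mem_sup_left hw),
      fun w hw => h w (Submodule.mem_sup_right hw)⟩⟩
    obtain ⟨y, hy, z, hz, rfl⟩ := Submodule.mem_sup.mp hw
    rw [map_add, LinearMap.add_apply, h.1 y hy, h.2 z hz, add_zero]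
  have hvsup : v ∈ ann ψ₁ ⊔ ann ψ₂ := by
    -- for `w ∈ ann ψ₁ ⊓ ann ψ₂`, applying `w` to `v ψ₁ = -v ψ₂` gives `⟨w, v⟩ ψ₁ = -⟨w, v⟩ ψ₂`
    rw [← hsup, mem_orth]
    intro w hw
    have h := congrArg (cliffordMul w) hv
    rw [cliffordMul_anticomm, map_neg, cliffordMul_anticomm w v ψ₂, mem_ann.mp hw.1,
      mem_ann.mp hw.2, map_zero, sub_zero, sub_zero] at h
    exact (hpair _ (LinearMap.dualProd ℂ L w v) (by rw [h]; module)).1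
  obtain ⟨u₁, hu₁, u₂, hu₂, rfl⟩ := Submodule.mem_sup.mp hvsup
  have huu : cliffordMul u₂ ψ₁ = - cliffordMul u₁ ψ₂ := by
    rw [map_add, LinearMap.add_apply, LinearMap.add_apply, mem_ann.mp hu₁, mem_ann.mp hu₂] at hv
    rwa [zero_add, add_zero] at hv
  have hu₁' : u₁ ∉ ann ψ₂ := fun h => hv₁ (by
    rw [mem_ann.mp h, neg_zero] at huu
    exact Submodule.add_mem _ hu₁ (mem_ann.mpr huu))
  obtain ⟨w, hw, hwu⟩ : ∃ w ∈ ann ψ₂, LinearMap.dualProd ℂ L w u₁ = 1 := by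
    rw [← hor₂, mem_orth] at hu₁'
    push Not at hu₁'
    obtain ⟨w, hw, hwu⟩ := hu₁'
    refine ⟨(LinearMap.dualProd ℂ L w u₁)⁻¹ • w, Submodule.smul_mem _ _ hw, ?_⟩
    rw [map_smul, LinearMap.smul_apply, smul_eq_mul, inv_mul_cancel₀ hwu]
  refine ⟨![-w, u₂], fun i => ?_, ?_⟩
  · fin_cases i
    · exact Submodule.neg_mem _ hw
    · exact hu₂
  · change ψ₂ = cliffordMul (-w) (cliffordMul u₂ ψ₁)
    rw [huu, map_neg, map_neg, LinearMap.neg_apply, neg_neg, cliffordMul_anticomm, hwu,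
      mem_ann.mp hw, map_zero, one_smul, sub_zero]

/-- If `q₀ q₁ ψ₁ ≠ 0` for orthogonal null vectors, then no combination of `q₀, q₁` annihilates
`ψ₁`. -/
theorem eq_zero_of_smul_add_smul_mem_ann {ψ : Spinor L} {q : Fin 2 → Vec L}
    (hqq : ∀ i j, LinearMap.dualProd ℂ L (q i) (q j) = 0)
    (h0 : cliffordMul (q 0) (cliffordMul (q 1) ψ) ≠ 0) {α β : ℂ}
    (h : α • q 0 + β • q 1 ∈ ann ψ) : α = 0 ∧ β = 0 := by
  rw [mem_ann, map_add, map_smul, map_smul, LinearMap.add_apply, LinearMap.smul_apply,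
    LinearMap.smul_apply] at h
  have hsq : ∀ i x, cliffordMul (q i) (cliffordMul (q i) x) = 0 := fun i x => by
    have := dualProd_self (q i)
    rw [hqq] at this
    rw [cliffordMul_cliffordMul, (mul_eq_zero.mp this.symm).resolve_left two_ne_zero, zero_smul]
  have e0 := congrArg (cliffordMul (q 0)) h
  have e1 := congrArg (cliffordMul (q 1)) h
  rw [map_add, map_smul, map_smul, map_zero, hsq, smul_zero, zero_add] at e0
  rw [map_add, map_smul, map_smul, map_zero, hsq, smul_zero, add_zero, cliffordMul_anticomm, hqq,
    zero_smul, zero_sub, smul_neg, neg_eq_zero] at e1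
  exact ⟨(smul_eq_zero.mp e1).resolve_right h0, (smul_eq_zero.mp e0).resolve_right h0⟩

/-- The inner products with `q₀, q₁` on a Lagrangian subspace. -/
def pairingMap (M : Submodule ℂ (Vec L)) (q : Fin 2 → Vec L) : M →ₗ[ℂ] (Fin 2 → ℂ) :=
  LinearMap.pi fun i => LinearMap.dualProd ℂ L (q i) ∘ₗ M.subtype

theorem pairingMap_apply (M : Submodule ℂ (Vec L)) (q : Fin 2 → Vec L) (x : M) (i : Fin 2) :
    pairingMap M q x i = LinearMap.dualProd ℂ L (q i) x := rfl

/-- A functional vanishing on the range would be a combination of `q₀, q₁` orthogonal to the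
Lagrangian subspace, hence inside it. -/
theorem range_pairingMap {M : Submodule ℂ (Vec L)} (hM : orth M = M) {q : Fin 2 → Vec L}
    (hq : ∀ α β : ℂ, α • q 0 + β • q 1 ∈ M → α = 0 ∧ β = 0) :
    LinearMap.range (pairingMap M q) = ⊤ := by
  by_contra hne
  obtain ⟨f, hf0, hf⟩ := Submodule.exists_le_ker_of_lt_top _ (lt_top_iff_ne_top.mpr hne)
  have hfx : ∀ x : Fin 2 → ℂ, f x = f (Pi.single 0 1) * x 0 + f (Pi.single 1 1) * x 1 := by
    intro x
    have hx : x = x 0 • Pi.single 0 1 + x 1 • Pi.single 1 1 := by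
      ext i
      fin_cases i <;> simp
    conv_lhs => rw [hx]
    rw [map_add, map_smul, map_smul, smul_eq_mul, smul_eq_mul, mul_comm,
      mul_comm (f (Pi.single 1 1))]
  have h0 := hq (f (Pi.single 0 1)) (f (Pi.single 1 1)) (by
    rw [← hM, mem_orth]
    intro p hp
    have := LinearMap.mem_ker.mp (hf ⟨⟨p, hp⟩, rfl⟩)
    rw [hfx, pairingMap_apply, pairingMap_apply] at this
    rw [dualProd_comm, map_add, map_smul, map_smul, LinearMap.add_apply, LinearMap.smul_apply,
      LinearMap.smul_apply, smul_eq_mul, smul_eq_mul]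
    exact this)
  exact hf0 (LinearMap.ext fun x => by rw [hfx, h0.1, h0.2]; simp)

include e in
/-- Vectors dual to `q₀, q₁` and a basis of the orthogonal complement of `q₀, q₁` in a Lagrangian
subspace. -/
theorem exists_dual_and_ker {M : Submodule ℂ (Vec L)} (hM : Maximal IsIsotropic M)
    {q : Fin 2 → Vec L} (hq : ∀ α β : ℂ, α • q 0 + β • q 1 ∈ M → α = 0 ∧ β = 0) :
    ∃ (p : Fin 2 → Vec L) (k : Fin 3 → Vec L), (∀ i, p i ∈ M) ∧ (∀ i, k i ∈ M) ∧
      LinearIndependent ℂ k ∧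
      (∀ i j, LinearMap.dualProd ℂ L (q i) (p j) = if i = j then 1 else 0) ∧
      ∀ i j, LinearMap.dualProd ℂ L (q i) (k j) = 0 := by
  have : Module.Finite ℂ L := Module.Finite.of_basis e
  have hT := range_pairingMap (orthogonal_eq_of_maximal e hM) hq
  have hp : ∀ j : Fin 2, ∃ p : M, pairingMap M q p = Pi.single j 1 := fun j =>
    LinearMap.range_eq_top.mp hT _
  choose p hp using hp
  have hker : Module.finrank ℂ ((LinearMap.ker (pairingMap M q)).map M.subtype) = 3 := by
    have h := LinearMap.finrank_range_add_finrank_ker (pairingMap M q)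
    rw [hT, finrank_top, Module.finrank_fin_fun, finrank_of_maximal e hM] at h
    have h2 := Submodule.finrank_map_subtype_eq M (LinearMap.ker (pairingMap M q))
    omega
  let k := Module.finBasisOfFinrankEq ℂ ((LinearMap.ker (pairingMap M q)).map M.subtype) hker
  have hk : ∀ i, ∃ x ∈ LinearMap.ker (pairingMap M q), (x : Vec L) = k i := fun i => (k i).2
  refine ⟨fun i => p i, fun i => k i, fun i => (p i).2, fun i => ?_, ?_,
    fun i j => ?_, fun i j => ?_⟩
  · obtain ⟨x, -, hx⟩ := hk i
    change (k i : Vec L) ∈ M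
    rw [← hx]
    exact x.2
  · exact k.linearIndependent.map' (Submodule.subtype _) (Submodule.ker_subtype _)
  · have := congrFun (hp j) i
    rw [Pi.single_apply] at this
    exact this
  · obtain ⟨x, hx0, hx⟩ := hk j
    change LinearMap.dualProd ℂ L (q i) (k j : Vec L) = 0
    rw [← hx]
    exact congrFun (LinearMap.mem_ker.mp hx0) i

include e in
/-- A line of pure spinors consists of a vacuum `ψ₁` and a spinor `q₀ q₁ ψ₁` in its Fock space, for
two creation operators `q₀, q₁`. -/
theorem exists_fockFrame {ψ₁ ψ₂ : Spinor L} (hli : LinearIndependent ℂ ![ψ₁, ψ₂])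
    (h₁ : IsPure ψ₁) (h₂ : IsPure ψ₂) (h₃ : IsPure (ψ₁ + ψ₂)) :
    ∃ F : FockFrame L (Fin 3 ⊕ Fin 2), F.vacuum = ψ₁ ∧
      ψ₂ = cliffordMul (F.a (.inr 0)) (cliffordMul (F.a (.inr 1)) ψ₁) := by
  have hψ₁ : ψ₁ ≠ 0 := hli.ne_zero 0
  have hψ₂ : ψ₂ ≠ 0 := hli.ne_zero 1
  obtain ⟨q, hq₂, hψ⟩ := exists_eq_cliffordMul_cliffordMul e hli h₁ h₂ h₃
  have hqq : ∀ i j, LinearMap.dualProd ℂ L (q i) (q j) = 0 := fun i j =>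
    h₂.1 _ (hq₂ i) _ (hq₂ j)
  obtain ⟨p, k, hp, hk, hkli, hqp, hqk⟩ := exists_dual_and_ker e h₁ (q := q)
    fun α β h => eq_zero_of_smul_add_smul_mem_ann hqq (hψ ▸ hψ₂) h
  have hkq : ∀ i j, LinearMap.dualProd ℂ L (k i) (q j) = 0 := fun i j => by
    rw [dualProd_comm, hqk]
  have hpq : ∀ i j, LinearMap.dualProd ℂ L (p i) (q j) = if j = i then 1 else 0 := fun i j => by
    rw [dualProd_comm, hqp]
  have hkk : ∀ i j, LinearMap.dualProd ℂ L (k i) (k j) = 0 := fun i j => h₁.1 _ (hk i) _ (hk j)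
  have hkp : ∀ i j, LinearMap.dualProd ℂ L (k i) (p j) = 0 := fun i j => h₁.1 _ (hk i) _ (hp j)
  have hpk : ∀ i j, LinearMap.dualProd ℂ L (p i) (k j) = 0 := fun i j => h₁.1 _ (hp i) _ (hk j)
  have hpp : ∀ i j, LinearMap.dualProd ℂ L (p i) (p j) = 0 := fun i j => h₁.1 _ (hp i) _ (hp j)
  -- `k` spans the part of `Ann ψ₁` orthogonal to `q`; it remains to find vectors dual to it
  have hall : LinearIndependent ℂ (Sum.elim k (Sum.elim p q)) := by
    rw [Fintype.linearIndependent_iff]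
    intro g hg
    simp only [Fintype.sum_sum_type, Sum.elim_inl, Sum.elim_inr] at hg
    have h := fun v => congrArg (LinearMap.dualProd ℂ L v) hg
    simp only [map_add, map_sum, map_smul, map_zero] at h
    have hgp : ∀ i, g (Sum.inr (Sum.inl i)) = 0 := fun i => by
      simpa [-LinearMap.dualProd_apply_apply, hqk, hqq, hqp] using h (q i)
    have hgq : ∀ i, g (Sum.inr (Sum.inr i)) = 0 := fun i => by
      simpa [-LinearMap.dualProd_apply_apply, hpk, hpp, hpq] using h (p i)
    have hgk : ∀ i, g (Sum.inl i) = 0 := by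
      refine Fintype.linearIndependent_iff.mp hkli _ ?_
      simpa only [hgp, hgq, zero_smul, Finset.sum_const_zero, add_zero] using hg
    rintro (i | i | i)
    exacts [hgk i, hgp i, hgq i]
  obtain ⟨k', hk'k, hk'k', hk'x⟩ := exists_isotropic_dual e _ _ hall hkk (by
    rintro i (j | j)
    exacts [hkp i j, hkq i j])
  refine ⟨⟨Sum.elim k' q, Sum.elim k p, ?_, ?_, ?_, ψ₁, hψ₁, ?_⟩, rfl, hψ⟩
  · rintro (i | i) (j | j)
    · exact hk'k' i j
    · exact hk'x i (.inr j)
    · rw [dualProd_comm]; exact hk'x j (.inr i)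
    · exact hqq i j
  · rintro (i | i) (j | j)
    exacts [hkk i j, hkp i j, hpk i j, hpp i j]
  · rintro (i | i) (j | j)
    · rw [Sum.elim_inl, Sum.elim_inl, hk'k]; simp
    · rw [if_neg (by simp)]; exact hk'x i (.inl j)
    · rw [if_neg (by simp)]; exact hqk i j
    · rw [Sum.elim_inr, Sum.elim_inr, hqp]; simp
  · rintro (i | i)
    exacts [mem_ann.mp (hk i), mem_ann.mp (hp i)]

end PureLine

/-! ### Lifts of `GL(5)` to the spin group -/

namespace FockFrame

variable {L : Type*} [AddCommGroup L] [Module ℂ L] {ι : Type*} [DecidableEq ι]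
  (F : FockFrame L ι)

theorem vecForm_a (i : ι) : vecForm L (F.a i) = 0 := by
  have := dualProd_self (F.a i)
  rw [F.aa] at this
  exact (mul_eq_zero.mp this.symm).resolve_left two_ne_zero

theorem vecForm_b (i : ι) : vecForm L (F.b i) = 0 := by
  have := dualProd_self (F.b i)
  rw [F.bb] at this
  exact (mul_eq_zero.mp this.symm).resolve_left two_ne_zero

theorem vecForm_smul_b_add_smul_a (i : ι) (s t : ℂ) :
    vecForm L (s • F.b i + t • F.a i) = s * t := by
  rw [vecForm_add, QuadraticMap.map_smul, QuadraticMap.map_smul, vecForm_a, vecForm_b, map_smul,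
    map_smul, LinearMap.smul_apply, F.ba]
  simp [mul_comm]

/-- A lift of the scaling `b i ↦ c² b i` to the spin group. -/
def scale (i : ι) {c : ℂ} (hc : c ≠ 0) : spinGroup (vecForm L) :=
  ⟨CliffordAlgebra.ι _ (c • F.b i + c⁻¹ • F.a i) *
      CliffordAlgebra.ι _ ((1 : ℂ) • F.b i + (1 : ℂ) • F.a i),
    ι_mul_ι_mem_spinGroup (by
      rw [vecForm_smul_b_add_smul_a, vecForm_smul_b_add_smul_a, mul_inv_cancel₀ hc]; norm_num)⟩

theorem coe_scale (i : ι) {c : ℂ} (hc : c ≠ 0) : (F.scale i hc).1 =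
    c • (CliffordAlgebra.ι (vecForm L) (F.b i) * CliffordAlgebra.ι _ (F.a i)) +
      c⁻¹ • (CliffordAlgebra.ι _ (F.a i) * CliffordAlgebra.ι _ (F.b i)) := by
  simp only [scale, one_smul, map_add, map_smul, mul_add, add_mul, smul_mul_assoc,
    ι_mul_self_eq_zero (F.vecForm_a i), ι_mul_self_eq_zero (F.vecForm_b i), smul_zero, zero_add,
    add_zero]
  abel

theorem scale_vacuum (i : ι) {c : ℂ} (hc : c ≠ 0) :
    spinorRep L (F.scale i hc).1 F.vacuum = c • F.vacuum := by
  rw [coe_scale]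
  simp only [map_add, map_smul, map_mul, spinorRep_ι, LinearMap.add_apply, LinearMap.smul_apply,
    Module.End.mul_apply]
  rw [F.b_vacuum, cliffordMul_anticomm, F.ba, F.b_vacuum]
  simp

theorem a_mul_b_add (i : ι) : CliffordAlgebra.ι (vecForm L) (F.a i) * CliffordAlgebra.ι _ (F.b i) +
    CliffordAlgebra.ι _ (F.b i) * CliffordAlgebra.ι _ (F.a i) = 1 := by
  rw [ι_mul_ι_add, F.ab, if_pos rfl, map_one]

theorem ad_scale_b (i : ι) {c : ℂ} (hc : c ≠ 0) :
    ad (F.scale i hc) (F.b i) = c ^ 2 • F.b i := by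
  apply ad_eq_of_mul_eq
  have h := F.a_mul_b_add i
  have hb := ι_mul_self_eq_zero (F.vecForm_b i)
  rw [coe_scale, map_smul]
  set A := CliffordAlgebra.ι (vecForm L) (F.a i)
  set B := CliffordAlgebra.ι (vecForm L) (F.b i)
  have h1 : A * B * B = 0 := by rw [mul_assoc, hb, mul_zero]
  have h2 : B * (B * A) = 0 := by rw [← mul_assoc, hb, zero_mul]
  simp only [add_mul, mul_add, smul_mul_assoc, mul_smul_comm, h1, h2, smul_zero, add_zero,
    zero_add, smul_smul, mul_assoc]
  rw [show c⁻¹ * c ^ 2 = c by field_simp]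

theorem ad_scale_a (i : ι) {c : ℂ} (hc : c ≠ 0) :
    ad (F.scale i hc) (F.a i) = (c ^ 2)⁻¹ • F.a i := by
  apply ad_eq_of_mul_eq
  have ha := ι_mul_self_eq_zero (F.vecForm_a i)
  rw [coe_scale, map_smul]
  set A := CliffordAlgebra.ι (vecForm L) (F.a i)
  set B := CliffordAlgebra.ι (vecForm L) (F.b i)
  have h1 : B * A * A = 0 := by rw [mul_assoc, ha, mul_zero]
  have h2 : A * (A * B) = 0 := by rw [← mul_assoc, ha, zero_mul]
  simp only [add_mul, mul_add, smul_mul_assoc, mul_smul_comm, h1, h2, smul_zero, add_zero,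
    zero_add, smul_smul, mul_assoc]
  rw [show (c * (c ^ 2)⁻¹) = c⁻¹ by field_simp]

end FockFrame

theorem ad_eq_self_of_orthogonal {L : Type*} [AddCommGroup L] [Module ℂ L]
    {g : spinGroup (vecForm L)} {v w x : Vec L}
    (hg : g.1 = CliffordAlgebra.ι _ v * CliffordAlgebra.ι _ w)
    (hv : LinearMap.dualProd ℂ L x v = 0) (hw : LinearMap.dualProd ℂ L x w = 0) :
    ad g x = x := by
  apply ad_eq_of_mul_eq
  have h1 := ι_mul_ι_swap x v
  have h2 := ι_mul_ι_swap x w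
  rw [hv, map_zero, zero_sub] at h1
  rw [hw, map_zero, zero_sub] at h2
  rw [hg, mul_assoc, h2, mul_neg, ← mul_assoc, h1, neg_mul, neg_neg, mul_assoc]

namespace FockFrame

variable {L : Type*} [AddCommGroup L] [Module ℂ L] {ι : Type*} [DecidableEq ι]
  (F : FockFrame L ι)

theorem ad_scale_b_ne {i j : ι} (h : i ≠ j) {c : ℂ} (hc : c ≠ 0) :
    ad (F.scale i hc) (F.b j) = F.b j :=
  ad_eq_self_of_orthogonal rfl (by simp [-LinearMap.dualProd_apply_apply, F.bb, F.ba, h.symm])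
    (by simp [-LinearMap.dualProd_apply_apply, F.bb, F.ba, h.symm])

theorem ad_scale_a_ne {i j : ι} (h : i ≠ j) {c : ℂ} (hc : c ≠ 0) :
    ad (F.scale i hc) (F.a j) = F.a j :=
  ad_eq_self_of_orthogonal rfl (by simp [-LinearMap.dualProd_apply_apply, F.aa, F.ab, h.symm])
    (by simp [-LinearMap.dualProd_apply_apply, F.aa, F.ab, h.symm])

variable [Fintype ι]

/-- The matrix `G`, with inverse `H`, acting on the span of the `b i` and contragrediently on the
span of the `a i`, lifts to `g` in the spin group, which scales the vacuum by `r`. -/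
structure IsLift (G H : Matrix ι ι ℂ) (r : ℂ) (g : spinGroup (vecForm L)) : Prop where
  vacuum : spinorRep L g.1 F.vacuum = r • F.vacuum
  b : ∀ j, ad g (F.b j) = ∑ i, G i j • F.b i
  a : ∀ j, ad g (F.a j) = ∑ i, H j i • F.a i

variable {F}

theorem IsLift.mul {G H G' H' : Matrix ι ι ℂ} {r r' : ℂ} {g g' : spinGroup (vecForm L)}
    (h : F.IsLift G H r g) (h' : F.IsLift G' H' r' g') :
    F.IsLift (G * G') (H' * H) (r * r') (g * g') where
  vacuum := by
    rw [spinorRep_mul_apply, h'.vacuum, map_smul, h.vacuum, smul_smul, mul_comm]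
  b j := by
    rw [ad_mul_apply, h'.b, map_sum]
    simp only [map_smul, h.b, Matrix.mul_apply, Finset.smul_sum, smul_smul, Finset.sum_smul]
    rw [Finset.sum_comm]
    simp only [mul_comm]
  a j := by
    rw [ad_mul_apply, h'.a, map_sum]
    simp only [map_smul, h.a, Matrix.mul_apply, Finset.smul_sum, smul_smul, Finset.sum_smul]
    rw [Finset.sum_comm]

variable (F)

theorem isLift_scale (i : ι) {c : ℂ} (hc : c ≠ 0) :
    F.IsLift (Matrix.diagonal (Pi.mulSingle i (c ^ 2)))
      (Matrix.diagonal (Pi.mulSingle i (c ^ 2)⁻¹)) c (F.scale i hc) where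
  vacuum := F.scale_vacuum i hc
  b j := by
    rw [Finset.sum_eq_single j (by
      intro l _ hl; rw [Matrix.diagonal_apply_ne _ hl, zero_smul]) (by simp),
      Matrix.diagonal_apply_eq]
    by_cases h : i = j
    · subst h; rw [Pi.mulSingle_eq_same, ad_scale_b]
    · rw [Pi.mulSingle_eq_of_ne (Ne.symm h), ad_scale_b_ne F h, one_smul]
  a j := by
    rw [Finset.sum_eq_single j (by
      intro l _ hl; rw [Matrix.diagonal_apply_ne' _ hl, zero_smul]) (by simp),
      Matrix.diagonal_apply_eq]
    by_cases h : i = j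
    · subst h; rw [Pi.mulSingle_eq_same, ad_scale_a]
    · rw [Pi.mulSingle_eq_of_ne (Ne.symm h), ad_scale_a_ne F h, one_smul]

/-- Some lift of the matrix `G` exists. -/
def HasLift (G : Matrix ι ι ℂ) : Prop :=
  ∃ (H : Matrix ι ι ℂ) (r : ℂ) (g : spinGroup (vecForm L)),
    G * H = 1 ∧ r ^ 2 = G.det ∧ F.IsLift G H r g

theorem HasLift.mul {G G' : Matrix ι ι ℂ} (h : F.HasLift G) (h' : F.HasLift G') :
    F.HasLift (G * G') := by
  obtain ⟨H, r, g, h1, h2, h3⟩ := h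
  obtain ⟨H', r', g', h1', h2', h3'⟩ := h'
  refine ⟨H' * H, r * r', g * g', ?_, ?_, h3.mul h3'⟩
  · rw [mul_assoc, ← mul_assoc G', h1', one_mul, h1]
  · rw [mul_pow, h2, h2', Matrix.det_mul]

theorem hasLift_one : F.HasLift (1 : Matrix ι ι ℂ) := by
  refine ⟨1, 1, 1, by simp, by simp, by simp, fun j => ?_, fun j => ?_⟩
  · simp [Matrix.one_apply]
  · simp [Matrix.one_apply]

theorem hasLift_diagonal {D : ι → ℂ} (hD : ∀ i, D i ≠ 0) : F.HasLift (Matrix.diagonal D) := by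
  have h1 : ∀ i, F.HasLift (Matrix.diagonal (Pi.mulSingle i (D i))) := by
    intro i
    obtain ⟨c, hc⟩ := IsAlgClosed.exists_pow_nat_eq (D i) two_pos
    have hc0 : c ≠ 0 := by rintro rfl; exact hD i (by rw [← hc]; simp)
    have h := F.isLift_scale i hc0
    rw [hc] at h
    refine ⟨_, c, _, ?_, ?_, h⟩
    · rw [Matrix.diagonal_mul_diagonal, ← Matrix.diagonal_one]
      congr 1
      funext j
      rw [← Pi.mul_apply, ← Pi.mulSingle_mul, mul_inv_cancel₀ (hD i), Pi.mulSingle_one]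
      rfl
    · rw [Matrix.det_diagonal, hc, Finset.prod_pi_mulSingle']
      simp
  have h2 : ∀ s : Finset ι, F.HasLift (Matrix.diagonal (∏ i ∈ s, Pi.mulSingle i (D i))) := by
    intro s
    induction s using Finset.induction_on with
    | empty => simpa using F.hasLift_one
    | insert i s hi ih =>
      rw [Finset.prod_insert hi]
      have := (h1 i).mul F ih
      rwa [Matrix.diagonal_mul_diagonal] at this
  have := h2 Finset.univ
  rwa [Finset.univ_prod_mulSingle] at this

theorem hasLift_transvection {i j : ι} (hij : i ≠ j) (c : ℂ) :
    F.HasLift (Matrix.transvection i j c) := by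
  have hu : LinearMap.dualProd ℂ L (F.b i) (c • F.a j) = 0 := by
    rw [map_smul, F.ba, if_neg hij, smul_zero]
  have hmem := one_add_ι_mul_ι_mem_spinGroup (F.vecForm_b i) hu
    (z := (1 : ℂ) • F.b j + (1 : ℂ) • F.a j)
    (by simp [-LinearMap.dualProd_apply_apply, F.bb, F.ba, hij])
    (by rw [vecForm_smul_b_add_smul_a]; norm_num)
  let g : spinGroup (vecForm L) := ⟨_, hmem⟩
  have had := ad_one_add (F.vecForm_b i) hu (g := g) rfl
  refine ⟨Matrix.transvection i j (-c), 1, g, ?_, ?_, ?_, fun l => ?_, fun l => ?_⟩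
  · rw [Matrix.transvection_mul_transvection_same _ _ hij]; simp
  · rw [Matrix.det_transvection_of_ne _ _ hij, one_pow]
  · simp only [g, map_add, map_one, map_mul, spinorRep_ι, LinearMap.add_apply, Module.End.one_apply,
      Module.End.mul_apply]
    rw [cliffordMul_anticomm, hu, F.b_vacuum]
    simp
  · rw [had, F.bb, map_smul, LinearMap.smul_apply, F.ab]
    simp only [Matrix.transvection, Matrix.add_apply, Matrix.one_apply, Matrix.single_apply,
      add_smul, ite_smul, one_smul, zero_smul, Finset.sum_add_distrib, Finset.sum_ite_eq',
      Finset.mem_univ, if_true, ite_and, Finset.sum_ite_eq]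
    by_cases h : j = l <;> simp [h]
  · rw [had, F.ba, map_smul, LinearMap.smul_apply, F.aa, QuadraticMap.map_smul, F.vecForm_a]
    simp only [Matrix.transvection, Matrix.add_apply, Matrix.one_apply, Matrix.single_apply,
      add_smul, ite_smul, one_smul, zero_smul, Finset.sum_add_distrib, Finset.sum_ite_eq,
      Finset.mem_univ, if_true, ite_and]
    by_cases h : i = l <;> simp [h, sub_eq_add_neg]

/-- Every invertible matrix `G` lifts to the spin group, and its lifts are indexed by the square
roots of `det G`, by which they scale the vacuum. -/
theorem exists_isLift [Nonempty ι] (G : Matrix ι ι ℂ) {r : ℂ} (hr0 : r ≠ 0) (hr : r ^ 2 = G.det) :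
    ∃ g, F.IsLift G G⁻¹ r g := by
  have hdet : G.det ≠ 0 := by rw [← hr]; exact pow_ne_zero 2 hr0
  have h : F.HasLift G := Matrix.diagonal_transvection_induction_of_det_ne_zero _ G hdet
    (fun D hD => F.hasLift_diagonal fun i => by
      rw [Matrix.det_diagonal, Finset.prod_ne_zero_iff] at hD
      exact hD i (Finset.mem_univ i))
    (fun t => F.hasLift_transvection t.hij t.c) (fun A B _ _ hA hB => hA.mul F hB)
  obtain ⟨H, s, g, h1, h2, h3⟩ := h
  rw [← Matrix.inv_eq_right_inv h1] at h3
  rw [← hr] at h2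
  -- only the two square roots of the determinant can occur as the scale of the vacuum
  rcases sq_eq_sq_iff_eq_or_eq_neg.mp h2 with rfl | rfl
  · exact ⟨g, h3⟩
  · -- `-1` belongs to the spin group
    have h4 := (F.isLift_scale (Classical.arbitrary ι) (c := -1) (by norm_num)).mul h3
    simp only [neg_one_sq, inv_one, Pi.mulSingle_one] at h4
    rw [show Matrix.diagonal (1 : ι → ℂ) = 1 from Matrix.diagonal_one, one_mul,
      mul_one, neg_mul_neg, one_mul] at h4
    exact ⟨_, h4⟩

end FockFrame

namespace FockFrame

/-! ### The flag of a line of pure spinors -/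

section Flag

variable {L : Type*} [AddCommGroup L] [Module ℂ L] (F : FockFrame L (Fin 3 ⊕ Fin 2))

/-- A basis of the common annihilator of the spinors of the line. -/
abbrev k (i : Fin 3) : Vec L := F.b (.inl i)

/-- The isotropic vectors dual to `k`. -/
abbrev k' (i : Fin 3) : Vec L := F.a (.inl i)

/-- The vectors that, together with `k`, span the annihilator of the vacuum. -/
abbrev p (j : Fin 2) : Vec L := F.b (.inr j)

/-- The vectors that, together with `k`, span the annihilator of the second spinor. -/
abbrev q (j : Fin 2) : Vec L := F.a (.inr j)

/-- The second spinor of the line. -/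
def second : Spinor L := cliffordMul (F.q 0) (cliffordMul (F.q 1) F.vacuum)

theorem k_second (i : Fin 3) : cliffordMul (F.k i) F.second = 0 := by
  rw [second, cliffordMul_anticomm, cliffordMul_anticomm (F.k i) (F.q 1), F.b_vacuum]
  simp [-LinearMap.dualProd_apply_apply, F.ba]

theorem a_a_self (i : Fin 3 ⊕ Fin 2) (x : Spinor L) :
    cliffordMul (F.a i) (cliffordMul (F.a i) x) = 0 := by
  rw [cliffordMul_cliffordMul, F.vecForm_a, zero_smul]

theorem q_second (j : Fin 2) : cliffordMul (F.q j) F.second = 0 := by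
  rw [second]
  fin_cases j
  · exact F.a_a_self _ _
  · change cliffordMul (F.q 1) _ = 0
    rw [cliffordMul_anticomm, F.aa, F.a_a_self, map_zero, zero_smul, sub_zero]

theorem p_p_second : cliffordMul (F.p 1) (cliffordMul (F.p 0) F.second) = F.vacuum := by
  rw [second, cliffordMul_anticomm (F.p 0), cliffordMul_anticomm (F.p 0) (F.q 1), F.b_vacuum]
  simp only [F.ba]
  simp [-LinearMap.dualProd_apply_apply]
  rw [cliffordMul_anticomm, F.b_vacuum, F.ba]
  simp

theorem second_ne_zero : F.second ≠ 0 := fun h => F.vacuum_ne_zero (by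
  rw [← F.p_p_second, h, map_zero, map_zero])

/-- The common annihilator of the spinors of the line. -/
def K : Submodule ℂ (Vec L) := Submodule.span ℂ (Set.range F.k)

theorem k_mem (i : Fin 3) : F.k i ∈ F.K := Submodule.subset_span ⟨i, rfl⟩

theorem k_isotropic {x y : Vec L} (hx : x ∈ F.K) (hy : y ∈ F.K) :
    LinearMap.dualProd ℂ L x y = 0 := by
  induction hx using Submodule.span_induction with
  | zero => simp
  | add x x' _ _ h h' => rw [map_add, LinearMap.add_apply, h, h', add_zero]
  | smul c x _ h => rw [map_smul, LinearMap.smul_apply, h, smul_zero]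
  | mem x hx =>
    obtain ⟨i, rfl⟩ := hx
    induction hy using Submodule.span_induction with
    | zero => simp
    | add y y' _ _ h h' => rw [map_add, h, h', add_zero]
    | smul c y _ h => rw [map_smul, h, smul_zero]
    | mem y hy => obtain ⟨j, rfl⟩ := hy; exact F.bb _ _

theorem mem_orth_K {x : Vec L} :
    x ∈ orth F.K ↔ ∀ i, LinearMap.dualProd ℂ L (F.k i) x = 0 := by
  refine ⟨fun h i => h _ (F.k_mem i), fun h y hy => ?_⟩
  induction hy using Submodule.span_induction with
  | zero => simp
  | add y y' _ _ h h' => rw [map_add, LinearMap.add_apply, h, h', add_zero]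
  | smul c y _ h => rw [map_smul, LinearMap.smul_apply, h, smul_zero]
  | mem y hy => obtain ⟨j, rfl⟩ := hy; exact h j

theorem K_le_orth : F.K ≤ orth F.K := fun _ hx _ hy => F.k_isotropic hy hx

theorem p_mem_orth (j : Fin 2) : F.p j ∈ orth F.K := F.mem_orth_K.mpr fun _ => F.bb _ _

theorem q_mem_orth (j : Fin 2) : F.q j ∈ orth F.K :=
  F.mem_orth_K.mpr fun _ => by rw [F.ba, if_neg (by simp)]

variable (e : Module.Basis (Fin 5) ℂ L)

include e in
/-- The expansion of a vector in the frame adapted to the flag. -/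
theorem expand' (v : Vec L) :
    v = ∑ i, LinearMap.dualProd ℂ L (F.k i) v • F.k' i +
      ∑ j, LinearMap.dualProd ℂ L (F.p j) v • F.q j +
      ∑ j, LinearMap.dualProd ℂ L (F.q j) v • F.p j +
      ∑ i, LinearMap.dualProd ℂ L (F.k' i) v • F.k i := by
  conv_lhs => rw [F.expand e (by simp) v]
  rw [Fintype.sum_sum_type, Fintype.sum_sum_type]
  abel

include e in
theorem mem_K {x : Vec L} (hk : ∀ i, LinearMap.dualProd ℂ L (F.k i) x = 0)
    (hp : ∀ j, LinearMap.dualProd ℂ L (F.p j) x = 0)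
    (hq : ∀ j, LinearMap.dualProd ℂ L (F.q j) x = 0) : x ∈ F.K := by
  rw [F.expand' e x]
  simp only [hk, hp, hq, zero_smul, Finset.sum_const_zero, zero_add]
  exact Submodule.sum_mem _ fun i _ => Submodule.smul_mem _ _ (F.k_mem i)

include e in
theorem eq_zero_of_mem_K {x : Vec L} (hx : x ∈ F.K)
    (hk' : ∀ i, LinearMap.dualProd ℂ L (F.k' i) x = 0) : x = 0 := by
  rw [F.expand' e x]
  have h1 : ∀ i, LinearMap.dualProd ℂ L (F.k i) x = 0 := F.mem_orth_K.mp (F.K_le_orth hx)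
  have h2 : ∀ j, LinearMap.dualProd ℂ L (F.p j) x = 0 := fun j => by
    rw [dualProd_comm]; exact F.p_mem_orth j x hx
  have h3 : ∀ j, LinearMap.dualProd ℂ L (F.q j) x = 0 := fun j => by
    rw [dualProd_comm]; exact F.q_mem_orth j x hx
  simp only [h1, h2, h3, hk', zero_smul, Finset.sum_const_zero, zero_add]

include e in
/-- Two linear maps agree if they agree on the frame. -/
theorem linearMap_ext {M : Type*} [AddCommGroup M] [Module ℂ M] {f g : Vec L →ₗ[ℂ] M}
    (hk : ∀ i, f (F.k i) = g (F.k i)) (hp : ∀ j, f (F.p j) = g (F.p j))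
    (hq : ∀ j, f (F.q j) = g (F.q j)) (hk' : ∀ i, f (F.k' i) = g (F.k' i)) (v : Vec L) :
    f v = g v := by
  rw [F.expand' e v]
  simp only [map_add, map_sum, map_smul, hk, hp, hq, hk']

include e in
theorem K_eq : F.K = ann F.vacuum ⊓ ann F.second := by
  apply le_antisymm
  · rw [K, Submodule.span_le]
    rintro _ ⟨i, rfl⟩
    exact ⟨mem_ann.mpr (F.b_vacuum _), mem_ann.mpr (F.k_second i)⟩
  · rintro x ⟨h1, h2⟩
    rw [SetLike.mem_coe, mem_ann] at h1 h2
    have hb : ∀ i, LinearMap.dualProd ℂ L (F.b i) x = 0 := fun i => by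
      have := cliffordMul_anticomm (F.b i) x F.vacuum
      rw [h1, F.b_vacuum, map_zero, map_zero, sub_zero] at this
      exact (smul_eq_zero.mp this.symm).resolve_right F.vacuum_ne_zero
    refine F.mem_K e (fun i => hb _) (fun j => hb _) fun j => ?_
    have := cliffordMul_anticomm (F.q j) x F.second
    rw [h2, F.q_second, map_zero, map_zero, sub_zero] at this
    exact (smul_eq_zero.mp this.symm).resolve_right F.second_ne_zero

include e in
theorem finrank_K : Module.finrank ℂ F.K = 3 := by
  have : Module.Finite ℂ L := Module.Finite.of_basis e
  have hli : LinearIndependent ℂ F.k :=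
    (F.linearIndependent.comp (fun i => Sum.inr (Sum.inl i)) (fun i j h => by simpa using h))
  rw [K, finrank_span_eq_card hli, Fintype.card_fin]

end Flag

/-! ### The unipotent radical -/

section Unipotent

variable {L : Type*} [AddCommGroup L] [Module ℂ L] (F : FockFrame L (Fin 3 ⊕ Fin 2))

/-- The elements of the spin group that preserve the flag `0 ⊂ K ⊂ K^⟂ ⊂ V` and act trivially on
its graded pieces. -/
def unip : Subgroup (spinGroup (vecForm L)) where
  carrier := {g | (∀ x ∈ F.K, ad g x = x) ∧ ∀ x ∈ orth F.K, ad g x - x ∈ F.K}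
  mul_mem' {g h} hg hh := by
    refine ⟨fun x hx => by rw [ad_mul_apply, hh.1 x hx, hg.1 x hx], fun x hx => ?_⟩
    have h1 := hh.2 x hx
    have h2 : ad (g * h) x - x = (ad h x - x) + (ad g x - x) := by
      have h3 := hg.1 _ h1
      rw [map_sub] at h3
      rw [ad_mul_apply, ← h3]; abel
    rw [h2]
    exact Submodule.add_mem _ h1 (hg.2 x hx)
  one_mem' := ⟨fun x _ => by rw [map_one]; rfl, fun x _ => by
    rw [map_one, Module.End.one_apply, sub_self]; exact Submodule.zero_mem _⟩
  inv_mem' {g} hg := by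
    have h1 : ∀ x ∈ F.K, ad g⁻¹ x = x := fun x hx => by
      conv_lhs => rw [← hg.1 x hx]
      exact ad_inv_ad g x
    refine ⟨h1, fun x hx => ?_⟩
    have h2 := h1 _ (hg.2 x hx)
    rw [map_sub, ad_inv_ad] at h2
    have h3 : ad g⁻¹ x - x = -(ad g x - x) := by rw [← h2]; abel
    rw [h3]
    exact Submodule.neg_mem _ (hg.2 x hx)

variable {F} in
theorem ad_k {g : spinGroup (vecForm L)} (hg : g ∈ F.unip) (i : Fin 3) :
    ad g (F.k i) = F.k i := hg.1 _ (F.k_mem i)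

variable {F} in
/-- A unipotent element moves vectors by elements of `K^⟂`. -/
theorem ad_sub_mem_orth {g : spinGroup (vecForm L)} (hg : g ∈ F.unip) (v : Vec L) :
    ad g v - v ∈ orth F.K := by
  rw [mem_orth_K]
  intro i
  rw [map_sub, sub_eq_zero]
  conv_lhs => rw [← ad_k hg i]
  exact dualProd_ad g _ _

variable {F} in
/-- The action on `K^⟂` is determined by the action on the `k'`. -/
theorem dualProd_k'_ad_sub {g : spinGroup (vecForm L)} (hg : g ∈ F.unip) {y : Vec L}
    (hy : y ∈ orth F.K) (i : Fin 3) : LinearMap.dualProd ℂ L (F.k' i) (ad g y - y) =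
      LinearMap.dualProd ℂ L (F.k' i) y - LinearMap.dualProd ℂ L y (ad g (F.k' i)) := by
  rw [← dualProd_ad g (F.k' i), hg.1 _ (hg.2 y hy), map_sub, dualProd_ad,
    dualProd_comm y]

/-- Coordinates on the unipotent radical. -/
abbrev UnipIndex : Type := (Fin 3 × (Fin 2 ⊕ Fin 2)) ⊕ Fin 3

/-- The vectors of the two Lagrangians of `K^⟂ / K`. -/
def u : Fin 2 ⊕ Fin 2 → Vec L := Sum.elim F.p F.q

/-- The dual vectors of the two Lagrangians of `K^⟂ / K`. -/
def u' : Fin 2 ⊕ Fin 2 → Vec L := Sum.elim F.q F.p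

theorem u_mem_orth (s : Fin 2 ⊕ Fin 2) : F.u s ∈ orth F.K := by
  rcases s with j | j
  exacts [F.p_mem_orth j, F.q_mem_orth j]

/-- The coordinates of a unipotent element: the components in `K^⟂ / K` of the vectors `g k'ᵢ`, and
the antisymmetric part of their components in `K`. -/
def unipCoord (g : spinGroup (vecForm L)) : UnipIndex → ℂ :=
  Sum.elim (fun x => -LinearMap.dualProd ℂ L (F.u x.2) (ad g (F.k' x.1)))
    ![-LinearMap.dualProd ℂ L (F.k' 1) (ad g (F.k' 0)),
      -LinearMap.dualProd ℂ L (F.k' 2) (ad g (F.k' 0)),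
      -LinearMap.dualProd ℂ L (F.k' 2) (ad g (F.k' 1))]

variable {F} in
/-- Unipotent elements with the same coordinates act on `V` in the same way. -/
theorem ad_eq_of_unipCoord_eq (e : Module.Basis (Fin 5) ℂ L) {g h : spinGroup (vecForm L)}
    (hg : g ∈ F.unip) (hh : h ∈ F.unip) (hgh : F.unipCoord g = F.unipCoord h) (v : Vec L) :
    ad g v = ad h v := by
  have hu : ∀ s i, LinearMap.dualProd ℂ L (F.u s) (ad g (F.k' i)) =
      LinearMap.dualProd ℂ L (F.u s) (ad h (F.k' i)) := fun s i =>
    neg_injective (congrFun hgh (.inl (i, s)))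
  have hy : ∀ s, ad g (F.u s) = ad h (F.u s) := by
    intro s
    have hs := F.u_mem_orth s
    rw [← sub_left_inj (a := F.u s), ← sub_eq_zero]
    refine F.eq_zero_of_mem_K e (Submodule.sub_mem _ (hg.2 _ hs) (hh.2 _ hs)) fun i => ?_
    rw [map_sub, dualProd_k'_ad_sub hg hs, dualProd_k'_ad_sub hh hs, hu, sub_self]
  have hw : ∀ i, ad g (F.k' i) - ad h (F.k' i) ∈ F.K := by
    intro i
    refine F.mem_K e (fun j => ?_) (fun j => ?_) fun j => ?_
    · rw [← sub_sub_sub_cancel_right _ _ (F.k' i), map_sub,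
        F.mem_orth_K.mp (ad_sub_mem_orth hg _), F.mem_orth_K.mp (ad_sub_mem_orth hh _), sub_zero]
    · rw [map_sub, sub_eq_zero]; exact hu (.inl j) i
    · rw [map_sub, sub_eq_zero]; exact hu (.inr j) i
  -- the matrix of the differences is antisymmetric
  have hanti : ∀ i j, LinearMap.dualProd ℂ L (F.k' i) (ad g (F.k' j) - ad h (F.k' j)) =
      - LinearMap.dualProd ℂ L (F.k' j) (ad g (F.k' i) - ad h (F.k' i)) := by
    intro i j
    have e1 : ∀ i j, LinearMap.dualProd ℂ L (ad h (F.k' i)) (ad g (F.k' j) - ad h (F.k' j)) =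
        LinearMap.dualProd ℂ L (F.k' i) (ad g (F.k' j) - ad h (F.k' j)) := fun i j => by
      conv_lhs => rw [← hh.1 _ (hw j), dualProd_ad]
    have e2 := F.k_isotropic (hw i) (hw j)
    have e3 := (dualProd_ad g (F.k' i) (F.k' j)).trans (F.aa _ _)
    have e4 := (dualProd_ad h (F.k' i) (F.k' j)).trans (F.aa _ _)
    rw [← e1, ← e1, map_sub, map_sub, dualProd_comm (ad h (F.k' j)) (ad g (F.k' i)), e4,
      dualProd_comm (ad h (F.k' j)), e4]
    simp only [map_sub, LinearMap.sub_apply, e3, e4] at e2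
    linear_combination -e2
  have hdiff : ∀ i j, LinearMap.dualProd ℂ L (F.k' i) (ad g (F.k' j) - ad h (F.k' j)) = 0 := by
    have e10 := congrFun hgh (.inr 0)
    have e20 := congrFun hgh (.inr 1)
    have e21 := congrFun hgh (.inr 2)
    simp only [unipCoord, Sum.elim_inr, Matrix.cons_val] at e10 e20 e21
    rw [neg_inj, ← sub_eq_zero, ← map_sub] at e10 e20 e21
    have ediag : ∀ i, LinearMap.dualProd ℂ L (F.k' i) (ad g (F.k' i) - ad h (F.k' i)) = 0 :=
      fun i => self_eq_neg.mp (hanti i i)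
    intro i j
    fin_cases i <;> fin_cases j
    · exact ediag 0
    · exact (hanti 0 1).trans (by rw [e10, neg_zero])
    · exact (hanti 0 2).trans (by rw [e20, neg_zero])
    · exact e10
    · exact ediag 1
    · exact (hanti 1 2).trans (by rw [e21, neg_zero])
    · exact e20
    · exact e21
    · exact ediag 2
  refine F.linearMap_ext e (fun i => ?_) (fun j => hy (.inl j)) (fun j => hy (.inr j))
    (fun i => ?_) v
  · rw [ad_k hg, ad_k hh]
  · rw [← sub_eq_zero]
    exact F.eq_zero_of_mem_K e (hw i) fun j => hdiff j i

/-- The element `1 + kᵢ x` of the spin group, for `x` in `K^⟂`. -/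
def eichler (i : Fin 3) {x : Vec L} (hx : x ∈ orth F.K) : spinGroup (vecForm L) :=
  ⟨1 + CliffordAlgebra.ι _ (F.k i) * CliffordAlgebra.ι _ x,
    one_add_ι_mul_ι_mem_spinGroup (F.vecForm_b _) (hx _ (F.k_mem i))
      (z := (1 : ℂ) • F.p 0 + (1 : ℂ) • F.q 0)
      (by simp [-LinearMap.dualProd_apply_apply, F.bb, F.ba])
      (by rw [vecForm_smul_b_add_smul_a]; norm_num)⟩

theorem ad_eichler (i : Fin 3) {x : Vec L} (hx : x ∈ orth F.K) (v : Vec L) :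
    ad (F.eichler i hx) v = v + LinearMap.dualProd ℂ L x v • F.k i -
      LinearMap.dualProd ℂ L (F.k i) v • x -
      (LinearMap.dualProd ℂ L (F.k i) v * vecForm L x) • F.k i :=
  ad_one_add (F.vecForm_b _) (hx _ (F.k_mem i)) rfl v

theorem eichler_mem_unip (i : Fin 3) {x : Vec L} (hx : x ∈ orth F.K) :
    F.eichler i hx ∈ F.unip := by
  refine ⟨fun v hv => ?_, fun v hv => ?_⟩
  · rw [ad_eichler, F.k_isotropic (F.k_mem i) hv, dualProd_comm, hx v hv]
    simp
  · rw [ad_eichler, hv _ (F.k_mem i), zero_smul, sub_zero, zero_mul, zero_smul, sub_zero,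
      add_sub_cancel_left]
    exact Submodule.smul_mem _ _ (F.k_mem i)

/-- The elements `1 + kᵢ x` fix the spinors annihilated by `kᵢ`. -/
theorem eichler_fix (i : Fin 3) {x : Vec L} (hx : x ∈ orth F.K) {ψ : Spinor L}
    (hψ : cliffordMul (F.k i) ψ = 0) : spinorRep L (F.eichler i hx).1 ψ = ψ := by
  simp only [eichler, map_add, map_one, map_mul, spinorRep_ι, LinearMap.add_apply,
    Module.End.one_apply, Module.End.mul_apply]
  rw [cliffordMul_anticomm, hx _ (F.k_mem i), hψ]
  simp

/-- The vector in the span of the `p`, `q` with given inner products with them. -/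
def uVec (x : UnipIndex → ℂ) (i : Fin 3) : Vec L := ∑ s, x (.inl (i, s)) • F.u' s

theorem uVec_mem (x : UnipIndex → ℂ) (i : Fin 3) : F.uVec x i ∈ orth F.K := by
  refine Submodule.sum_mem _ fun s _ => Submodule.smul_mem _ _ ?_
  rcases s with j | j
  exacts [F.q_mem_orth j, F.p_mem_orth j]

theorem dualProd_u_uVec (x : UnipIndex → ℂ) (i : Fin 3) (s : Fin 2 ⊕ Fin 2) :
    LinearMap.dualProd ℂ L (F.u s) (F.uVec x i) = x (.inl (i, s)) := by
  have h : ∀ s t, LinearMap.dualProd ℂ L (F.u s) (F.u' t) = if s = t then 1 else 0 := by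
    rintro (s | s) (t | t)
    · exact (F.ba _ _).trans (by simp)
    · exact (F.bb _ _).trans (by simp)
    · exact (F.aa _ _).trans (by simp)
    · exact (F.ab _ _).trans (by simp)
  rw [uVec, map_sum]
  simp only [map_smul, h]
  simp

theorem dualProd_uVec_k' (x : UnipIndex → ℂ) (i j : Fin 3) :
    LinearMap.dualProd ℂ L (F.uVec x i) (F.k' j) = 0 := by
  rw [dualProd_comm, uVec, map_sum]
  refine Finset.sum_eq_zero fun s _ => ?_
  rcases s with s | s
  · rw [map_smul]
    exact (congrArg _ (F.aa _ _)).trans (smul_zero _)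
  · rw [map_smul]
    exact (congrArg _ (F.ab _ _)).trans (by simp)

/-- The three vectors by which the unipotent element with coordinates `x` is built. -/
def unipVec (x : UnipIndex → ℂ) (i : Fin 3) : Vec L :=
  F.uVec x i + ![x (.inr 0) • F.k 1 + x (.inr 1) • F.k 2, x (.inr 2) • F.k 2, 0] i

theorem unipVec_mem (x : UnipIndex → ℂ) (i : Fin 3) : F.unipVec x i ∈ orth F.K := by
  refine Submodule.add_mem _ (F.uVec_mem x i) (F.K_le_orth ?_)
  fin_cases i
  · exact Submodule.add_mem _ (Submodule.smul_mem _ _ (F.k_mem _))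
      (Submodule.smul_mem _ _ (F.k_mem _))
  · exact Submodule.smul_mem _ _ (F.k_mem _)
  · exact Submodule.zero_mem _

/-- The unipotent element with coordinates `x`. -/
def unipElt (x : UnipIndex → ℂ) : spinGroup (vecForm L) :=
  F.eichler 0 (F.unipVec_mem x 0) * F.eichler 1 (F.unipVec_mem x 1) *
    F.eichler 2 (F.unipVec_mem x 2)

theorem unipElt_mem (x : UnipIndex → ℂ) : F.unipElt x ∈ F.unip :=
  mul_mem (mul_mem (F.eichler_mem_unip _ _) (F.eichler_mem_unip _ _)) (F.eichler_mem_unip _ _)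

theorem unipElt_fix (x : UnipIndex → ℂ) {ψ : Spinor L}
    (hψ : ∀ i, cliffordMul (F.k i) ψ = 0) : spinorRep L (F.unipElt x).1 ψ = ψ := by
  rw [unipElt, spinorRep_mul_apply, spinorRep_mul_apply, eichler_fix _ _ _ (hψ _),
    eichler_fix _ _ _ (hψ _), eichler_fix _ _ _ (hψ _)]

theorem dualProd_unipVec_k' (x : UnipIndex → ℂ) (i j : Fin 3) :
    LinearMap.dualProd ℂ L (F.unipVec x i) (F.k' j) =
      !![0, x (.inr 0), x (.inr 1); 0, 0, x (.inr 2); 0, 0, 0] i j := by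
  rw [unipVec, map_add, LinearMap.add_apply, dualProd_uVec_k', zero_add]
  fin_cases i <;> fin_cases j <;> simp [-LinearMap.dualProd_apply_apply, F.ba]

theorem dualProd_k_k' (i j : Fin 3) :
    LinearMap.dualProd ℂ L (F.k i) (F.k' j) = if i = j then 1 else 0 := by
  rw [F.ba]; simp

theorem ad_unipElt_k' (x : UnipIndex → ℂ) (i : Fin 3) :
    ∃ y : Fin 3 → ℂ, ad (F.unipElt x) (F.k' i) = F.k' i - F.unipVec x i + ∑ j, y j • F.k j ∧
      ∀ j, i ≤ j → i ≠ j → y j = 0 := by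
  have h0 : ∀ i j, LinearMap.dualProd ℂ L (F.k i) (F.unipVec x j) = 0 := fun i j =>
    F.unipVec_mem x j _ (F.k_mem i)
  have h1 : ∀ i j, LinearMap.dualProd ℂ L (F.unipVec x i) (F.k j) = 0 := fun i j => by
    rw [dualProd_comm, h0]
  rw [unipElt, ad_mul_apply, ad_mul_apply]
  simp only [ad_eichler]
  fin_cases i
  · refine ⟨![-vecForm L (F.unipVec x 0), 0, 0], ?_, ?_⟩
    · simp [-LinearMap.dualProd_apply_apply, -QuadraticForm.dualProd_apply, dualProd_k_k',
        dualProd_unipVec_k', Fin.sum_univ_three]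
      module
    · intro j; fin_cases j <;> simp
  · refine ⟨![x (.inr 0) - LinearMap.dualProd ℂ L (F.unipVec x 0) (F.unipVec x 1),
      -vecForm L (F.unipVec x 1), 0], ?_, ?_⟩
    · simp [-LinearMap.dualProd_apply_apply, -QuadraticForm.dualProd_apply, h0, h1,
        dualProd_k_k', dualProd_unipVec_k', F.bb, Fin.sum_univ_three]
      module
    · intro j; fin_cases j <;> simp
  · refine ⟨![x (.inr 1) - LinearMap.dualProd ℂ L (F.unipVec x 0) (F.unipVec x 2),
      x (.inr 2) - LinearMap.dualProd ℂ L (F.unipVec x 1) (F.unipVec x 2),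
      -vecForm L (F.unipVec x 2)], ?_, ?_⟩
    · simp [-LinearMap.dualProd_apply_apply, -QuadraticForm.dualProd_apply, h0, h1,
        dualProd_k_k', dualProd_unipVec_k', F.bb, Fin.sum_univ_three]
      module
    · intro j; fin_cases j <;> simp

theorem unipCoord_unipElt (x : UnipIndex → ℂ) : F.unipCoord (F.unipElt x) = x := by
  have hk'k : ∀ i j, LinearMap.dualProd ℂ L (F.k' i) (F.k j) = if i = j then 1 else 0 :=
    fun i j => by rw [F.ab]; simp
  have huv : ∀ i j, LinearMap.dualProd ℂ L (F.k' j) (F.unipVec x i) =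
      !![0, x (.inr 0), x (.inr 1); 0, 0, x (.inr 2); 0, 0, 0] i j := fun i j => by
    rw [dualProd_comm, dualProd_unipVec_k']
  have key : ∀ i j, i ≤ j → i ≠ j → LinearMap.dualProd ℂ L (F.k' j) (ad (F.unipElt x) (F.k' i)) =
      - !![0, x (.inr 0), x (.inr 1); 0, 0, x (.inr 2); 0, 0, 0] i j := by
    intro i j hij hne
    obtain ⟨y, hy, hy0⟩ := F.ad_unipElt_k' x i
    rw [hy, map_add, map_sub, huv, F.aa, map_sum]
    simp only [map_smul, hk'k]
    simp [hy0 j hij hne]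
  funext s
  rcases s with ⟨i, s⟩ | c
  · obtain ⟨y, hy, -⟩ := F.ad_unipElt_k' x i
    have h1 : ∀ j, LinearMap.dualProd ℂ L (F.u s) (F.k j) = 0 := fun j => by
      rw [dualProd_comm]; exact F.u_mem_orth s _ (F.k_mem j)
    have h2 : LinearMap.dualProd ℂ L (F.u s) (F.k' i) = 0 := by
      rcases s with s | s
      · exact (F.ba _ _).trans (by simp)
      · exact F.aa _ _
    have h3 : LinearMap.dualProd ℂ L (F.u s) (F.unipVec x i) = x (.inl (i, s)) := by
      rw [unipVec, map_add, dualProd_u_uVec]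
      fin_cases i <;> simp [-LinearMap.dualProd_apply_apply, h1]
    change -LinearMap.dualProd ℂ L (F.u s) (ad (F.unipElt x) (F.k' i)) = _
    rw [hy, map_add, map_sub, h2, h3, map_sum]
    simp only [map_smul, h1]
    simp
  · fin_cases c
    · change - LinearMap.dualProd ℂ L (F.k' 1) (ad (F.unipElt x) (F.k' 0)) = _
      rw [key 0 1 (by decide) (by decide), neg_neg]; rfl
    · change - LinearMap.dualProd ℂ L (F.k' 2) (ad (F.unipElt x) (F.k' 0)) = _
      rw [key 0 2 (by decide) (by decide), neg_neg]; rfl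
    · change - LinearMap.dualProd ℂ L (F.k' 2) (ad (F.unipElt x) (F.k' 1)) = _
      rw [key 1 2 (by decide) (by decide), neg_neg]; rfl

/-- A unipotent element acts on `V` as the unipotent element with the same coordinates. -/
theorem ad_unipElt_unipCoord (e : Module.Basis (Fin 5) ℂ L) {g : spinGroup (vecForm L)}
    (hg : g ∈ F.unip) (v : Vec L) : ad (F.unipElt (F.unipCoord g)) v = ad g v :=
  ad_eq_of_unipCoord_eq e (F.unipElt_mem _) hg (F.unipCoord_unipElt _) v

variable {F} in
/-- The components in `K^⟂ / K` are additive. -/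
theorem dualProd_u_ad_mul {g h : spinGroup (vecForm L)} (hg : g ∈ F.unip) (hh : h ∈ F.unip)
    (i : Fin 3) (s : Fin 2 ⊕ Fin 2) : LinearMap.dualProd ℂ L (F.u s) (ad (g * h) (F.k' i)) =
      LinearMap.dualProd ℂ L (F.u s) (ad g (F.k' i)) +
        LinearMap.dualProd ℂ L (F.u s) (ad h (F.k' i)) := by
  have h1 := F.u_mem_orth s _ (hg.2 _ (ad_sub_mem_orth hh (F.k' i)))
  have h2 : LinearMap.dualProd ℂ L (F.u s) (F.k' i) = 0 := by
    rcases s with s | s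
    · exact (F.ba _ _).trans (by simp)
    · exact F.aa _ _
  rw [dualProd_comm] at h1
  simp only [map_sub] at h1
  rw [ad_mul_apply]
  linear_combination h1 - h2

variable {F} in
/-- A unipotent element that moves the `k'` by elements of `K` commutes with all unipotent
elements. -/
theorem ad_comm_of_dualProd_u_eq_zero (e : Module.Basis (Fin 5) ℂ L) {g z : spinGroup (vecForm L)}
    (hg : g ∈ F.unip) (hz : z ∈ F.unip)
    (h : ∀ i s, LinearMap.dualProd ℂ L (F.u s) (ad z (F.k' i)) = 0) (v : Vec L) :
    ad (z * g) v = ad (g * z) v := by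
  have hk'u : ∀ i s, LinearMap.dualProd ℂ L (F.k' i) (F.u s) = 0 := fun i s => by
    rcases s with s | s
    · exact (F.ab _ _).trans (by simp)
    · exact F.aa _ _
  have hzk' : ∀ i, ad z (F.k' i) - F.k' i ∈ F.K := by
    intro i
    have h1 : ∀ s, LinearMap.dualProd ℂ L (F.u s) (ad z (F.k' i) - F.k' i) = 0 := fun s => by
      rw [map_sub, h, dualProd_comm, hk'u, sub_zero]
    exact F.mem_K e (F.mem_orth_K.mp (ad_sub_mem_orth hz _)) (fun j => h1 (.inl j))
      fun j => h1 (.inr j)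
  have hzu : ∀ s, ad z (F.u s) = F.u s := by
    intro s
    rw [← sub_eq_zero]
    refine F.eq_zero_of_mem_K e (hz.2 _ (F.u_mem_orth s)) fun i => ?_
    rw [dualProd_k'_ad_sub hz (F.u_mem_orth s), hk'u, h, sub_zero]
  have hzorth : ∀ x ∈ orth F.K, ad z x = x := by
    intro x hx
    rw [F.expand' e x]
    have hp : ∀ j, ad z (F.p j) = F.p j := fun j => hzu (.inl j)
    have hq : ∀ j, ad z (F.q j) = F.q j := fun j => hzu (.inr j)
    simp only [F.mem_orth_K.mp hx, zero_smul, Finset.sum_const_zero, zero_add, map_add, map_sum,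
      map_smul, hp, hq, ad_k hz]
  have hu : ∀ s, ad (z * g) (F.u s) = ad (g * z) (F.u s) := by
    intro s
    have h1 := hz.1 _ (hg.2 _ (F.u_mem_orth s))
    rw [map_sub, hzu] at h1
    rw [ad_mul_apply, ad_mul_apply, hzu]
    exact sub_left_injective h1
  refine F.linearMap_ext e (fun i => ?_) (fun j => hu (.inl j)) (fun j => hu (.inr j))
    (fun i => ?_) v
  · rw [ad_mul_apply, ad_mul_apply, ad_k hg, ad_k hz, ad_k hg]
  · have h1 := hzorth _ (ad_sub_mem_orth hg (F.k' i))
    have h2 := hg.1 _ (hzk' i)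
    rw [map_sub] at h1 h2
    rw [ad_mul_apply, ad_mul_apply]
    rw [sub_eq_iff_eq_add] at h1 h2
    rw [h1, h2]
    abel

end Unipotent

end FockFrame

/-! ### Regular maps to vector spaces -/

section Regular

variable {X Y : Type*} {M N P : Type*} [AddCommGroup M] [Module ℂ M] [AddCommGroup N] [Module ℂ N]
  [AddCommGroup P] [Module ℂ P]

/-- A map to a vector space is regular if all linear functions on the vector space pull back to
regular functions. -/
def IsRegular (R : Subalgebra ℂ (X → ℂ)) (F : X → M) : Prop :=
  ∀ f : Module.Dual ℂ M, (fun x => f (F x)) ∈ R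

variable {R : Subalgebra ℂ (X → ℂ)}

namespace IsRegular

theorem const (m : M) : IsRegular R fun _ => m := fun f => R.algebraMap_mem (f m)

theorem add {F G : X → M} (hF : IsRegular R F) (hG : IsRegular R G) :
    IsRegular R fun x => F x + G x := fun f => by
  simp only [map_add]
  exact R.add_mem (hF f) (hG f)

theorem smul {φ : X → ℂ} {F : X → M} (hφ : φ ∈ R) (hF : IsRegular R F) :
    IsRegular R fun x => φ x • F x := fun f => by
  simp only [map_smul, smul_eq_mul]
  exact R.mul_mem hφ (hF f)

theorem const_smul (c : ℂ) {F : X → M} (hF : IsRegular R F) : IsRegular R fun x => c • F x :=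
  smul (R.algebraMap_mem c) hF

theorem sum {ι : Type*} (s : Finset ι) {F : ι → X → M} (hF : ∀ i ∈ s, IsRegular R (F i)) :
    IsRegular R fun x => ∑ i ∈ s, F i x := fun f => by
  simp only [map_sum]
  have := R.sum_mem fun i hi => hF i hi f
  convert this using 1
  funext x
  simp

theorem map {F : X → M} (hF : IsRegular R F) (T : M →ₗ[ℂ] N) : IsRegular R fun x => T (F x) :=
  fun f => hF (f ∘ₗ T)

theorem bilin [Module.Finite ℂ M] {F : X → M} {G : X → N} (hF : IsRegular R F)
    (hG : IsRegular R G) (β : M →ₗ[ℂ] N →ₗ[ℂ] P) : IsRegular R fun x => β (F x) (G x) := by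
  have h : (fun x => β (F x) (G x)) = fun x => ∑ i, (Module.finBasis ℂ M).coord i (F x) •
      β (Module.finBasis ℂ M i) (G x) := by
    funext x
    conv_lhs => rw [← (Module.finBasis ℂ M).sum_repr (F x)]
    simp only [map_sum, map_smul, LinearMap.sum_apply, LinearMap.smul_apply]
    rfl
  rw [h]
  exact sum _ fun i _ => smul (hF _) (hG.map _)

/-- A family of endomorphisms is regular if its values on all vectors are. -/
theorem of_apply [Module.Finite ℂ M] [Module.Finite ℂ N] {F : X → M →ₗ[ℂ] N}
    (hF : ∀ m, IsRegular R fun x => F x m) : IsRegular R F := by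
  have h : F = fun x => ∑ i, LinearMap.smulRightₗ ((Module.finBasis ℂ M).coord i)
      (F x (Module.finBasis ℂ M i)) := by
    funext x
    refine (Module.finBasis ℂ M).ext fun j => ?_
    rw [LinearMap.sum_apply, Finset.sum_eq_single j]
    · simp
    · intro i _ hij
      simp [Ne.symm hij]
    · simp
  rw [h]
  exact sum _ fun i _ => (hF _).map _

/-- Regularity may be tested after an injective linear map. -/
theorem of_injective {F : X → M} {T : M →ₗ[ℂ] N} (hT : Function.Injective T)
    (hF : IsRegular R fun x => T (F x)) : IsRegular R F := by
  obtain ⟨S, hS⟩ := LinearMap.exists_leftInverse_of_injective T (LinearMap.ker_eq_bot.mpr hT)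
  have h := hF.map S
  have h2 : ∀ m, S (T m) = m := fun m => LinearMap.congr_fun hS m
  simpa only [h2] using h

end IsRegular

theorem comp_mem_adjoin {S : Set (X → ℂ)} {T : Set (Y → ℂ)} {Φ : X → Y}
    (h : ∀ t ∈ T, t ∘ Φ ∈ Algebra.adjoin ℂ S) {u : Y → ℂ} (hu : u ∈ Algebra.adjoin ℂ T) :
    u ∘ Φ ∈ Algebra.adjoin ℂ S :=
  Algebra.adjoin_le (S := (Algebra.adjoin ℂ S).comap
    (AlgHom.pi fun x => Pi.evalAlgHom ℂ (fun _ : Y => ℂ) (Φ x))) h hu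

/-- A bijection is biregular if it and its inverse pull back generators to regular functions. -/
theorem isBiregular_adjoin {S : Set (X → ℂ)} {T : Set (Y → ℂ)} {Φ : X ≃ Y}
    (h₁ : ∀ t ∈ T, t ∘ Φ ∈ Algebra.adjoin ℂ S) (h₂ : ∀ s ∈ S, s ∘ Φ.symm ∈ Algebra.adjoin ℂ T) :
    IsBiregular (Algebra.adjoin ℂ S) (Algebra.adjoin ℂ T) Φ := by
  refine fun u => ⟨fun hu => comp_mem_adjoin h₁ hu, fun hu => ?_⟩
  have := comp_mem_adjoin h₂ hu
  rwa [Function.comp_assoc, Equiv.self_comp_symm, Function.comp_id] at this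

end Regular

section RegularGroup

variable {L : Type*} [AddCommGroup L] [Module ℂ L] {W : Type*} [AddCommGroup W] [Module ℂ W]
  {B : LinearMap.BilinForm ℂ W} {X Y : Type*}

theorem isRegular_spin (j : X → Sym L B) :
    IsRegular (groupFunctions B j) fun x => (j x).1.1 := fun f =>
  Algebra.subset_adjoin (Or.inl ⟨f, rfl⟩)

theorem isRegular_orthogonal (j : X → Sym L B) :
    IsRegular (groupFunctions B j) fun x => ((j x).2.1 : W →ₗ[ℂ] W) := fun f =>
  Algebra.subset_adjoin (Or.inr ⟨f, rfl⟩)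

/-- The action on the vector representation is regular. -/
theorem isRegular_ad (e : Module.Basis (Fin 5) ℂ L) (j : X → Sym L B) (v : Vec L) :
    IsRegular (groupFunctions B j) fun x => ad (j x).1 v := by
  have := finite_cliffordAlgebra e
  have h := isRegular_spin j
  let starL : CliffordAlgebra (vecForm L) →ₗ[ℂ] CliffordAlgebra (vecForm L) :=
    CliffordAlgebra.reverse ∘ₗ CliffordAlgebra.involute.toLinearMap
  have h1 := h.bilin (h.map starL)
    ((LinearMap.mul ℂ _) ∘ₗ LinearMap.mulRight ℂ (CliffordAlgebra.ι (vecForm L) v))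
  exact h1.map vecProj

/-- A family of elements of the spin group is regular if its action on one spinor and its action
on all vectors are regular. -/
theorem IsRegular.spin_of_apply (e : Module.Basis (Fin 5) ℂ L) {R : Subalgebra ℂ (X → ℂ)}
    {g : X → spinGroup (vecForm L)} {ψ : Spinor L} (hψ : ψ ≠ 0)
    (h₁ : IsRegular R fun x => spinorRep L (g x).1 ψ)
    (h₂ : ∀ v, IsRegular R fun x => ad (g x) v) : IsRegular R fun x => (g x).1 := by
  have : Module.Finite ℂ L := Module.Finite.of_basis e
  -- the spinors on which the action is regular are stable under Clifford multiplication
  let S : Submodule ℂ (Spinor L) :=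
    { carrier := {φ | IsRegular R fun x => spinorRep L (g x).1 φ}
      add_mem' := fun {φ φ'} h h' => by
        simp only [Set.mem_ofPred_eq, map_add] at h h' ⊢
        exact h.add h'
      zero_mem' := by
        simp only [Set.mem_ofPred_eq, map_zero]
        exact IsRegular.const 0
      smul_mem' := fun c φ h => by
        simp only [Set.mem_ofPred_eq, map_smul] at h ⊢
        exact h.const_smul c }
  have hS : S = ⊤ := by
    refine eq_top_of_cliffordMul_mem e S (fun h => hψ ?_) fun v φ hφ => ?_
    · have : ψ ∈ S := h₁
      rwa [h, Submodule.mem_bot] at this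
    · change IsRegular R fun x => spinorRep L (g x).1 (cliffordMul v φ)
      simp only [spinorRep_cliffordMul]
      exact (h₂ v).bilin hφ cliffordMul
  have h3 : IsRegular R fun x => spinorRep L (g x).1 := IsRegular.of_apply fun φ => by
    have : φ ∈ S := hS ▸ Submodule.mem_top
    exact this
  exact IsRegular.of_injective (T := (spinorRep L).toLinearMap) (spinorRep_injective e) h3

/-- Criterion for a bijection onto a subset of the symmetry group to be biregular. -/
theorem isBiregular_groupFunctions {S : Set (X → ℂ)} {j : Y → Sym L B} {Φ : X ≃ Y}
    (h₁ : IsRegular (Algebra.adjoin ℂ S) fun x => (j (Φ x)).1.1)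
    (h₂ : IsRegular (Algebra.adjoin ℂ S) fun x => ((j (Φ x)).2.1 : W →ₗ[ℂ] W))
    (h₃ : ∀ s ∈ S, s ∘ Φ.symm ∈ groupFunctions B j) :
    IsBiregular (Algebra.adjoin ℂ S) (groupFunctions B j) Φ := by
  refine isBiregular_adjoin ?_ h₃
  rintro t (⟨f, rfl⟩ | ⟨f, rfl⟩)
  exacts [h₁ f, h₂ f]

end RegularGroup

/-! ### The orthogonal group of the plane `W` -/

section Plane

variable {W : Type*} [AddCommGroup W] [Module ℂ W]

/-- A basis of two null vectors with inner product one. -/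
structure IsHyperbolic (B : LinearMap.BilinForm ℂ W) (w : Module.Basis (Fin 2) ℂ W) : Prop where
  zero_zero : B (w 0) (w 0) = 0
  one_one : B (w 1) (w 1) = 0
  zero_one : B (w 0) (w 1) = 1
  one_zero : B (w 1) (w 0) = 1

theorem linearEquiv_ext_fin_two (w : Module.Basis (Fin 2) ℂ W) {f g : W ≃ₗ[ℂ] W}
    (h0 : f (w 0) = g (w 0)) (h1 : f (w 1) = g (w 1)) : f = g :=
  w.ext' fun i => by fin_cases i <;> assumption

theorem det_fin_two (w : Module.Basis (Fin 2) ℂ W) {h : W ≃ₗ[ℂ] W} {a b c d : ℂ}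
    (h0 : h (w 0) = a • w 0 + c • w 1) (h1 : h (w 1) = b • w 0 + d • w 1) :
    ((LinearEquiv.det h : ℂˣ) : ℂ) = a * d - b * c := by
  rw [LinearEquiv.coe_det, ← LinearMap.det_toMatrix w, Matrix.det_fin_two]
  simp [LinearMap.toMatrix_apply, h0, h1]

/-- The elements of the special orthogonal group in a hyperbolic basis. -/
def scaling (w : Module.Basis (Fin 2) ℂ W) (t : ℂˣ) : W ≃ₗ[ℂ] W :=
  w.equiv (w.unitsSMul ![t, t⁻¹]) (Equiv.refl _)

theorem scaling_zero (w : Module.Basis (Fin 2) ℂ W) (t : ℂˣ) :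
    scaling w t (w 0) = (t : ℂ) • w 0 := by
  rw [scaling, Module.Basis.equiv_apply, Equiv.refl_apply, Module.Basis.unitsSMul_apply]
  rfl

theorem scaling_one (w : Module.Basis (Fin 2) ℂ W) (t : ℂˣ) :
    scaling w t (w 1) = (t : ℂ)⁻¹ • w 1 := by
  rw [scaling, Module.Basis.equiv_apply, Equiv.refl_apply, Module.Basis.unitsSMul_apply,
    ← Units.val_inv_eq_inv_val]
  rfl

theorem det_scaling (w : Module.Basis (Fin 2) ℂ W) (t : ℂˣ) :
    LinearEquiv.det (scaling w t) = 1 := by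
  ext
  rw [det_fin_two w (a := t) (b := 0) (c := 0) (d := (t : ℂ)⁻¹)
    (by simp [scaling_zero]) (by simp [scaling_one])]
  simp

theorem scaling_mul (w : Module.Basis (Fin 2) ℂ W) (s t : ℂˣ) :
    scaling w (s * t) = scaling w s * scaling w t := by
  apply linearEquiv_ext_fin_two w
  · rw [LinearEquiv.mul_apply, scaling_zero, scaling_zero, map_smul, scaling_zero, smul_smul,
      Units.val_mul, mul_comm]
  · rw [LinearEquiv.mul_apply, scaling_one, scaling_one, map_smul, scaling_one, smul_smul,
      Units.val_mul, mul_inv, mul_comm]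

theorem scaling_injective (w : Module.Basis (Fin 2) ℂ W) : Function.Injective (scaling w) := by
  intro s t h
  have := LinearEquiv.congr_fun h (w 0)
  rw [scaling_zero, scaling_zero] at this
  exact Units.ext (smul_left_injective ℂ (w.ne_zero 0) this)

variable {B : LinearMap.BilinForm ℂ W} {w : Module.Basis (Fin 2) ℂ W}

namespace IsHyperbolic

theorem apply (hw : IsHyperbolic B w) (a b c d : ℂ) :
    B (a • w 0 + c • w 1) (b • w 0 + d • w 1) = a * d + c * b := by
  simp only [map_add, map_smul, LinearMap.add_apply, LinearMap.smul_apply, hw.zero_zero,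
    hw.one_one, hw.zero_one, hw.one_zero, smul_eq_mul]
  ring

theorem mem_orthogonal (hw : IsHyperbolic B w) {h : W ≃ₗ[ℂ] W} {a b c d : ℂ}
    (h0 : h (w 0) = a • w 0 + c • w 1) (h1 : h (w 1) = b • w 0 + d • w 1)
    (hac : a * c = 0) (hbd : b * d = 0) (h01 : a * d + c * b = 1) : h ∈ orthogonal B := by
  intro x y
  rw [← w.sum_repr x, ← w.sum_repr y, Fin.sum_univ_two, Fin.sum_univ_two]
  generalize w.repr x 0 = x0
  generalize w.repr x 1 = x1
  generalize w.repr y 0 = y0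
  generalize w.repr y 1 = y1
  have key : ∀ x0 x1 : ℂ, h (x0 • w 0 + x1 • w 1) =
      (x0 * a + x1 * b) • w 0 + (x0 * c + x1 * d) • w 1 := fun x0 x1 => by
    rw [map_add, map_smul, map_smul, h0, h1]; module
  rw [key, key, hw.apply, hw.apply]
  linear_combination (2 * x0 * y0) * hac + (2 * x1 * y1) * hbd + (x0 * y1 + x1 * y0) * h01

theorem scaling_mem (hw : IsHyperbolic B w) (t : ℂˣ) : scaling w t ∈ orthogonal B :=
  hw.mem_orthogonal (a := t) (b := 0) (c := 0) (d := (t : ℂ)⁻¹) (by simp [scaling_zero])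
    (by simp [scaling_one]) (by simp) (by simp) (by simp)

theorem exists_coeff (hw : IsHyperbolic B w) {h : W ≃ₗ[ℂ] W} (hh : h ∈ orthogonal B) :
    ∃ a b c d : ℂ, h (w 0) = a • w 0 + c • w 1 ∧ h (w 1) = b • w 0 + d • w 1 ∧
      a * c = 0 ∧ b * d = 0 ∧ a * d + c * b = 1 := by
  have e0 := w.sum_repr (h (w 0))
  have e1 := w.sum_repr (h (w 1))
  rw [Fin.sum_univ_two] at e0 e1
  refine ⟨_, _, _, _, e0.symm, e1.symm, ?_, ?_, ?_⟩
  · have := hh (w 0) (w 0)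
    rw [← e0, hw.apply, hw.zero_zero] at this
    linear_combination this / 2
  · have := hh (w 1) (w 1)
    rw [← e1, hw.apply, hw.one_one] at this
    linear_combination this / 2
  · have := hh (w 0) (w 1)
    rw [← e0, ← e1, hw.apply, hw.zero_one] at this
    exact this

/-- The special orthogonal group of the plane is a one-dimensional torus. -/
theorem exists_eq_scaling (hw : IsHyperbolic B w) {h : W ≃ₗ[ℂ] W} (hh : h ∈ orthogonal B)
    (hdet : LinearEquiv.det h = 1) : ∃ t, h = scaling w t := by
  obtain ⟨a, b, c, d, h0, h1, hac, hbd, h01⟩ := hw.exists_coeff hh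
  have hd := det_fin_two w h0 h1
  rw [hdet, Units.val_one] at hd
  have had : a * d = 1 := by linear_combination (h01 - hd) / 2
  have ha : a ≠ 0 := left_ne_zero_of_mul_eq_one had
  have hd0 : d ≠ 0 := right_ne_zero_of_mul_eq_one had
  obtain rfl := (mul_eq_zero.mp hac).resolve_left ha
  obtain rfl := (mul_eq_zero.mp hbd).resolve_right hd0
  refine ⟨Units.mk0 a ha, linearEquiv_ext_fin_two w ?_ ?_⟩
  · rw [h0, scaling_zero, zero_smul, add_zero]; rfl
  · rw [h1, scaling_one, zero_smul, zero_add, eq_inv_of_mul_eq_one_right had]; rfl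

theorem det_eq_one_or_neg_one (hw : IsHyperbolic B w) {h : W ≃ₗ[ℂ] W} (hh : h ∈ orthogonal B) :
    LinearEquiv.det h = 1 ∨ LinearEquiv.det h = -1 := by
  obtain ⟨a, b, c, d, h0, h1, hac, hbd, h01⟩ := hw.exists_coeff hh
  have hd := det_fin_two w h0 h1
  have h2 : ((LinearEquiv.det h : ℂˣ) : ℂ) * (LinearEquiv.det h : ℂˣ) = 1 := by
    rw [hd]
    linear_combination (a * d + c * b + 1) * h01 - 4 * b * d * hac
  rcases mul_self_eq_one_iff.mp h2 with h3 | h3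
  · exact Or.inl (Units.ext h3)
  · exact Or.inr (Units.ext h3)

end IsHyperbolic

end Plane

/-! ### The stabilizer in terms of a frame -/

variable {L : Type*} [AddCommGroup L] [Module ℂ L] {W : Type*} [AddCommGroup W] [Module ℂ W]

theorem tmul_add_tmul_eq_iff (w : Module.Basis (Fin 2) ℂ W) {ψ₁ ψ₂ φ₁ φ₂ : SPlus L} :
    ψ₁ ⊗ₜ[ℂ] w 0 + ψ₂ ⊗ₜ[ℂ] w 1 = φ₁ ⊗ₜ[ℂ] w 0 + φ₂ ⊗ₜ[ℂ] w 1 ↔ ψ₁ = φ₁ ∧ ψ₂ = φ₂ := by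
  refine ⟨fun h => ?_, fun h => by rw [h.1, h.2]⟩
  have h0 := congrArg (fun Q => toMap Q (w.coord 0)) h
  have h1 := congrArg (fun Q => toMap Q (w.coord 1)) h
  simp only [toMap_add, toMap_tmul, Module.Basis.coord_apply, Module.Basis.repr_self] at h0 h1
  exact ⟨by simpa using h0, by simpa using h1⟩

/-- A frame of `V` and a basis of `W` in which the supercharge `Q` is
`vacuum ⊗ w₀ + second ⊗ w₁`. -/
structure AdaptedFrame (B : LinearMap.BilinForm ℂ W) (Q : Supercharge L W) where
  /-- The frame of `V`. -/
  F : FockFrame L (Fin 3 ⊕ Fin 2)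
  /-- The basis of `W`. -/
  w : Module.Basis (Fin 2) ℂ W
  hw : IsHyperbolic B w
  vacuum_mem : F.vacuum ∈ SPlus L
  second_mem : F.second ∈ SPlus L
  eq : Q = (⟨F.vacuum, vacuum_mem⟩ : SPlus L) ⊗ₜ[ℂ] w 0 +
    (⟨F.second, second_mem⟩ : SPlus L) ⊗ₜ[ℂ] w 1

namespace AdaptedFrame

variable {B : LinearMap.BilinForm ℂ W} {Q : Supercharge L W} (D : AdaptedFrame B Q)

theorem mem_stab_iff {s : Sym L B} : s ∈ stab B Q ↔ superRep L B s Q = Q := Iff.rfl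

theorem superRep_apply (s : Sym L B) : superRep L B s Q =
    halfSpinRep L s.1 ⟨D.F.vacuum, D.vacuum_mem⟩ ⊗ₜ[ℂ] s.2.1 (D.w 0) +
      halfSpinRep L s.1 ⟨D.F.second, D.second_mem⟩ ⊗ₜ[ℂ] s.2.1 (D.w 1) := by
  conv_lhs => rw [D.eq]
  rw [map_add]
  rfl

/-- An element of `Spin(V)` and a rotation of `W` stabilize the supercharge if they scale its
components inversely. -/
theorem mem_stab_of_scaling {s : Sym L B} {t : ℂˣ} (hs : s.2.1 = scaling D.w t) :
    s ∈ stab B Q ↔ spinorRep L s.1.1 D.F.vacuum = (t : ℂ)⁻¹ • D.F.vacuum ∧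
      spinorRep L s.1.1 D.F.second = (t : ℂ) • D.F.second := by
  have ht : (t : ℂ) ≠ 0 := t.ne_zero
  rw [mem_stab_iff, D.superRep_apply, hs, scaling_zero, scaling_one, ← TensorProduct.smul_tmul,
    ← TensorProduct.smul_tmul]
  conv_lhs => rhs; rw [D.eq]
  rw [tmul_add_tmul_eq_iff, Subtype.ext_iff, Subtype.ext_iff, eq_inv_smul_iff₀ ht]
  refine and_congr Iff.rfl ?_
  rw [← inv_smul_eq_iff₀ ht]
  exact Iff.rfl

theorem mem_stab_of_swap {s : Sym L B} (h0 : s.2.1 (D.w 0) = D.w 1) (h1 : s.2.1 (D.w 1) = D.w 0) :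
    s ∈ stab B Q ↔ spinorRep L s.1.1 D.F.second = D.F.vacuum ∧
      spinorRep L s.1.1 D.F.vacuum = D.F.second := by
  rw [mem_stab_iff, D.superRep_apply, h0, h1, add_comm]
  conv_lhs => rhs; rw [D.eq]
  rw [tmul_add_tmul_eq_iff, Subtype.ext_iff, Subtype.ext_iff]
  exact Iff.rfl

theorem mem_specialStab_iff {s : Sym L B} : s ∈ specialStab B Q ↔
    s ∈ stab B Q ∧ LinearEquiv.det s.2.1 = 1 := Iff.rfl

theorem exists_scaling {s : Sym L B} (hs : s ∈ specialStab B Q) : ∃ t : ℂˣ,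
    s.2.1 = scaling D.w t ∧ spinorRep L s.1.1 D.F.vacuum = (t : ℂ)⁻¹ • D.F.vacuum ∧
      spinorRep L s.1.1 D.F.second = (t : ℂ) • D.F.second := by
  obtain ⟨t, ht⟩ := D.hw.exists_eq_scaling s.2.2 hs.2
  exact ⟨t, ht, (D.mem_stab_of_scaling ht).mp hs.1⟩

theorem mem_specialStab {s : Sym L B} {t : ℂˣ} (ht : s.2.1 = scaling D.w t)
    (h1 : spinorRep L s.1.1 D.F.vacuum = (t : ℂ)⁻¹ • D.F.vacuum)
    (h2 : spinorRep L s.1.1 D.F.second = (t : ℂ) • D.F.second) : s ∈ specialStab B Q :=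
  mem_specialStab_iff.mpr ⟨(D.mem_stab_of_scaling ht).mpr ⟨h1, h2⟩, by rw [ht, det_scaling]⟩

end AdaptedFrame

variable {L : Type*} [AddCommGroup L] [Module ℂ L] {W : Type*} [AddCommGroup W] [Module ℂ W]

namespace FockFrame

variable {F : FockFrame L (Fin 3 ⊕ Fin 2)}

theorem mul_comm_of_dualProd_u_eq_zero (e : Module.Basis (Fin 5) ℂ L)
    {g z : spinGroup (vecForm L)} (hg : g ∈ F.unip) (hz : z ∈ F.unip)
    (h : ∀ i s, LinearMap.dualProd ℂ L (F.u s) (ad z (F.k' i)) = 0)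
    (hgv : spinorRep L g.1 F.vacuum = F.vacuum) (hzv : spinorRep L z.1 F.vacuum = F.vacuum) :
    z * g = g * z :=
  spin_ext e (ad_comm_of_dualProd_u_eq_zero e hg hz h) F.vacuum_ne_zero
    (by rw [spinorRep_mul_apply, spinorRep_mul_apply, hgv, hzv, hgv])

variable (F) in
/-- `g` scales the two spinors of the line by `r` and `r'`. -/
structure Scales (g : spinGroup (vecForm L)) (r r' : ℂ) : Prop where
  vacuum : spinorRep L g.1 F.vacuum = r • F.vacuum
  second : spinorRep L g.1 F.second = r' • F.second

namespace Scales

theorem inv {g : spinGroup (vecForm L)} {r r' : ℂ} (h : F.Scales g r r') (hr : r ≠ 0)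
    (hr' : r' ≠ 0) : F.Scales g⁻¹ r⁻¹ r'⁻¹ where
  vacuum := by rw [eq_inv_smul_iff₀ hr, ← map_smul, ← h.vacuum, spinorRep_inv_apply]
  second := by rw [eq_inv_smul_iff₀ hr', ← map_smul, ← h.second, spinorRep_inv_apply]

variable {g : spinGroup (vecForm L)} {r r' : ℂ} (h : F.Scales g r r') (hr : r ≠ 0) (hr' : r' ≠ 0)

include h hr hr'

theorem ad_mem_K (e : Module.Basis (Fin 5) ℂ L) {x : Vec L} (hx : x ∈ F.K) : ad g x ∈ F.K := by
  rw [F.K_eq e] at hx ⊢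
  obtain ⟨h1, h2⟩ := hx
  rw [SetLike.mem_coe, mem_ann] at h1 h2
  exact ⟨mem_ann.mpr (ad_mem_ann hr h.vacuum h1), mem_ann.mpr (ad_mem_ann hr' h.second h2)⟩

theorem ad_inv_mem_K (e : Module.Basis (Fin 5) ℂ L) {x : Vec L} (hx : x ∈ F.K) :
    ad g⁻¹ x ∈ F.K :=
  (h.inv hr hr').ad_mem_K (inv_ne_zero hr) (inv_ne_zero hr') e hx

theorem ad_mem_orth_K (e : Module.Basis (Fin 5) ℂ L) {x : Vec L} (hx : x ∈ orth F.K) :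
    ad g x ∈ orth F.K := fun y hy => by
  have h1 := hx _ (h.ad_inv_mem_K hr hr' e hy)
  have h2 := dualProd_ad g (ad g⁻¹ y) x
  rw [ad_ad_inv] at h2
  exact h2.trans h1

theorem conj_mem_unip (e : Module.Basis (Fin 5) ℂ L) {n : spinGroup (vecForm L)}
    (hn : n ∈ F.unip) : g * n * g⁻¹ ∈ F.unip := by
  have h' := h.inv hr hr'
  refine ⟨fun x hx => ?_, fun x hx => ?_⟩
  · rw [ad_mul_apply, ad_mul_apply, hn.1 _ (h.ad_inv_mem_K hr hr' e hx), ad_ad_inv]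
  · have h1 := h.ad_mem_K hr hr' e
      (hn.2 _ (h'.ad_mem_orth_K (inv_ne_zero hr) (inv_ne_zero hr') e hx))
    rw [map_sub, ad_ad_inv] at h1
    rwa [ad_mul_apply, ad_mul_apply]

end Scales

end FockFrame

/-! ### The unipotent radical of the stabilizer -/

namespace AdaptedFrame

open FockFrame

variable {B : LinearMap.BilinForm ℂ W} {Q : Supercharge L W} (D : AdaptedFrame B Q)

theorem exists_scales (s : specialStab B Q) : ∃ t : ℂˣ, s.1.2.1 = scaling D.w t ∧
    D.F.Scales s.1.1 (t : ℂ)⁻¹ t := by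
  obtain ⟨t, h1, h2, h3⟩ := D.exists_scaling s.2
  exact ⟨t, h1, h2, h3⟩

/-- The elements of the stabilizer that act trivially on `W` and unipotently on `V`. -/
def radical : Subgroup (specialStab B Q) :=
  D.F.unip.comap ((MonoidHom.fst _ _).comp (specialStab B Q).subtype) ⊓
    ((MonoidHom.snd _ _).comp (specialStab B Q).subtype).ker

theorem mem_radical {s : specialStab B Q} : s ∈ D.radical ↔ s.1.1 ∈ D.F.unip ∧ s.1.2 = 1 := Iff.rfl

theorem radical_normal (e : Module.Basis (Fin 5) ℂ L) : D.radical.Normal where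
  conj_mem n hn s := by
    obtain ⟨t, -, h⟩ := D.exists_scales s
    refine D.mem_radical.mpr
      ⟨h.conj_mem_unip (inv_ne_zero t.ne_zero) t.ne_zero e (D.mem_radical.mp hn).1, ?_⟩
    have h2 : n.1.2 = 1 := (D.mem_radical.mp hn).2
    change s.1.2 * n.1.2 * s.1.2⁻¹ = 1
    rw [h2, mul_one, mul_inv_cancel]

theorem scaling_one_eq (w : Module.Basis (Fin 2) ℂ W) : scaling w 1 = 1 := by
  apply linearEquiv_ext_fin_two w
  · simp [scaling_zero]
  · simp [scaling_one]

theorem radical_fix (n : D.radical) :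
    spinorRep L n.1.1.1.1 D.F.vacuum = D.F.vacuum := by
  obtain ⟨t, h1, h2⟩ := D.exists_scales n.1
  have h3 : n.1.1.2 = 1 := (D.mem_radical.mp n.2).2
  rw [h3] at h1
  have h4 : t = 1 := scaling_injective D.w (h1.symm.trans (scaling_one_eq D.w).symm)
  have := h2.vacuum
  rwa [h4, Units.val_one, inv_one, one_smul] at this

/-- The isomorphism of `ℂ¹⁵` with the unipotent radical. -/
def radicalEquiv (e : Module.Basis (Fin 5) ℂ L) (σ : UnipIndex ≃ Fin 15) :
    (Fin 15 → ℂ) ≃ D.radical where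
  toFun x := ⟨⟨(D.F.unipElt (x ∘ σ), 1), D.mem_specialStab (t := 1) (scaling_one_eq D.w).symm
      (by rw [D.F.unipElt_fix _ fun i => D.F.b_vacuum _]; simp)
      (by rw [D.F.unipElt_fix _ fun i => D.F.k_second _]; simp)⟩,
    D.mem_radical.mpr ⟨D.F.unipElt_mem _, rfl⟩⟩
  invFun n := D.F.unipCoord n.1.1.1 ∘ σ.symm
  left_inv x := by
    change D.F.unipCoord (D.F.unipElt (x ∘ σ)) ∘ σ.symm = x
    rw [unipCoord_unipElt, Function.comp_assoc, Equiv.self_comp_symm, Function.comp_id]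
  right_inv n := by
    have h1 := D.mem_radical.mp n.2
    refine Subtype.ext (Subtype.ext (Prod.ext ?_ h1.2.symm))
    change D.F.unipElt ((D.F.unipCoord n.1.1.1 ∘ σ.symm) ∘ σ) = n.1.1.1
    rw [Function.comp_assoc, Equiv.symm_comp_self, Function.comp_id]
    refine spin_ext e (D.F.ad_unipElt_unipCoord e h1.1) D.F.vacuum_ne_zero ?_
    rw [D.radical_fix, D.F.unipElt_fix _ fun i => D.F.b_vacuum _]

end AdaptedFrame

open FockFrame in
theorem isRegular_unipElt (e : Module.Basis (Fin 5) ℂ L) (σ : UnipIndex ≃ Fin 15)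
    (F : FockFrame L (Fin 3 ⊕ Fin 2)) :
    IsRegular (affineFunctions 15) fun x : Fin 15 → ℂ => (F.unipElt (x ∘ σ)).1 := by
  have := finite_cliffordAlgebra e
  have hx : ∀ i, (fun x : Fin 15 → ℂ => (x ∘ σ) i) ∈ affineFunctions 15 := fun i =>
    Algebra.subset_adjoin ⟨σ i, rfl⟩
  have h1 : ∀ i, IsRegular (affineFunctions 15) fun x : Fin 15 → ℂ => F.unipVec (x ∘ σ) i := by
    intro i
    refine IsRegular.add (IsRegular.sum _ fun s _ => IsRegular.smul (hx _) (IsRegular.const _)) ?_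
    fin_cases i
    · exact IsRegular.add (IsRegular.smul (hx _) (IsRegular.const _))
        (IsRegular.smul (hx _) (IsRegular.const _))
    · exact IsRegular.smul (hx _) (IsRegular.const _)
    · exact IsRegular.const _
  have h2 : ∀ i, IsRegular (affineFunctions 15) fun x : Fin 15 → ℂ =>
      (F.eichler i (F.unipVec_mem (x ∘ σ) i)).1 := fun i =>
    IsRegular.add (IsRegular.const _)
      ((h1 i).map (LinearMap.mulLeft ℂ (CliffordAlgebra.ι (vecForm L) (F.k i)) ∘ₗ
        CliffordAlgebra.ι (vecForm L)))
  exact ((h2 0).bilin (h2 1) (LinearMap.mul ℂ _)).bilin (h2 2) (LinearMap.mul ℂ _)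

namespace AdaptedFrame

open FockFrame

variable {B : LinearMap.BilinForm ℂ W} {Q : Supercharge L W} (D : AdaptedFrame B Q)

theorem isBiregular_radicalEquiv (e : Module.Basis (Fin 5) ℂ L) (σ : UnipIndex ≃ Fin 15) :
    IsBiregular (affineFunctions 15)
      (groupFunctions B fun n : D.radical => (n : specialStab B Q).1) (D.radicalEquiv e σ) := by
  refine isBiregular_groupFunctions (isRegular_unipElt e σ D.F) (IsRegular.const _) ?_
  rintro _ ⟨i, rfl⟩
  change (fun n : D.radical => D.F.unipCoord n.1.1.1 (σ.symm i)) ∈ _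
  have h1 : ∀ v x, (fun n : D.radical => -LinearMap.dualProd ℂ L v (ad n.1.1.1 x)) ∈
      groupFunctions B fun n : D.radical => (n : specialStab B Q).1 := fun v x =>
    Subalgebra.neg_mem _ (isRegular_ad e (fun n : D.radical => (n : specialStab B Q).1) x
      (LinearMap.dualProd ℂ L v))
  rcases σ.symm i with ⟨i, s⟩ | c
  · exact h1 _ _
  · fin_cases c
    exacts [h1 _ _, h1 _ _, h1 _ _]

/-- The class of a unipotent element modulo the centre. -/
def radicalHom : D.radical →* Multiplicative (Fin 3 × (Fin 2 ⊕ Fin 2) → ℂ) :=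
  MonoidHom.mk' (fun n => Multiplicative.ofAdd fun x =>
      LinearMap.dualProd ℂ L (D.F.u x.2) (ad n.1.1.1 (D.F.k' x.1))) fun m n => by
    rw [← ofAdd_add]
    congr 1
    funext x
    exact dualProd_u_ad_mul (D.mem_radical.mp m.2).1 (D.mem_radical.mp n.2).1 _ _

/-- The group is two-step nilpotent: elements that act trivially on the classes modulo `K` are
central. -/
theorem radical_isNilpotent (e : Module.Basis (Fin 5) ℂ L) : Group.IsNilpotent D.radical := by
  refine Subgroup.isNilpotent_of_ker_le_center D.radicalHom fun z hz => ?_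
  rw [Subgroup.mem_center_iff]
  intro n
  have h1 : ∀ i s, LinearMap.dualProd ℂ L (D.F.u s) (ad z.1.1.1 (D.F.k' i)) = 0 := fun i s =>
    congrFun (Multiplicative.ofAdd.injective hz) (i, s)
  have hn := D.mem_radical.mp n.2
  have hz := D.mem_radical.mp z.2
  refine Subtype.ext (Subtype.ext (Prod.ext ?_ ?_))
  · exact (mul_comm_of_dualProd_u_eq_zero e hn.1 hz.1 h1 (D.radical_fix n) (D.radical_fix z)).symm
  · change n.1.1.2 * z.1.1.2 = z.1.1.2 * n.1.1.2
    rw [hn.2, hz.2]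

end AdaptedFrame

variable {L : Type*} [AddCommGroup L] [Module ℂ L] {W : Type*} [AddCommGroup W] [Module ℂ W]

/-! ### The Levi factor -/

namespace FockFrame

variable {F : FockFrame L (Fin 3 ⊕ Fin 2)}

/-- A lift is determined by its action on vectors and on the vacuum. -/
theorem isLift_unique (e : Module.Basis (Fin 5) ℂ L)
    {G H : Matrix (Fin 3 ⊕ Fin 2) (Fin 3 ⊕ Fin 2) ℂ} {r : ℂ} {g g' : spinGroup (vecForm L)}
    (h : F.IsLift G H r g) (h' : F.IsLift G H r g') : g = g' := by
  refine spin_ext e (F.linearMap_ext e (fun i => ?_) (fun j => ?_) (fun j => ?_) fun i => ?_)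
    F.vacuum_ne_zero (by rw [h.vacuum, h'.vacuum])
  · rw [h.b, h'.b]
  · rw [h.b, h'.b]
  · rw [h.a, h'.a]
  · rw [h.a, h'.a]

variable (F) in
/-- A linear change of `q₀, q₁` scales the second spinor by its determinant. -/
theorem cliffordMul_q_cliffordMul_q (D : Matrix (Fin 2) (Fin 2) ℂ) :
    cliffordMul (∑ i, D i 0 • F.q i) (cliffordMul (∑ i, D i 1 • F.q i) F.vacuum) =
      D.det • F.second := by
  have h10 : cliffordMul (F.q 1) (cliffordMul (F.q 0) F.vacuum) = -F.second := by
    rw [cliffordMul_anticomm, F.aa, zero_smul, zero_sub, second]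
  have h00 : cliffordMul (F.q 0) (cliffordMul (F.q 0) F.vacuum) = 0 := F.a_a_self _ _
  have h11 : cliffordMul (F.q 1) (cliffordMul (F.q 1) F.vacuum) = 0 := F.a_a_self _ _
  have h01 : cliffordMul (F.q 0) (cliffordMul (F.q 1) F.vacuum) = F.second := rfl
  simp only [Fin.sum_univ_two, map_add, map_smul, LinearMap.add_apply, LinearMap.smul_apply, h10,
    h00, h11, h01, Matrix.det_fin_two]
  module

namespace IsLift

variable {A A' : Matrix (Fin 3) (Fin 3) ℂ} {C C' : Matrix (Fin 2) (Fin 2) ℂ} {r : ℂ}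
  {g : spinGroup (vecForm L)}

theorem ad_k (h : F.IsLift (Matrix.fromBlocks A 0 0 C) (Matrix.fromBlocks A' 0 0 C') r g)
    (j : Fin 3) : ad g (F.k j) = ∑ i, A i j • F.k i := by
  rw [h.b, Fintype.sum_sum_type]; simp

theorem ad_p (h : F.IsLift (Matrix.fromBlocks A 0 0 C) (Matrix.fromBlocks A' 0 0 C') r g)
    (j : Fin 2) : ad g (F.p j) = ∑ i, C i j • F.p i := by
  rw [h.b, Fintype.sum_sum_type]; simp

theorem ad_q (h : F.IsLift (Matrix.fromBlocks A 0 0 C) (Matrix.fromBlocks A' 0 0 C') r g)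
    (j : Fin 2) : ad g (F.q j) = ∑ i, C' j i • F.q i := by
  rw [h.a, Fintype.sum_sum_type]; simp

theorem second (h : F.IsLift (Matrix.fromBlocks A 0 0 C) (Matrix.fromBlocks A' 0 0 C') r g) :
    spinorRep L g.1 F.second = (C'.det * r) • F.second := by
  rw [FockFrame.second, spinorRep_cliffordMul, spinorRep_cliffordMul, h.vacuum, map_smul,
    map_smul, h.ad_q, h.ad_q]
  have := F.cliffordMul_q_cliffordMul_q C'.transpose
  simp only [Matrix.transpose_apply, Matrix.det_transpose] at this
  rw [this, smul_smul, mul_comm]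
  rfl

end IsLift

end FockFrame

/-- The block matrix by which an element of the Levi factor acts on the maximal isotropic
subspace annihilating the vacuum. -/
def leviMatrix (m : Levi) : Matrix (Fin 3 ⊕ Fin 2) (Fin 3 ⊕ Fin 2) ℂ :=
  Matrix.fromBlocks m.1.1 0 0 (((m.2.2⁻¹ : ℂˣ) : ℂ) • m.2.1.1)

theorem leviMatrix_mul (m n : Levi) : leviMatrix (m * n) = leviMatrix m * leviMatrix n := by
  rw [leviMatrix, leviMatrix, leviMatrix, Matrix.fromBlocks_multiply]
  simp [mul_comm, smul_smul]

theorem leviMatrix_one : leviMatrix 1 = 1 := by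
  rw [leviMatrix, ← Matrix.fromBlocks_one]
  simp

theorem leviMatrix_inv (m : Levi) : (leviMatrix m)⁻¹ = leviMatrix m⁻¹ :=
  Matrix.inv_eq_right_inv (by rw [← leviMatrix_mul, mul_inv_cancel, leviMatrix_one])

theorem det_leviMatrix (m : Levi) : ((m.2.2⁻¹ : ℂˣ) : ℂ) ^ 2 = (leviMatrix m).det := by
  rw [leviMatrix, Matrix.det_fromBlocks_zero₂₁, Matrix.det_smul, m.1.2, m.2.1.2]
  simp

namespace FockFrame

variable (F : FockFrame L (Fin 3 ⊕ Fin 2))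

theorem exists_leviLift (m : Levi) : ∃ g, F.IsLift (leviMatrix m) (leviMatrix m⁻¹)
    ((m.2.2⁻¹ : ℂˣ) : ℂ) g := by
  rw [← leviMatrix_inv]
  exact F.exists_isLift _ (Units.ne_zero _) (det_leviMatrix m)

/-- The lift of an element of the Levi factor to the spin group that scales the vacuum by the
inverse of its component in `ℂˣ`. -/
def leviLift (m : Levi) : spinGroup (vecForm L) := (F.exists_leviLift m).choose

theorem isLift_leviLift (m : Levi) : F.IsLift (leviMatrix m) (leviMatrix m⁻¹)
    ((m.2.2⁻¹ : ℂˣ) : ℂ) (F.leviLift m) := (F.exists_leviLift m).choose_spec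

theorem leviLift_mul (e : Module.Basis (Fin 5) ℂ L) (m n : Levi) :
    F.leviLift (m * n) = F.leviLift m * F.leviLift n := by
  refine isLift_unique e (F.isLift_leviLift _) ?_
  rw [leviMatrix_mul, mul_inv_rev, leviMatrix_mul, Prod.snd_mul, Prod.snd_mul, mul_inv,
    Units.val_mul]
  exact (F.isLift_leviLift m).mul (F.isLift_leviLift n)

theorem leviLift_second (m : Levi) :
    spinorRep L (F.leviLift m).1 F.second = (m.2.2 : ℂ) • F.second := by
  have h1 : (m⁻¹).2.1.1.det = 1 := (m⁻¹).2.1.2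
  have h2 : (((m⁻¹).2.2⁻¹ : ℂˣ) : ℂ) = m.2.2 := by simp
  rw [(F.isLift_leviLift m).second, Matrix.det_smul, h1, h2, Fintype.card_fin, mul_one, pow_two,
    mul_assoc, Units.mul_inv, mul_one]

end FockFrame

namespace AdaptedFrame

open FockFrame

variable {B : LinearMap.BilinForm ℂ W} {Q : Supercharge L W} (D : AdaptedFrame B Q)

/-- The homomorphism from the Levi factor to the stabilizer. -/
def leviHom (e : Module.Basis (Fin 5) ℂ L) : Levi →* specialStab B Q :=
  MonoidHom.mk' (fun m => ⟨(D.F.leviLift m, ⟨scaling D.w m.2.2, D.hw.scaling_mem _⟩),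
    D.mem_specialStab (t := m.2.2) rfl
      (by rw [← Units.val_inv_eq_inv_val]; exact (D.F.isLift_leviLift m).vacuum)
      (D.F.leviLift_second m)⟩) fun m n =>
    Subtype.ext (Prod.ext (D.F.leviLift_mul e m n) (Subtype.ext (scaling_mul D.w _ _)))

theorem leviHom_apply_fst (e : Module.Basis (Fin 5) ℂ L) (m : Levi) :
    (D.leviHom e m).1.1 = D.F.leviLift m := rfl

theorem leviHom_apply_snd (e : Module.Basis (Fin 5) ℂ L) (m : Levi) :
    (D.leviHom e m).1.2.1 = scaling D.w m.2.2 := rfl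

theorem leviHom_snd_eq_one_iff (e : Module.Basis (Fin 5) ℂ L) (m : Levi) :
    (D.leviHom e m).1.2 = 1 ↔ m.2.2 = 1 := by
  rw [Subtype.ext_iff, leviHom_apply_snd]
  change scaling D.w m.2.2 = 1 ↔ _
  rw [← scaling_one_eq D.w]
  exact (scaling_injective D.w).eq_iff

end AdaptedFrame

namespace FockFrame

variable (F : FockFrame L (Fin 3 ⊕ Fin 2))

theorem leviLift_coord_k (m : Levi) (i j : Fin 3) :
    LinearMap.dualProd ℂ L (F.k' i) (ad (F.leviLift m) (F.k j)) = m.1.1 i j := by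
  have := (F.isLift_leviLift m).ad_k j
  rw [this, map_sum]
  simp only [map_smul, F.ab]
  simp

theorem leviLift_coord_p (m : Levi) (i j : Fin 2) :
    (m.2.2 : ℂ) * LinearMap.dualProd ℂ L (F.q i) (ad (F.leviLift m) (F.p j)) = m.2.1.1 i j := by
  have := (F.isLift_leviLift m).ad_p j
  rw [this, map_sum]
  simp only [map_smul, F.ab]
  simp

end FockFrame

namespace AdaptedFrame

open FockFrame

variable {B : LinearMap.BilinForm ℂ W} {Q : Supercharge L W} (D : AdaptedFrame B Q)

theorem leviHom_injective (e : Module.Basis (Fin 5) ℂ L) : Function.Injective (D.leviHom e) := by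
  rw [injective_iff_map_eq_one]
  intro m hm
  have ht : m.2.2 = 1 := (D.leviHom_snd_eq_one_iff e m).mp (by rw [hm]; rfl)
  have hg : D.F.leviLift m = 1 := by rw [← leviHom_apply_fst D e, hm]; rfl
  refine Prod.ext (Subtype.ext (Matrix.ext fun i j => ?_))
    (Prod.ext (Subtype.ext (Matrix.ext fun i j => ?_)) ht)
  · have := D.F.leviLift_coord_k m i j
    rw [hg, map_one, Module.End.one_apply, D.F.ab] at this
    rw [← this]
    simp [Matrix.one_apply]
  · have := D.F.leviLift_coord_p m i j
    rw [hg, map_one, Module.End.one_apply, D.F.ab, ht] at this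
    rw [← this]
    simp [Matrix.one_apply]

/-- The Levi factor as a subgroup of the stabilizer. -/
def leviEquiv (e : Module.Basis (Fin 5) ℂ L) : Levi ≃* (D.leviHom e).range :=
  MonoidHom.ofInjective (D.leviHom_injective e)

theorem coe_leviEquiv (e : Module.Basis (Fin 5) ℂ L) (m : Levi) :
    (D.leviEquiv e m : specialStab B Q) = D.leviHom e m := rfl

end AdaptedFrame

theorem det_mem {X ι : Type*} [Fintype ι] [DecidableEq ι] {R : Subalgebra ℂ (X → ℂ)}
    {A : X → Matrix ι ι ℂ} (hA : ∀ i j, (fun x => A x i j) ∈ R) : (fun x => (A x).det) ∈ R := by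
  have h : (fun x => (A x).det) = ∑ σ : Equiv.Perm ι, ((Equiv.Perm.sign σ : ℤ) : ℂ) •
      ∏ i, fun x => A x (σ i) i := by
    funext x
    simp [Matrix.det_apply']
  rw [h]
  exact R.sum_mem fun σ _ => R.smul_mem (R.prod_mem fun i _ => hA _ _) _

theorem adjugate_mem {X ι : Type*} [Fintype ι] [DecidableEq ι] {R : Subalgebra ℂ (X → ℂ)}
    {A : X → Matrix ι ι ℂ} (hA : ∀ i j, (fun x => A x i j) ∈ R) (i j : ι) :
    (fun x => (A x).adjugate i j) ∈ R := by
  simp only [Matrix.adjugate_apply]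
  refine det_mem fun k l => ?_
  by_cases h : k = j
  · subst h
    simp only [Matrix.updateRow_self]
    exact R.algebraMap_mem (Pi.single (M := fun _ => ℂ) i 1 l)
  · simp only [Matrix.updateRow_ne h]
    exact hA k l

open FockFrame in
theorem leviMatrix_mem (i j : Fin 3 ⊕ Fin 2) :
    (fun m => leviMatrix m i j) ∈ leviFunctions ∧
      (fun m => leviMatrix m⁻¹ i j) ∈ leviFunctions := by
  have h1 : ∀ i j, (fun m : Levi => m.1.1 i j) ∈ leviFunctions := fun i j =>
    Algebra.subset_adjoin (Or.inl (Or.inl ⟨(i, j), rfl⟩))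
  have h2 : ∀ i j, (fun m : Levi => m.2.1.1 i j) ∈ leviFunctions := fun i j =>
    Algebra.subset_adjoin (Or.inl (Or.inr ⟨(i, j), rfl⟩))
  have h3 : (fun m : Levi => (m.2.2 : ℂ)) ∈ leviFunctions :=
    Algebra.subset_adjoin (Or.inr (Or.inl rfl))
  have h4 : (fun m : Levi => ((m.2.2⁻¹ : ℂˣ) : ℂ)) ∈ leviFunctions :=
    Algebra.subset_adjoin (Or.inr (Or.inr rfl))
  have h0 : (fun _ : Levi => (0 : ℂ)) ∈ leviFunctions := zero_mem _
  have h5 : ∀ m : Levi, (((m⁻¹).2.2⁻¹ : ℂˣ) : ℂ) = m.2.2 := fun m => by simp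
  rcases i with i | i <;> rcases j with j | j
  · refine ⟨h1 i j, ?_⟩
    have := adjugate_mem h1 i j
    simpa [leviMatrix] using this
  · exact ⟨h0, h0⟩
  · exact ⟨h0, h0⟩
  · refine ⟨mul_mem h4 (h2 i j), ?_⟩
    have := mul_mem h3 (adjugate_mem h2 i j)
    simp only [leviMatrix, Matrix.fromBlocks_apply₂₂, h5]
    simp only [Prod.snd_inv, Prod.fst_inv, Matrix.SpecialLinearGroup.coe_inv, Matrix.smul_apply,
      smul_eq_mul]
    exact this

open FockFrame in
/-- The lift depends regularly on the matrices, because its actions on vectors and on the vacuum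
do. -/
theorem isRegular_leviLift (e : Module.Basis (Fin 5) ℂ L) (F : FockFrame L (Fin 3 ⊕ Fin 2)) :
    IsRegular leviFunctions fun m : Levi => (F.leviLift m).1 := by
  refine IsRegular.spin_of_apply e F.vacuum_ne_zero ?_ fun v => ?_
  · simp only [(F.isLift_leviLift _).vacuum]
    exact IsRegular.smul (Algebra.subset_adjoin (Or.inr (Or.inr rfl))) (IsRegular.const _)
  · have hb : ∀ j, IsRegular leviFunctions fun m : Levi => ad (F.leviLift m) (F.b j) := fun j => by
      simp only [(F.isLift_leviLift _).b]
      exact IsRegular.sum _ fun i _ => IsRegular.smul (leviMatrix_mem i j).1 (IsRegular.const _)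
    have ha : ∀ j, IsRegular leviFunctions fun m : Levi => ad (F.leviLift m) (F.a j) := fun j => by
      simp only [(F.isLift_leviLift _).a]
      exact IsRegular.sum _ fun i _ => IsRegular.smul (leviMatrix_mem j i).2 (IsRegular.const _)
    rw [F.expand e (by simp) v]
    simp only [map_add, map_sum, map_smul]
    exact IsRegular.add (IsRegular.sum _ fun i _ => IsRegular.const_smul _ (ha i))
      (IsRegular.sum _ fun i _ => IsRegular.const_smul _ (hb i))

theorem isRegular_scaling (w : Module.Basis (Fin 2) ℂ W) :
    IsRegular leviFunctions fun m : Levi => (scaling w m.2.2 : W →ₗ[ℂ] W) := by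
  have : Module.Finite ℂ W := Module.Finite.of_basis w
  refine IsRegular.of_apply fun x => ?_
  rw [← w.sum_repr x, Fin.sum_univ_two]
  simp only [map_add, map_smul, LinearEquiv.coe_coe, scaling_zero, scaling_one,
    ← Units.val_inv_eq_inv_val]
  exact IsRegular.add (IsRegular.const_smul _ (IsRegular.smul
      (Algebra.subset_adjoin (Or.inr (Or.inl rfl))) (IsRegular.const _)))
    (IsRegular.const_smul _ (IsRegular.smul
      (Algebra.subset_adjoin (Or.inr (Or.inr rfl))) (IsRegular.const _)))

namespace AdaptedFrame

open FockFrame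

variable {B : LinearMap.BilinForm ℂ W} {Q : Supercharge L W} (D : AdaptedFrame B Q)

theorem isBiregular_leviEquiv (e : Module.Basis (Fin 5) ℂ L) :
    IsBiregular leviFunctions
      (groupFunctions B fun h : (D.leviHom e).range => (h : specialStab B Q).1)
      (D.leviEquiv e).toEquiv := by
  set j := fun h : (D.leviHom e).range => (h : specialStab B Q).1 with hj
  refine isBiregular_groupFunctions (isRegular_leviLift e D.F) (isRegular_scaling D.w) ?_
  have hm : ∀ h, (j h).1 = D.F.leviLift ((D.leviEquiv e).symm h) := fun h => by
    rw [← leviHom_apply_fst D e, ← coe_leviEquiv, MulEquiv.apply_symm_apply]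
  have hm2 : ∀ h, (j h).2.1 = scaling D.w ((D.leviEquiv e).symm h).2.2 := fun h => by
    rw [← leviHom_apply_snd D e, ← coe_leviEquiv, MulEquiv.apply_symm_apply]
  have h1 : (fun h => (((D.leviEquiv e).symm h).2.2 : ℂ)) ∈ groupFunctions B j := by
    have := (isRegular_orthogonal j).map (LinearMap.applyₗ (D.w 0)) (D.w.coord 0)
    simpa [hm2, scaling_zero] using this
  have h2 : (fun h => ((((D.leviEquiv e).symm h).2.2⁻¹ : ℂˣ) : ℂ)) ∈ groupFunctions B j := by
    have := (isRegular_orthogonal j).map (LinearMap.applyₗ (D.w 1)) (D.w.coord 1)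
    simpa [hm2, scaling_one] using this
  rintro _ ((⟨⟨i, k⟩, rfl⟩ | ⟨⟨i, k⟩, rfl⟩) | (rfl | rfl))
  · have := isRegular_ad e j (D.F.k k) (LinearMap.dualProd ℂ L (D.F.k' i))
    simp only [hm, leviLift_coord_k] at this
    exact this
  · have := mul_mem h1 (isRegular_ad e j (D.F.p k) (LinearMap.dualProd ℂ L (D.F.q i)))
    simp only [hm] at this
    convert this using 1
    funext h
    exact (D.F.leviLift_coord_p _ i k).symm
  · exact h1
  · exact h2

end AdaptedFrame

variable {L : Type*} [AddCommGroup L] [Module ℂ L] {W : Type*} [AddCommGroup W] [Module ℂ W]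

/-! ### The Levi decomposition -/

namespace FockFrame

variable {F : FockFrame L (Fin 3 ⊕ Fin 2)}

theorem eq_sum_of_mem_K (e : Module.Basis (Fin 5) ℂ L) {x : Vec L} (hx : x ∈ F.K) :
    x = ∑ i, LinearMap.dualProd ℂ L (F.k' i) x • F.k i := by
  have h1 : ∀ i, LinearMap.dualProd ℂ L (F.k i) x = 0 := F.mem_orth_K.mp (F.K_le_orth hx)
  have h2 : ∀ j, LinearMap.dualProd ℂ L (F.p j) x = 0 := fun j => by
    rw [dualProd_comm]; exact F.p_mem_orth j x hx
  have h3 : ∀ j, LinearMap.dualProd ℂ L (F.q j) x = 0 := fun j => by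
    rw [dualProd_comm]; exact F.q_mem_orth j x hx
  conv_lhs => rw [F.expand' e x]
  simp only [h1, h2, h3, zero_smul, Finset.sum_const_zero, zero_add]

/-- Elements that agree on `K`, and on `K^⟂` modulo `K`, differ by a unipotent element. -/
theorem inv_mul_mem_unip (e : Module.Basis (Fin 5) ℂ L) {g g' : spinGroup (vecForm L)}
    (hK : ∀ x ∈ F.K, ad g⁻¹ x ∈ F.K) (hk : ∀ j, ad g (F.k j) = ad g' (F.k j))
    (hp : ∀ j, ad g (F.p j) - ad g' (F.p j) ∈ F.K)
    (hq : ∀ j, ad g (F.q j) - ad g' (F.q j) ∈ F.K) : g'⁻¹ * g ∈ F.unip := by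
  have h1 : ∀ x ∈ F.K, ad g x = ad g' x := by
    intro x hx
    rw [eq_sum_of_mem_K e hx]
    simp only [map_sum, map_smul, hk]
  have h2 : ∀ x ∈ F.K, ad g'⁻¹ x ∈ F.K := by
    intro x hx
    have h3 := h1 _ (hK x hx)
    rw [ad_ad_inv] at h3
    rw [h3, ad_inv_ad]
    exact hK x hx
  refine ⟨fun x hx => by rw [ad_mul_apply, h1 x hx, ad_inv_ad], fun x hx => ?_⟩
  have h3 : ad g x - ad g' x ∈ F.K := by
    have h4 : ad g x - ad g' x = (ad g - ad g') x := rfl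
    rw [h4, F.expand' e x]
    simp only [F.mem_orth_K.mp hx, zero_smul, Finset.sum_const_zero, zero_add, map_add, map_sum,
      map_smul, LinearMap.sub_apply]
    refine Submodule.add_mem _ (Submodule.add_mem _ ?_ ?_) ?_ <;>
      refine Submodule.sum_mem _ fun j _ => Submodule.smul_mem _ _ ?_
    · exact hq j
    · exact hp j
    · rw [hk, sub_self]; exact Submodule.zero_mem _
  have h5 := h2 _ h3
  rw [map_sub, ad_inv_ad] at h5
  rwa [ad_mul_apply]

/-- A unipotent element scales the vacuum by a sign: it differs by an element acting trivially on
`V` from a product of elements `1 + kᵢ x`, which fixes the vacuum. -/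
theorem sq_eq_one_of_mem_unip (e : Module.Basis (Fin 5) ℂ L) {n : spinGroup (vecForm L)}
    (hn : n ∈ F.unip) {r : ℂ} (hr : spinorRep L n.1 F.vacuum = r • F.vacuum) : r ^ 2 = 1 := by
  obtain ⟨s, hs, h⟩ := eq_algebraMap_of_ad_eq_id e (g := n * (F.unipElt (F.unipCoord n))⁻¹)
    fun v => by rw [ad_mul_apply, ← F.ad_unipElt_unipCoord e hn, ad_ad_inv]
  have h1 : spinorRep L (n * (F.unipElt (F.unipCoord n))⁻¹).1 F.vacuum = r • F.vacuum := by
    have h2 := F.unipElt_fix (F.unipCoord n) (ψ := F.vacuum) fun i => F.b_vacuum _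
    have h3 := spinorRep_inv_apply (F.unipElt (F.unipCoord n)) F.vacuum
    rw [h2] at h3
    rw [spinorRep_mul_apply, h3, hr]
  rw [h, AlgHom.commutes, Module.algebraMap_end_apply] at h1
  rw [← smul_left_injective ℂ F.vacuum_ne_zero h1, hs]

variable (F) in
/-- The action on `K` in the basis `k`. -/
def blockK (g : spinGroup (vecForm L)) : Matrix (Fin 3) (Fin 3) ℂ :=
  .of fun i j => LinearMap.dualProd ℂ L (F.k' i) (ad g (F.k j))

variable (F) in
/-- The action on the span of the `p` modulo `K`. -/
def blockP (g : spinGroup (vecForm L)) : Matrix (Fin 2) (Fin 2) ℂ :=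
  .of fun i j => LinearMap.dualProd ℂ L (F.q i) (ad g (F.p j))

variable (F) in
/-- The action on the span of the `q` modulo `K`. -/
def blockQ (g : spinGroup (vecForm L)) : Matrix (Fin 2) (Fin 2) ℂ :=
  .of fun i j => LinearMap.dualProd ℂ L (F.p i) (ad g (F.q j))

namespace Scales

variable {g : spinGroup (vecForm L)} {r r' : ℂ} (h : F.Scales g r r') (hr : r ≠ 0) (hr' : r' ≠ 0)
  (e : Module.Basis (Fin 5) ℂ L)

include h hr hr' e

theorem ad_k_eq (j : Fin 3) : ad g (F.k j) = ∑ i, F.blockK g i j • F.k i :=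
  eq_sum_of_mem_K e (h.ad_mem_K hr hr' e (F.k_mem j))

theorem ad_p_sub_mem (j : Fin 2) : ad g (F.p j) - ∑ i, F.blockP g i j • F.p i ∈ F.K := by
  have h1 : cliffordMul (ad g (F.p j)) F.vacuum = 0 := ad_mem_ann hr h.vacuum (F.b_vacuum _)
  have h2 : ∀ i, LinearMap.dualProd ℂ L (F.p i) (ad g (F.p j)) = 0 := fun i => by
    have := cliffordMul_anticomm (F.p i) (ad g (F.p j)) F.vacuum
    rw [h1, F.b_vacuum, map_zero, map_zero, sub_zero] at this
    exact (smul_eq_zero.mp this.symm).resolve_right F.vacuum_ne_zero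
  have h3 := F.mem_orth_K.mp (h.ad_mem_orth_K hr hr' e (F.p_mem_orth j))
  refine F.mem_K e (fun i => ?_) (fun i => ?_) fun i => ?_ <;> rw [map_sub, map_sum] <;>
    simp only [map_smul]
  · rw [h3]; simp [-LinearMap.dualProd_apply_apply, F.bb]
  · rw [h2]; simp [-LinearMap.dualProd_apply_apply, F.bb]
  · simp [-LinearMap.dualProd_apply_apply, F.ab, blockP]

theorem ad_q_sub_mem (j : Fin 2) : ad g (F.q j) - ∑ i, F.blockQ g i j • F.q i ∈ F.K := by
  have h1 : cliffordMul (ad g (F.q j)) F.second = 0 := ad_mem_ann hr' h.second (F.q_second _)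
  have h2 : ∀ i, LinearMap.dualProd ℂ L (F.q i) (ad g (F.q j)) = 0 := fun i => by
    have := cliffordMul_anticomm (F.q i) (ad g (F.q j)) F.second
    rw [h1, F.q_second, map_zero, map_zero, sub_zero] at this
    exact (smul_eq_zero.mp this.symm).resolve_right F.second_ne_zero
  have h3 := F.mem_orth_K.mp (h.ad_mem_orth_K hr hr' e (F.q_mem_orth j))
  refine F.mem_K e (fun i => ?_) (fun i => ?_) fun i => ?_ <;> rw [map_sub, map_sum] <;>
    simp only [map_smul]
  · rw [h3]; simp [-LinearMap.dualProd_apply_apply, F.ba]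
  · simp [-LinearMap.dualProd_apply_apply, F.ba, blockQ]
  · rw [h2]; simp [-LinearMap.dualProd_apply_apply, F.aa]

theorem det_blockK_ne_zero : (F.blockK g).det ≠ 0 := by
  have h1 : F.blockK g⁻¹ * F.blockK g = 1 := by
    ext i j
    have h2 := ad_inv_ad g (F.k j)
    rw [h.ad_k_eq hr hr' e, map_sum] at h2
    have h3 := congrArg (LinearMap.dualProd ℂ L (F.k' i)) h2
    rw [map_sum, F.ab] at h3
    simp only [map_smul] at h3
    rw [Matrix.mul_apply, Matrix.one_apply]
    convert h3 using 1
    · exact Finset.sum_congr rfl fun l _ => mul_comm _ _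
    · simp
  intro h0
  have := congrArg Matrix.det h1
  rw [Matrix.det_mul, h0, mul_zero, Matrix.det_one] at this
  exact zero_ne_one this

/-- The actions on the two Lagrangians of `K^⟂ / K` are contragredient. -/
theorem blockP_transpose_mul_blockQ : (F.blockP g).transpose * F.blockQ g = 1 := by
  ext j l
  have h1 := h.ad_p_sub_mem hr hr' e j
  have h2 := h.ad_q_sub_mem hr hr' e l
  have h3 := dualProd_ad g (F.p j) (F.q l)
  rw [F.ba] at h3
  have h4 : ad g (F.q l) ∈ orth F.K := h.ad_mem_orth_K hr hr' e (F.q_mem_orth l)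
  have h5 := h4 _ h1
  rw [map_sub, LinearMap.sub_apply, sub_eq_zero, h3, map_sum, LinearMap.sum_apply] at h5
  simp only [map_smul, LinearMap.smul_apply] at h5
  rw [Matrix.mul_apply, Matrix.one_apply]
  simp only [Sum.inr.injEq] at h5
  exact h5.symm

/-- The action on the second spinor determines the determinant of the action on `K^⟂ / K`. -/
theorem det_blockQ_mul : (F.blockQ g).det * r = r' := by
  have hK : ∀ {x : Vec L}, x ∈ F.K → cliffordMul x F.vacuum = 0 := fun {x} hx => by
    rw [F.K_eq e] at hx
    exact mem_ann.mp hx.1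
  have hd : ∀ j, ∃ x ∈ F.K, ad g (F.q j) = ∑ i, F.blockQ g i j • F.q i + x := fun j =>
    ⟨_, h.ad_q_sub_mem hr hr' e j, by abel⟩
  obtain ⟨x, hx, h0⟩ := hd 0
  obtain ⟨y, hy, h1⟩ := hd 1
  have h2 : LinearMap.dualProd ℂ L x (∑ i, F.blockQ g i 1 • F.q i) = 0 := by
    rw [map_sum]
    refine Finset.sum_eq_zero fun i _ => ?_
    rw [map_smul]
    exact (congrArg _ (F.q_mem_orth i x hx)).trans (smul_zero _)
  have h3 : spinorRep L g.1 F.second = ((F.blockQ g).det * r) • F.second := by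
    rw [FockFrame.second, spinorRep_cliffordMul, spinorRep_cliffordMul, h.vacuum, map_smul,
      map_smul, h0, h1, map_add (cliffordMul (L := L)) _ y, LinearMap.add_apply, hK hy, add_zero,
      map_add (cliffordMul (L := L)) _ x, LinearMap.add_apply, cliffordMul_anticomm x, h2, hK hx,
      map_zero, zero_smul, sub_zero, add_zero, F.cliffordMul_q_cliffordMul_q, smul_smul,
      mul_comm]
    rfl
  rw [h.second] at h3
  exact (smul_left_injective ℂ F.second_ne_zero h3).symm

/-- A lift of the diagonal blocks of `g` differs from `g` by a unipotent element. -/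
theorem inv_mul_mem_unip_of_isLift {g' : spinGroup (vecForm L)} {s : ℂ}
    {A' : Matrix (Fin 3) (Fin 3) ℂ} {C' : Matrix (Fin 2) (Fin 2) ℂ} (hC : C' * F.blockP g = 1)
    (hg' : F.IsLift (Matrix.fromBlocks (F.blockK g) 0 0 (F.blockP g))
      (Matrix.fromBlocks A' 0 0 C') s g') : g'⁻¹ * g ∈ F.unip := by
  have hCQ : C' = (F.blockQ g).transpose := by
    have h1 := congrArg Matrix.transpose (h.blockP_transpose_mul_blockQ hr hr' e)
    rw [Matrix.transpose_mul, Matrix.transpose_transpose, Matrix.transpose_one] at h1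
    have h2 := mul_eq_one_comm.mp h1
    calc C' = C' * (F.blockP g * (F.blockQ g).transpose) := by rw [h2, mul_one]
      _ = _ := by rw [← mul_assoc, hC, one_mul]
  refine inv_mul_mem_unip e (fun x hx => h.ad_inv_mem_K hr hr' e hx) (fun j => ?_) (fun j => ?_)
    fun j => ?_
  · rw [h.ad_k_eq hr hr' e, hg'.ad_k]
  · rw [hg'.ad_p]; exact h.ad_p_sub_mem hr hr' e j
  · rw [hg'.ad_q, hCQ]; exact h.ad_q_sub_mem hr hr' e j

omit hr hr' in
/-- The determinants of the diagonal blocks of an element that scales the two spinors inversely. -/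
theorem det_blocks {t : ℂˣ} (hrt : r = (t : ℂ)⁻¹) (hrt' : r' = t) :
    (F.blockK g).det = 1 ∧ (t : ℂ) ^ 2 * (F.blockP g).det = 1 := by
  have hr : r ≠ 0 := hrt ▸ inv_ne_zero t.ne_zero
  have hr' : r' ≠ 0 := hrt' ▸ t.ne_zero
  have hPQ := congrArg Matrix.det (h.blockP_transpose_mul_blockQ hr hr' e)
  rw [Matrix.det_mul, Matrix.det_transpose, Matrix.det_one] at hPQ
  have hQ : (F.blockQ g).det = (t : ℂ) ^ 2 := by
    have h1 := h.det_blockQ_mul hr hr' e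
    rw [hrt, hrt', mul_inv_eq_iff_eq_mul₀ t.ne_zero] at h1
    rw [h1, pow_two]
  rw [hQ] at hPQ
  refine ⟨?_, by rw [mul_comm, hPQ]⟩
  have hA := h.det_blockK_ne_zero hr hr' e
  have hC : (F.blockP g).det ≠ 0 := left_ne_zero_of_mul_eq_one hPQ
  -- compare with a lift of the diagonal blocks: the quotient is unipotent up to sign
  have hG : (Matrix.fromBlocks (F.blockK g) 0 0 (F.blockP g)).det =
      (F.blockK g).det * (F.blockP g).det := Matrix.det_fromBlocks_zero₂₁ _ _ _
  have hinv : (Matrix.fromBlocks (F.blockK g) 0 0 (F.blockP g))⁻¹ =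
      Matrix.fromBlocks (F.blockK g)⁻¹ 0 0 (F.blockP g)⁻¹ := by
    apply Matrix.inv_eq_right_inv
    rw [Matrix.fromBlocks_multiply, ← Matrix.fromBlocks_one]
    simp [Matrix.mul_nonsing_inv _ hA.isUnit, Matrix.mul_nonsing_inv _ hC.isUnit]
  obtain ⟨s, hs⟩ := IsAlgClosed.exists_pow_nat_eq ((F.blockK g).det * (F.blockP g).det) two_pos
  have hs0 : s ≠ 0 := by
    rintro rfl
    exact mul_ne_zero hA hC (by rw [← hs]; simp)
  obtain ⟨g', hg'⟩ := F.exists_isLift _ hs0 (hs.trans hG.symm)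
  rw [hinv] at hg'
  have hn := h.inv_mul_mem_unip_of_isLift hr hr' e (Matrix.nonsing_inv_mul _ hC.isUnit) hg'
  have h2 : spinorRep L (g'⁻¹ * g).1 F.vacuum = (s⁻¹ * r) • F.vacuum := by
    have h3 : spinorRep L g'⁻¹.1 F.vacuum = s⁻¹ • F.vacuum := by
      rw [eq_inv_smul_iff₀ hs0, ← map_smul, ← hg'.vacuum, spinorRep_inv_apply]
    rw [spinorRep_mul_apply, h.vacuum, map_smul, h3, smul_smul, mul_comm]
  have h4 := sq_eq_one_of_mem_unip e hn h2
  rw [mul_pow, inv_pow, hs, hrt, inv_pow] at h4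
  have ht := t.ne_zero
  field_simp at h4
  linear_combination -(F.blockK g).det * hPQ - h4

end Scales

end FockFrame

namespace AdaptedFrame

open FockFrame

variable {B : LinearMap.BilinForm ℂ W} {Q : Supercharge L W} (D : AdaptedFrame B Q)

theorem leviHom_mem_radical (e : Module.Basis (Fin 5) ℂ L) {m : Levi}
    (hm : D.leviHom e m ∈ D.radical) : m = 1 := by
  rw [mem_radical] at hm
  have ht : m.2.2 = 1 := (D.leviHom_snd_eq_one_iff e m).mp hm.2
  have hg := hm.1
  rw [leviHom_apply_fst] at hg
  refine Prod.ext (Subtype.ext (Matrix.ext fun i j => ?_))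
    (Prod.ext (Subtype.ext (Matrix.ext fun i j => ?_)) ht)
  · have := D.F.leviLift_coord_k m i j
    rw [hg.1 _ (D.F.k_mem j), D.F.ab] at this
    rw [← this]
    simp [Matrix.one_apply]
  · have h1 := D.F.leviLift_coord_p m i j
    have h2 := D.F.q_mem_orth i _ (hg.2 _ (D.F.p_mem_orth j))
    rw [dualProd_comm, map_sub, sub_eq_zero] at h2
    rw [h2, D.F.ab, ht] at h1
    rw [← h1]
    simp [Matrix.one_apply]

/-- Every element of the stabilizer is the product of an element of the Levi factor and one of the
unipotent radical. -/
theorem exists_leviHom_inv_mul_mem (e : Module.Basis (Fin 5) ℂ L) (s : specialStab B Q) :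
    ∃ m, (D.leviHom e m)⁻¹ * s ∈ D.radical := by
  obtain ⟨t, ht, h⟩ := D.exists_scales s
  have hr := inv_ne_zero t.ne_zero
  obtain ⟨hA, hC⟩ := h.det_blocks e rfl rfl
  have hC' : ((t : ℂ) • D.F.blockP s.1.1).det = 1 := by
    rw [Matrix.det_smul, Fintype.card_fin, hC]
  let m : Levi := (⟨_, hA⟩, ⟨_, hC'⟩, t)
  refine ⟨m, D.mem_radical.mpr ⟨?_, ?_⟩⟩
  · have hl := D.F.isLift_leviLift m
    have h1 : leviMatrix m = Matrix.fromBlocks (D.F.blockK s.1.1) 0 0 (D.F.blockP s.1.1) := by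
      simp [leviMatrix, m, smul_smul]
    have h2 : leviMatrix m⁻¹ * leviMatrix m = 1 := by
      rw [← leviMatrix_mul, inv_mul_cancel, leviMatrix_one]
    rw [h1, leviMatrix, Matrix.fromBlocks_multiply, ← Matrix.fromBlocks_one,
      Matrix.fromBlocks_inj] at h2
    rw [h1, leviMatrix] at hl
    refine h.inv_mul_mem_unip_of_isLift hr t.ne_zero e ?_ hl
    simpa using h2.2.2.2
  · change (⟨scaling D.w t, D.hw.scaling_mem t⟩ : orthogonal B)⁻¹ * s.1.2 = 1
    rw [inv_mul_eq_one]
    exact Subtype.ext ht.symm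

theorem isComplement_radical_levi (e : Module.Basis (Fin 5) ℂ L) :
    Subgroup.IsComplement' D.radical (D.leviHom e).range := by
  apply Subgroup.isComplement'_of_disjoint_and_mul_eq_univ
  · rw [Subgroup.disjoint_def]
    rintro _ hx ⟨m, rfl⟩
    rw [D.leviHom_mem_radical e hx, map_one]
  · refine Set.eq_univ_of_forall fun s => ?_
    obtain ⟨m, hm⟩ := D.exists_leviHom_inv_mul_mem e s
    refine ⟨s * (D.leviHom e m)⁻¹, ?_, D.leviHom e m, ⟨m, rfl⟩, by simp⟩
    have := (D.radical_normal e).conj_mem _ hm (D.leviHom e m)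
    simpa using this

end AdaptedFrame

/-! ### The components of the stabilizer -/

namespace FockFrame

variable (F : FockFrame L (Fin 3 ⊕ Fin 2))

/-- The two spinors are exchanged by a product of four vectors: `p₁ + q₁` and `i (p₀ - q₀)`, of
norm `1`, exchange them up to a factor `i`, and two vectors in the plane of `k₀, k'₀` contribute a
factor `-i`. -/
theorem exists_swap : ∃ g : spinGroup (vecForm L), spinorRep L g.1 F.vacuum = F.second ∧
    spinorRep L g.1 F.second = F.vacuum := by
  have hI := Complex.I_mul_I
  have h1 := ι_mul_ι_mem_spinGroup (v := (1 : ℂ) • F.p 1 + (1 : ℂ) • F.q 1)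
    (w := Complex.I • F.p 0 + (-Complex.I) • F.q 0) (by
      rw [vecForm_smul_b_add_smul_a, vecForm_smul_b_add_smul_a]; linear_combination -hI)
  have h2 := ι_mul_ι_mem_spinGroup (v := (1 : ℂ) • F.k 0 + (-1 : ℂ) • F.k' 0)
    (w := (-Complex.I) • F.k 0 + (-Complex.I) • F.k' 0) (by
      rw [vecForm_smul_b_add_smul_a, vecForm_smul_b_add_smul_a]; linear_combination -hI)
  have hqp : cliffordMul (F.p 1) (cliffordMul (F.q 0) F.vacuum) = 0 := by
    rw [cliffordMul_anticomm, F.b_vacuum, F.ba]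
    simp
  have hpq : cliffordMul (F.p 1) (cliffordMul (F.q 1) F.vacuum) = F.vacuum := by
    rw [cliffordMul_anticomm, F.b_vacuum, F.ba]
    simp
  have hqq : cliffordMul (F.q 1) (cliffordMul (F.q 0) F.vacuum) = -F.second := by
    rw [cliffordMul_anticomm, F.aa, zero_smul, zero_sub, second]
  have hq1 : cliffordMul (F.q 1) (cliffordMul (F.q 1) F.vacuum) = 0 := F.a_a_self _ _
  have hp0 : cliffordMul (F.p 0) F.second = cliffordMul (F.q 1) F.vacuum := by
    rw [second, cliffordMul_anticomm, cliffordMul_anticomm (F.p 0) (F.q 1), F.b_vacuum, F.ba,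
      F.ba]
    simp
  have hk : ∀ ψ, cliffordMul (F.k 0) ψ = 0 →
      cliffordMul (F.k 0) (cliffordMul (F.k' 0) ψ) = ψ := fun ψ hψ => by
    rw [cliffordMul_anticomm, hψ, F.ba]
    simp
  have hkk : ∀ ψ, cliffordMul (F.k' 0) (cliffordMul (F.k' 0) ψ) = 0 := F.a_a_self _
  refine ⟨⟨_, h1⟩ * ⟨_, h2⟩, ?_, ?_⟩
  · rw [spinorRep_mul_apply]
    simp only [map_mul, map_add, map_smul, spinorRep_ι, Module.End.mul_apply, LinearMap.add_apply,
      LinearMap.smul_apply, F.b_vacuum, hk _ (F.b_vacuum _), hkk, hqp, hqq, smul_zero, zero_add,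
      add_zero, one_smul, smul_neg, smul_smul]
    rw [show -Complex.I * -Complex.I = (-1 : ℂ) by linear_combination hI, neg_one_smul, neg_neg]
  · rw [spinorRep_mul_apply]
    simp only [map_mul, map_add, map_smul, spinorRep_ι, Module.End.mul_apply, LinearMap.add_apply,
      LinearMap.smul_apply, F.k_second, hk _ (F.k_second _), hkk, hp0, F.q_second, hpq, hq1,
      smul_zero, zero_add, add_zero, one_smul, smul_smul]
    rw [show (-Complex.I * Complex.I) = (1 : ℂ) by linear_combination -hI, one_smul]

end FockFrame

namespace AdaptedFrame

variable {B : LinearMap.BilinForm ℂ W} {Q : Supercharge L W} (D : AdaptedFrame B Q)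

include D in
/-- The exchange of `ψ₁, ψ₂` together with the exchange of `w₀, w₁`, of determinant `-1`, is an
element of the stabilizer outside `Stab₀(Q)`. -/
theorem relIndex_eq_two : (specialStab B Q).relIndex (stab B Q) = 2 := by
  obtain ⟨g, hg1, hg2⟩ := D.F.exists_swap
  let σ : W ≃ₗ[ℂ] W := D.w.equiv D.w (Equiv.swap 0 1)
  have h0 : σ (D.w 0) = D.w 1 := by simp [σ]
  have h1 : σ (D.w 1) = D.w 0 := by simp [σ]
  have hσ : σ ∈ orthogonal B := D.hw.mem_orthogonal (a := 0) (b := 1) (c := 1) (d := 0)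
    (by simp [h0]) (by simp [h1]) (by simp) (by simp) (by simp)
  have hdet : LinearEquiv.det σ = -1 := by
    ext
    rw [det_fin_two D.w (a := 0) (b := 1) (c := 1) (d := 0) (by simp [h0]) (by simp [h1])]
    simp
  have ha : ((g, ⟨σ, hσ⟩) : Sym L B) ∈ stab B Q :=
    (D.mem_stab_of_swap (s := (g, ⟨σ, hσ⟩)) h0 h1).mpr ⟨hg2, hg1⟩
  have hne : (-1 : ℂˣ) ≠ 1 := fun h => by
    have := congrArg Units.val h
    norm_num at this
  rw [Subgroup.relIndex_eq_two_iff]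
  refine ⟨_, ha, fun b hb => ?_⟩
  have hdetm : LinearEquiv.det (b * (g, ⟨σ, hσ⟩) : Sym L B).2.1 = -LinearEquiv.det b.2.1 := by
    change LinearEquiv.det (b.2.1 * σ) = _
    rw [map_mul, hdet, mul_neg, mul_one]
  rw [mem_specialStab_iff, mem_specialStab_iff, hdetm]
  rcases D.hw.det_eq_one_or_neg_one b.2.2 with h | h
  · exact Or.inr ⟨⟨hb, h⟩, fun h' => hne (by have := h'.2; rwa [h] at this)⟩
  · exact Or.inl ⟨⟨mul_mem hb ha, by rw [h, neg_neg]⟩, fun h' => hne (h.symm.trans h'.2)⟩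

end AdaptedFrame

/-! ### Isotropic subspaces and Euclidean real forms -/

section Euclidean

variable {L : Type*} [AddCommGroup L] [Module ℂ L]

/-- The expansion of a vector in an orthonormal basis. -/
theorem expand_of_orthonormal (e : Module.Basis (Fin 5) ℂ L) {ι : Type*} [Fintype ι]
    [DecidableEq ι] {u : ι → Vec L}
    (hu : ∀ i j, LinearMap.dualProd ℂ L (u i) (u j) = if i = j then 1 else 0)
    (hι : Fintype.card ι = 10) (v : Vec L) :
    v = ∑ i, LinearMap.dualProd ℂ L (u i) v • u i := by
  have hc : ∀ (c : ι → ℂ) j, LinearMap.dualProd ℂ L (u j) (∑ i, c i • u i) = c j := by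
    intro c j
    rw [map_sum]
    simp only [map_smul, hu]
    simp
  have hli : LinearIndependent ℂ u := by
    rw [Fintype.linearIndependent_iff]
    intro c h j
    rw [← hc c j, h, map_zero]
  have : Module.Finite ℂ L := Module.Finite.of_basis e
  have : Nonempty ι := Fintype.card_pos_iff.mp (by omega)
  let b := basisOfLinearIndependentOfCardEqFinrank hli (hι.trans (finrank_vec e).symm)
  have hb : ∀ i, b i = u i := fun i => by simp [b]
  have h := b.sum_repr v
  simp only [hb] at h
  conv_rhs => rw [← h]
  simp only [hc]
  exact h.symm

variable {j : EuclideanSpace ℝ (Fin 10) →ₗ[ℝ] Vec L}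

theorem dualProd_of_orthonormalBasis (hj : IsEuclideanForm j) {ι : Type*} [Fintype ι]
    [DecidableEq ι] (u : OrthonormalBasis ι ℝ (EuclideanSpace ℝ (Fin 10))) (i k : ι) :
    LinearMap.dualProd ℂ L (j (u i)) (j (u k)) = if i = k then 1 else 0 := by
  rw [hj, orthonormal_iff_ite.mp u.orthonormal]
  split_ifs <;> simp

/-- A vector of `V`, split into its real and imaginary parts with respect to a real form. -/
theorem exists_coordinates (e : Module.Basis (Fin 5) ℂ L) (hj : IsEuclideanForm j) :
    ∃ C : Vec L →ₗ[ℂ] EuclideanSpace ℂ (Fin 10), Function.Injective C ∧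
      ∀ v, v = j (WithLp.toLp 2 fun i => (C v i).re) +
        Complex.I • j (WithLp.toLp 2 fun i => (C v i).im) := by
  let ε := EuclideanSpace.basisFun (Fin 10) ℝ
  have hexp := expand_of_orthonormal e (dualProd_of_orthonormalBasis hj ε) (by simp)
  let C : Vec L →ₗ[ℂ] EuclideanSpace ℂ (Fin 10) :=
    (WithLp.linearEquiv 2 ℂ (Fin 10 → ℂ)).symm.toLinearMap ∘ₗ
      LinearMap.pi fun i => LinearMap.dualProd ℂ L (j (ε i))
  have hC : ∀ v i, C v i = LinearMap.dualProd ℂ L (j (ε i)) v := fun v i => rfl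
  have hjx : ∀ x : EuclideanSpace ℝ (Fin 10), j x = ∑ i, ((x i : ℝ) : ℂ) • j (ε i) := by
    intro x
    conv_lhs => rw [← ε.sum_repr x, map_sum]
    refine Finset.sum_congr rfl fun i _ => ?_
    rw [map_smul, Complex.coe_smul, EuclideanSpace.basisFun_repr]
  refine ⟨C, fun v w h => ?_, fun v => ?_⟩
  · rw [hexp v, hexp w]
    refine Finset.sum_congr rfl fun i _ => ?_
    rw [← hC, ← hC, h]
  · rw [hjx, hjx, Finset.smul_sum, ← Finset.sum_add_distrib]
    conv_lhs => rw [hexp v]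
    refine Finset.sum_congr rfl fun i _ => ?_
    rw [← hC, smul_smul, ← add_smul, mul_comm Complex.I, Complex.re_add_im]

theorem dualProd_add_I_smul (hj : IsEuclideanForm j) (x y x' y' : EuclideanSpace ℝ (Fin 10)) :
    LinearMap.dualProd ℂ L (j x + Complex.I • j y) (j x' + Complex.I • j y') =
      ⟨inner ℝ x x' - inner ℝ y y', inner ℝ x y' + inner ℝ y x'⟩ := by
  simp only [map_add, map_smul, LinearMap.add_apply, LinearMap.smul_apply, hj _ _, smul_eq_mul]
  apply Complex.ext <;> simp <;> ring

theorem inner_eq_re_im (z z' : EuclideanSpace ℂ (Fin 10)) : inner ℂ z z' =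
    (⟨inner ℝ (WithLp.toLp 2 fun i => (z i).re : EuclideanSpace ℝ (Fin 10))
          (WithLp.toLp 2 fun i => (z' i).re) +
        inner ℝ (WithLp.toLp 2 fun i => (z i).im : EuclideanSpace ℝ (Fin 10))
          (WithLp.toLp 2 fun i => (z' i).im),
      inner ℝ (WithLp.toLp 2 fun i => (z i).re : EuclideanSpace ℝ (Fin 10))
          (WithLp.toLp 2 fun i => (z' i).im) -
        inner ℝ (WithLp.toLp 2 fun i => (z i).im : EuclideanSpace ℝ (Fin 10))
          (WithLp.toLp 2 fun i => (z' i).re)⟩ : ℂ) := by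
  simp only [PiLp.inner_apply]
  apply Complex.ext
  · simp only [Complex.re_sum, ← Finset.sum_add_distrib]
    refine Finset.sum_congr rfl fun i _ => ?_
    simp [mul_comm]
  · simp only [Complex.im_sum, ← Finset.sum_sub_distrib]
    refine Finset.sum_congr rfl fun i _ => ?_
    simp
    ring

/-- An isotropic subspace of dimension three is spanned by vectors `x + i y`, for orthogonal
families `x` and `y` of vectors of equal length in the real form. -/
theorem exists_orthogonal_of_isotropic (e : Module.Basis (Fin 5) ℂ L) (hj : IsEuclideanForm j)
    {K : Submodule ℂ (Vec L)} (hK : IsIsotropic K) (h3 : Module.finrank ℂ K = 3) :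
    ∃ x y : Fin 3 → EuclideanSpace ℝ (Fin 10),
      (∀ a b, inner ℝ (x a) (x b) = if a = b then (1 : ℝ) / 2 else 0) ∧
      (∀ a b, inner ℝ (y a) (y b) = if a = b then (1 : ℝ) / 2 else 0) ∧
      (∀ a b, inner ℝ (x a) (y b) = 0) ∧
      K = Submodule.span ℂ (Set.range fun a => j (x a) + Complex.I • j (y a)) := by
  obtain ⟨C, hinj, hC⟩ := exists_coordinates e hj
  have : Module.Finite ℂ L := Module.Finite.of_basis e
  have hfin : Module.finrank ℂ (K.map C) = 3 := by
    rw [← h3]; exact (K.equivMapOfInjective C hinj).finrank_eq.symm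
  let f := (stdOrthonormalBasis ℂ (K.map C)).reindex (finCongr hfin)
  choose k hk hkf using fun a => (f a).2
  have horth : ∀ a b, inner ℂ (C (k a)) (C (k b)) = if a = b then (1 : ℂ) else 0 := fun a b => by
    rw [hkf, hkf]
    exact orthonormal_iff_ite.mp f.orthonormal a b
  refine ⟨fun a => WithLp.toLp 2 fun i => (C (k a) i).re,
    fun a => WithLp.toLp 2 fun i => (C (k a) i).im, ?_⟩
  have h1 := fun a b => inner_eq_re_im (C (k a)) (C (k b))
  have h2 := fun a b => dualProd_add_I_smul hj (WithLp.toLp 2 fun i => (C (k a) i).re)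
    (WithLp.toLp 2 fun i => (C (k a) i).im) (WithLp.toLp 2 fun i => (C (k b) i).re)
    (WithLp.toLp 2 fun i => (C (k b) i).im)
  simp only [← hC] at h2 ⊢
  have hre1 := fun a b => congrArg Complex.re (h1 a b)
  have him1 := fun a b => congrArg Complex.im (h1 a b)
  have hre2 := fun a b => congrArg Complex.re (h2 a b)
  have him2 := fun a b => congrArg Complex.im (h2 a b)
  simp only [horth, hK _ (hk _) _ (hk _), Complex.zero_re, Complex.zero_im] at hre1 him1 hre2 him2
  have hite : ∀ a b : Fin 3, (if a = b then (1 : ℂ) else 0).re = (if a = b then 1 else 0) ∧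
      (if a = b then (1 : ℂ) else 0).im = 0 := fun a b => by split_ifs <;> simp
  have hhalf : ∀ a b : Fin 3, (if a = b then (1 : ℝ) / 2 else 0) = (if a = b then 1 else 0) / 2 :=
    fun a b => by split_ifs <;> simp
  refine ⟨fun a b => ?_, fun a b => ?_, fun a b => ?_, le_antisymm (fun v hv => ?_) ?_⟩
  · rw [hhalf]
    linear_combination -(hre1 a b + hre2 a b) / 2 + (hite a b).1 / 2
  · rw [hhalf]
    linear_combination -(hre1 a b - hre2 a b) / 2 + (hite a b).1 / 2
  · linear_combination -(him1 a b + him2 a b) / 2 + (hite a b).2 / 2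
  · have h4 := f.sum_repr ⟨C v, Submodule.mem_map_of_mem hv⟩
    have h5 := congrArg Subtype.val h4
    rw [Submodule.coe_sum] at h5
    simp only [Submodule.coe_smul, ← hkf, ← map_smul, ← map_sum] at h5
    rw [← hinj h5]
    exact Submodule.sum_mem _ fun a _ => Submodule.smul_mem _ _ (Submodule.subset_span ⟨a, rfl⟩)
  · rw [Submodule.span_le]
    rintro _ ⟨a, rfl⟩
    exact hk a

end Euclidean

section Twist

variable {L : Type*} [AddCommGroup L] [Module ℂ L]

/-- The real coordinates on `ℂᵃ × ℝᵇ`. -/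
def realCoordinates (a b : ℕ) :
    WithLp 2 (EuclideanSpace ℂ (Fin a) × EuclideanSpace ℝ (Fin b)) ≃ₗᵢ[ℝ]
      EuclideanSpace ℝ (Fin a ⊕ (Fin a ⊕ Fin b)) where
  toFun p := WithLp.toLp 2
    (Sum.elim (fun i => (p.fst i).re) (Sum.elim (fun i => (p.fst i).im) fun i => p.snd i))
  invFun c := WithLp.toLp 2 (WithLp.toLp 2 fun i => ⟨c (.inl i), c (.inr (.inl i))⟩,
    WithLp.toLp 2 fun i => c (.inr (.inr i)))
  map_add' p q := by
    ext i
    rcases i with i | i | i <;> simp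
  map_smul' r p := by
    ext i
    rcases i with i | i | i <;> simp
  left_inv p := rfl
  right_inv c := by
    ext i
    rcases i with i | i | i <;> rfl
  norm_map' p := by
    rw [← sq_eq_sq₀ (norm_nonneg _) (norm_nonneg _), EuclideanSpace.norm_sq_eq,
      WithLp.prod_norm_sq_eq_of_L2, EuclideanSpace.norm_sq_eq, EuclideanSpace.norm_sq_eq]
    simp [Fintype.sum_sum_type, Complex.sq_norm, Complex.normSq_apply, Finset.sum_add_distrib,
      ← pow_two, add_assoc]
    rfl

theorem sqrt_two_inner {n : ℕ} {x y : EuclideanSpace ℝ (Fin n)} :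
    inner ℝ (√2 • x) (√2 • y) = 2 * inner ℝ x y := by
  rw [real_inner_smul_left, real_inner_smul_right, ← mul_assoc, Real.mul_self_sqrt (by norm_num)]

/-- The twist whose surviving translations are dual to an isotropic subspace of dimension three
lives on `ℂ³ × ℝ⁴`. -/
theorem livesOn_of_isIsotropic_orth (e : Module.Basis (Fin 5) ℂ L) {E : Submodule ℂ (Vec L)}
    (hE : IsIsotropic (orth E)) (h3 : Module.finrank ℂ (orth E) = 3)
    {j : EuclideanSpace ℝ (Fin 10) →ₗ[ℝ] Vec L} (hj : IsEuclideanForm j) : LivesOn E 3 4 j := by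
  obtain ⟨x, y, hx, hy, hxy, hK⟩ := exists_orthogonal_of_isotropic e hj hE h3
  have hyx : ∀ a b, inner ℝ (y a) (x b) = 0 := fun a b => by rw [real_inner_comm, hxy]
  -- complete the real and imaginary parts of a basis of `orth E` to an orthonormal basis of `ℝ¹⁰`
  let v : Fin 3 ⊕ (Fin 3 ⊕ Fin 4) → EuclideanSpace ℝ (Fin 10) :=
    Sum.elim (fun a => √2 • x a) (Sum.elim (fun a => √2 • y a) 0)
  obtain ⟨u, hu⟩ := Orthonormal.exists_orthonormalBasis_extension_of_card_eq (𝕜 := ℝ)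
    (ι := Fin 3 ⊕ (Fin 3 ⊕ Fin 4)) (by simp) (v := v)
    (s := Set.range (Sum.map id (Sum.inl : Fin 3 → Fin 3 ⊕ Fin 4))) (by
      rw [orthonormal_iff_ite]
      rintro ⟨_, a, rfl⟩ ⟨_, b, rfl⟩
      rcases a with a | a <;> rcases b with b | b <;>
        simp [v, sqrt_two_inner, hx, hy, hxy, hyx])
  have hux : ∀ a, u (.inl a) = √2 • x a := fun a => hu _ ⟨.inl a, rfl⟩
  have huy : ∀ a, u (.inr (.inl a)) = √2 • y a := fun a => hu _ ⟨.inr a, rfl⟩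
  have hdual := dualProd_of_orthonormalBasis hj u
  have hexp := expand_of_orthonormal e hdual (by simp)
  let φ := (realCoordinates 3 4).trans u.repr.symm
  have hφ : ∀ (z : EuclideanSpace ℂ (Fin 3)) (s : EuclideanSpace ℝ (Fin 4)),
      j (φ (WithLp.toLp 2 (z, s))) = ∑ a, ((z a).re : ℂ) • j (u (.inl a)) +
        (∑ a, ((z a).im : ℂ) • j (u (.inr (.inl a))) +
          ∑ b, (s b : ℂ) • j (u (.inr (.inr b)))) := by
    intro z s
    change j (u.repr.symm _) = _
    rw [← u.sum_repr (u.repr.symm _), map_sum, Fintype.sum_sum_type, Fintype.sum_sum_type]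
    simp only [map_smul, LinearIsometryEquiv.apply_symm_apply, Complex.coe_smul]
    rfl
  -- the antiholomorphic translations of `ℂ³`, which span `orth E`
  let κ : Fin 3 → Vec L := fun a => j (u (.inl a)) + Complex.I • j (u (.inr (.inl a)))
  have hκ : ∀ a, κ a = (√2 : ℂ) • (j (x a) + Complex.I • j (y a)) := fun a => by
    simp only [κ, hux, huy, map_smul, ← Complex.coe_smul, smul_add]
    rw [smul_comm]
  have hκK : ∀ a, κ a ∈ orth E := fun a => by
    rw [hκ, hK]
    exact Submodule.smul_mem _ _ (Submodule.subset_span ⟨a, rfl⟩)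
  have hanti : ∀ z : EuclideanSpace ℂ (Fin 3), j (φ (WithLp.toLp 2 (z, 0))) +
      Complex.I • j (φ (WithLp.toLp 2 (Complex.I • z, 0))) =
        ∑ a, (starRingEnd ℂ (z a)) • κ a := by
    intro z
    rw [hφ, hφ]
    simp only [PiLp.zero_apply, Complex.ofReal_zero, zero_smul, Finset.sum_const_zero, add_zero,
      Finset.smul_sum, smul_add, smul_smul, ← Finset.sum_add_distrib]
    refine Finset.sum_congr rfl fun a _ => ?_
    have h1 : (Complex.I • z) a = Complex.I * z a := rfl
    have h2 : starRingEnd ℂ (z a) = (z a).re - (z a).im * Complex.I := by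
      apply Complex.ext <;> simp
    rw [h1, h2, Complex.I_mul_re, Complex.I_mul_im, Complex.ofReal_neg]
    have hI := Complex.I_mul_I
    simp only [κ, smul_add, smul_smul]
    rw [show ((z a).re - (z a).im * Complex.I) * Complex.I =
      ((z a).im : ℂ) + Complex.I * (z a).re by linear_combination -((z a).im : ℂ) * hI]
    module
  have hEorth : ∀ w, w ∈ E ↔ ∀ a, LinearMap.dualProd ℂ L (κ a) w = 0 := by
    intro w
    have h2 : (√2 : ℂ) ≠ 0 := by simp
    rw [show w ∈ E ↔ w ∈ orth (orth E) by rw [orthogonal_orthogonal_dualProd e E], mem_orth]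
    refine ⟨fun h a => h _ (hκK a), fun h y hy => ?_⟩
    rw [hK] at hy
    induction hy using Submodule.span_induction with
    | zero => simp
    | add y y' _ _ h h' => rw [map_add, LinearMap.add_apply, h, h', add_zero]
    | smul c y _ h => rw [map_smul, LinearMap.smul_apply, h, smul_zero]
    | mem y hy =>
      obtain ⟨a, rfl⟩ := hy
      have h1 := h a
      rw [hκ, map_smul, LinearMap.smul_apply] at h1
      exact (smul_eq_zero.mp h1).resolve_left h2
  refine ⟨φ, le_antisymm (fun w hw => ?_) ?_⟩
  · rw [hexp w, Fintype.sum_sum_type, Fintype.sum_sum_type, ← add_assoc, ← Finset.sum_add_distrib]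
    refine Submodule.add_mem _ (Submodule.sum_mem _ fun a _ => ?_)
      (Submodule.sum_mem _ fun b _ => Submodule.smul_mem _ _ (Submodule.subset_span ?_))
    · have h1 := (hEorth w).mp hw a
      have h2 : LinearMap.dualProd ℂ L (j (u (.inl a))) w • j (u (.inl a)) +
          LinearMap.dualProd ℂ L (j (u (.inr (.inl a)))) w • j (u (.inr (.inl a))) =
          LinearMap.dualProd ℂ L (j (u (.inl a))) w • κ a := by
        have hI := Complex.I_mul_I
        simp only [κ, map_add, map_smul, LinearMap.add_apply, LinearMap.smul_apply,
          smul_eq_mul] at h1 ⊢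
        rw [smul_add, smul_smul]
        congr 2
        linear_combination -Complex.I * h1 + LinearMap.dualProd ℂ L (j (u (.inr (.inl a)))) w * hI
      rw [h2]
      refine Submodule.smul_mem _ _ (Submodule.subset_span (Or.inl ⟨EuclideanSpace.single a 1, ?_⟩))
      change j (φ (WithLp.toLp 2 (_, 0))) + Complex.I • j (φ (WithLp.toLp 2 (Complex.I • _, 0))) = _
      rw [hanti, Finset.sum_eq_single a]
      · simp
      · intro b _ hb
        simp [hb]
      · simp
    · refine Or.inr ⟨EuclideanSpace.single b 1, ?_⟩
      change j (φ (WithLp.toLp 2 (0, _))) = _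
      rw [hφ, Finset.sum_eq_single (f := fun b' => _ • j (u (.inr (.inr b')))) b]
      · simp
      · intro b' _ hb
        simp [hb]
      · simp
  · rw [Submodule.span_le]
    rintro _ (⟨z, rfl⟩ | ⟨s, rfl⟩)
    · change j (φ (WithLp.toLp 2 (z, 0))) + Complex.I • j (φ (WithLp.toLp 2 (Complex.I • z, 0))) ∈ E
      rw [hanti]
      refine Submodule.sum_mem _ fun a _ => Submodule.smul_mem _ _ ((hEorth _).mpr fun b =>
        hE _ (hκK b) _ (hκK a))
    · change j (φ (WithLp.toLp 2 (0, s))) ∈ E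
      rw [hφ]
      simp only [PiLp.zero_apply, Complex.zero_re, Complex.zero_im, Complex.ofReal_zero, zero_smul,
        Finset.sum_const_zero, zero_add]
      refine Submodule.sum_mem _ fun b _ => Submodule.smul_mem _ _ ((hEorth _).mpr fun a => ?_)
      simp [κ, -LinearMap.dualProd_apply_apply, hdual]

end Twist

/-! ### Supercharges of rank two on a line of pure spinors -/

section Supercharge

variable {L : Type*} [AddCommGroup L] [Module ℂ L] {W : Type*} [AddCommGroup W] [Module ℂ W]

theorem linearIndependent_of_finrank_range (w : Module.Basis (Fin 2) ℂ W) {Q : Supercharge L W}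
    (hrank : Module.finrank ℂ (LinearMap.range (toMap Q)) = 2) :
    LinearIndependent ℂ ![(toMap Q (w.coord 0) : Spinor L), (toMap Q (w.coord 1) : Spinor L)] := by
  have hspan : LinearMap.range (toMap Q) =
      Submodule.span ℂ (Set.range ![toMap Q (w.coord 0), toMap Q (w.coord 1)]) := by
    have h1 : LinearMap.range (toMap Q) = Submodule.map (toMap Q) ⊤ := LinearMap.range_eq_map _
    rw [h1, ← w.dualBasis.span_eq, Submodule.map_span, ← Set.range_comp]
    congr 2
    funext i
    fin_cases i <;> simp
  have h1 : LinearIndependent ℂ ![toMap Q (w.coord 0), toMap Q (w.coord 1)] := by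
    rw [linearIndependent_iff_card_eq_finrank_span, Set.finrank, ← hspan, hrank, Fintype.card_fin]
  have h2 := h1.map' (SPlus L).subtype (Submodule.ker_subtype _)
  have h3 : ![(toMap Q (w.coord 0) : Spinor L), (toMap Q (w.coord 1) : Spinor L)] =
      (SPlus L).subtype ∘ ![toMap Q (w.coord 0), toMap Q (w.coord 1)] := by
    funext i
    fin_cases i <;> rfl
  rw [h3]
  exact h2

/-- A supercharge of rank two whose image consists of pure spinors has an adapted frame. -/
theorem exists_adaptedFrame (e : Module.Basis (Fin 5) ℂ L) (hW : Module.finrank ℂ W = 2)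
    {B : LinearMap.BilinForm ℂ W} (hsymm : B.IsSymm) (hB : B.Nondegenerate) {Q : Supercharge L W}
    (hrank : Module.finrank ℂ (LinearMap.range (toMap Q)) = 2)
    (hpure : ∀ ψ ∈ LinearMap.range (toMap Q), ψ ≠ 0 → IsPure (ψ : Spinor L)) :
    Nonempty (AdaptedFrame B Q) := by
  obtain ⟨w, h00, h11, h01, h10⟩ := exists_null_basis hW hsymm hB
  have hli := linearIndependent_of_finrank_range w hrank
  have hp : ∀ f, (toMap Q f : Spinor L) ≠ 0 → IsPure (toMap Q f : Spinor L) := fun f hf =>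
    hpure _ ⟨f, rfl⟩ fun h => hf (by rw [h]; rfl)
  have h3 : (toMap Q (w.coord 0) : Spinor L) + (toMap Q (w.coord 1) : Spinor L) ≠ 0 := fun h => by
    have := LinearIndependent.pair_iff.mp hli 1 1 (by simpa using h)
    exact one_ne_zero this.1
  obtain ⟨F, hF0, hF1⟩ := exists_fockFrame e hli (hp _ (hli.ne_zero 0)) (hp _ (hli.ne_zero 1))
    (by
      have := hp (w.coord 0 + w.coord 1) (by rw [map_add]; exact h3)
      rwa [map_add] at this)
  have hF1' : F.second = (toMap Q (w.coord 1) : Spinor L) := by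
    rw [hF1, ← hF0]; rfl
  refine ⟨⟨F, w, ⟨h00, h11, h01, h10⟩, hF0 ▸ (toMap Q (w.coord 0)).2,
    hF1' ▸ (toMap Q (w.coord 1)).2, ?_⟩⟩
  conv_lhs => rw [supercharge_eq w Q]
  congr 2
  · exact Subtype.ext hF0.symm
  · exact Subtype.ext hF1'.symm

/-- The translations that are not in the image of the bracket with `Q` are dual to the common
annihilator of the spinors in the image of `Q`. -/
theorem AdaptedFrame.orth_range_bracket_eq (e : Module.Basis (Fin 5) ℂ L)
    {B : LinearMap.BilinForm ℂ W} {Q : Supercharge L W} (D : AdaptedFrame B Q) :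
    orth (LinearMap.range (bracket e B Q)) = D.F.K := by
  conv_lhs => rw [D.eq]
  rw [orth_range_bracket e D.hw.zero_zero D.hw.one_one D.hw.zero_one D.hw.one_zero, D.F.K_eq e]

end Supercharge

end IIB

end

theorem mainTheorem5 {L : Type*} [AddCommGroup L] [Module ℂ L] {W : Type*} [AddCommGroup W]
    [Module ℂ W] (e : Module.Basis (Fin 5) ℂ L) (hW : Module.finrank ℂ W = 2)
    (B : LinearMap.BilinForm ℂ W) (hsymm : B.IsSymm) (hB : B.Nondegenerate)
    (Q : IIB.Supercharge L W)
    (hrank : Module.finrank ℂ (LinearMap.range (IIB.toMap Q)) = 2)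
    (hpure : ∀ ψ ∈ LinearMap.range (IIB.toMap Q), ψ ≠ 0 → IIB.IsPure (ψ : IIB.Spinor L)) :
    -- the image of `[Q, -]` has dimension seven and three translations survive
    (Module.finrank ℂ (LinearMap.range (IIB.bracket e B Q)) = 7 ∧
      Module.finrank ℂ (IIB.Vec L ⧸ LinearMap.range (IIB.bracket e B Q)) = 3) ∧
    -- the twist lives on `ℂ³ × ℝ⁴`
    (∀ j : EuclideanSpace ℝ (Fin 10) →ₗ[ℝ] IIB.Vec L, IIB.IsEuclideanForm j →
      IIB.LivesOn (LinearMap.range (IIB.bracket e B Q)) 3 4 j) ∧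
    -- the stabilizer is `(SL(3) × SL(2) × ℂˣ) ⋉ N₁₅`, up to the two components of `O(W)`
    (IIB.specialStab B Q).relIndex (IIB.stab B Q) = 2 ∧
    ∃ (N H : Subgroup (IIB.specialStab B Q)) (Φ : (Fin 15 → ℂ) ≃ N) (Ψ : IIB.Levi ≃* H),
      N.Normal ∧ Group.IsNilpotent N ∧ Subgroup.IsComplement' N H ∧
      IIB.IsBiregular (IIB.affineFunctions 15)
        (IIB.groupFunctions B fun n : N => (n : IIB.specialStab B Q).1) Φ ∧
      IIB.IsBiregular IIB.leviFunctions
        (IIB.groupFunctions B fun h : H => (h : IIB.specialStab B Q).1) Ψ.toEquiv ∧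
      -- the factor `ℂˣ` is the part of the stabilizer that acts on `W`
      (∀ n : N, (n : IIB.specialStab B Q).1.2 = 1) ∧
      ∀ m : IIB.Levi, ((Ψ m : H) : IIB.specialStab B Q).1.2 = 1 ↔ m.2.2 = 1 := by
  obtain ⟨D⟩ := IIB.exists_adaptedFrame e hW hsymm hB hrank hpure
  have : Module.Finite ℂ L := Module.Finite.of_basis e
  have horth := D.orth_range_bracket_eq e
  have h3 : Module.finrank ℂ (IIB.orth (LinearMap.range (IIB.bracket e B Q))) = 3 := by
    rw [horth]; exact D.F.finrank_K e
  have h10 := IIB.finrank_add_finrank_orthogonal_dualProd e (LinearMap.range (IIB.bracket e B Q))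
  have hq := Submodule.finrank_quotient_add_finrank (LinearMap.range (IIB.bracket e B Q))
  rw [IIB.finrank_vec e] at hq
  refine ⟨⟨by omega, by omega⟩, fun j hj => IIB.livesOn_of_isIsotropic_orth e ?_ h3 hj,
    D.relIndex_eq_two, D.radical, (D.leviHom e).range,
    D.radicalEquiv e (Fintype.equivFinOfCardEq (by simp)), D.leviEquiv e, D.radical_normal e,
    D.radical_isNilpotent e, D.isComplement_radical_levi e, D.isBiregular_radicalEquiv e _,
    D.isBiregular_leviEquiv e, fun n => (D.mem_radical.mp n.2).2, D.leviHom_snd_eq_one_iff e⟩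
  rw [horth]
  exact fun v hv w hw => D.F.k_isotropic hv hw
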